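/- Let $\mathcal G$ be the semiring of isomorphism classes of finite simple graphs under disjoint union and strong product, preordered by $H\le G$ iff there is a graph homomorphism $\overline H\to\overline G$ between the complements. Let $\mathcal G_{\mathrm{nc}}$ be the semiring of unitary isomorphism classes of noncommutative graphs (subspaces $S=S^*\subseteq B(\mathcal H)$ with $I\in S$ and $\dim\mathcal H<\infty$) under direct sum and tensor product, preordered by $T\le S$ iff there are finitely many linear maps $E_i:\mathcal K\to\mathcal H$, where $T\subseteq B(\mathcal K)$ and $S\subseteq B(\mathcal H)$, with $\sum_iE_i^*E_i=I$ and $E_i^*SE_j\subseteq T$ for all $i,j$. A graph $G$ is identified with $\operatorname{span}\{|x\rangle\langle y| : x=y\text{ or }x\sim y\}\subseteq B(\mathbb C^{V(G)})$, and $\mathcal I_d$ denotes $\mathbb CI\subseteq B(\mathbb C^d)$. Let $\mathcal A\subseteq\mathcal G_{\mathrm{nc}}$ be the subsemiring generated by all graphs and all $\mathcal I_d$, with the restricted preorder. For a preordered semiring $R$, let $\Delta(R,\le)$ be the set of monotone semiring homomorphisms $R\to\mathbb R_{\ge0}$. For $f\in\Delta(\mathcal G,\le)$ and $\alpha\in[1,\infty)$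 let $f_\alpha:\mathcal A\to\mathbb R_{\ge0}$ be the semiring homomorphism $f_\alpha\bigl(\bigoplus_{d=1}^rG_d\otimes\mathcal I_d\bigr)=\sum_{d=1}^rf(G_d)d^\alpha$. The pair $(f,\alpha)$ is called admissible if $f_\alpha\in\Delta(\mathcal A,\le)$, i.e. if $f_\alpha$ is monotone. For $f\in\Delta(\mathcal G,\le)$, a nonempty graph $G$ and a probability distribution $Q$ on $V(G)$, let $f(G,Q)=\lim_{n\to\infty}f\bigl(G^{\boxtimes n}[T^n_{Q_n}]\bigr)^{1/n}$, where $Q_n\to Q$ is a sequence of distributions on $V(G)$ such that $nQ_n$ is integer valued, $T^n_{Q_n}\subseteq V(G)^n$ is the set of words in which each vertex $v$ occurs exactly $nQ_n(v)$ times, and $G^{\boxtimes n}[\,\cdot\,]$ denotes the induced subgraph of the strong power. For $S=\bigoplus_{d=1}^rG_d\otimes\mathcal I_d$ and a probability distribution $Q$ on $\bigsqcup_{d=1}^rV(G_d)$, let $$\log f_\alpha(S,Q)=H(\pi_*Q)+\sum_{d=1}^r\pi_*Q(d)\bigl[\log f(G_d,Q_d)+\alpha\log d\bigr],$$ where $\pi$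 sends the vertices of $G_d$ to $d$, $H$ is the Shannon entropy, $Q_d$ is the normalized restriction of $Q$ to $V(G_d)$, and terms with $\pi_*Q(d)=0$ are zero. **Theorem.** (1) For all $f\in\Delta(\mathcal G,\le)$, all nonempty $G$ and all $Q$, the limit $f(G,Q)$ exists, does not depend on the sequence $(Q_n)_n$, and is positive. (2) The set of functionals $(S,Q)\mapsto\log f_\alpha(S,Q)$ with $f\in\Delta(\mathcal G,\le)$, $\alpha\in[1,\infty)$ and $f_\alpha\in\Delta(\mathcal A,\le)$ is convex. (3) If $(f,\alpha)$ and $(g,\beta)$ are admissible with $f,g\in\Delta(\mathcal G,\le)$ and $\lambda\in[0,1]$, then there is an $h\in\Delta(\mathcal G,\le)$ with $\log h(G,Q)=\lambda\log f(G,Q)+(1-\lambda)\log g(G,Q)$ for every nonempty graph $G$ and every probability distribution $Q$ on $V(G)$, and the pair $(h,\lambda\alpha+(1-\lambda)\beta)$ is admissible. -/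

import Mathlib

open Matrix Filter Topology
open scoped NNReal Kronecker

namespace ZeroError

/-! ## The preordered semiring of graphs -/

/-- A finite simple undirected graph. -/
structure FinGraph : Type 1 where
  V : Type
  [fintypeV : Fintype V]
  [decEqV : DecidableEq V]
  graph : SimpleGraph V

attribute [instance] FinGraph.fintypeV FinGraph.decEqV

namespace FinGraph

/-- `g ≃ g'`: adjacent or equal. -/
def AdjEq (G : FinGraph) (x y : G.V) : Prop := x = y ∨ G.graph.Adj x y

theorem AdjEq.symm {G : FinGraph} {x y : G.V} (h : G.AdjEq x y) : G.AdjEq y x :=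
  h.elim (fun h => Or.inl h.symm) (fun h => Or.inr h.symm)

theorem AdjEq.refl {G : FinGraph} (x : G.V) : G.AdjEq x x := Or.inl rfl

/-- Isomorphism of graphs. -/
instance isoSetoid : Setoid FinGraph where
  r G H := Nonempty (G.graph ≃g H.graph)
  iseqv := ⟨fun _ => ⟨SimpleGraph.Iso.refl⟩, fun ⟨e⟩ => ⟨e.symm⟩, fun ⟨e⟩ ⟨f⟩ => ⟨f.comp e⟩⟩

/-- The empty graph. -/
abbrev empty : FinGraph := ⟨PEmpty, ⊥⟩

/-- The one-vertex graph. -/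
abbrev point : FinGraph := ⟨PUnit, ⊥⟩

/-- Disjoint union. -/
abbrev disjUnion (G H : FinGraph) : FinGraph := ⟨G.V ⊕ H.V, G.graph ⊕g H.graph⟩

/-- Strong product: `(g, h) ≃ (g', h')` iff `g ≃ g'` and `h ≃ h'`. -/
abbrev strongProd (G H : FinGraph) : FinGraph where
  V := G.V × H.V
  graph :=
    { Adj := fun x y => x ≠ y ∧ G.AdjEq x.1 y.1 ∧ H.AdjEq x.2 y.2
      symm := ⟨fun _ _ h => ⟨h.1.symm, h.2.1.symm, h.2.2.symm⟩⟩
      loopless := ⟨fun _ h => h.1 rfl⟩ }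

/-- `n`-fold strong power, on the words of length `n`. -/
def strongPow (G : FinGraph) (n : ℕ) : SimpleGraph (Fin n → G.V) where
  Adj x y := x ≠ y ∧ ∀ i, G.AdjEq (x i) (y i)
  symm := ⟨fun _ _ h => ⟨h.1.symm, fun i => (h.2 i).symm⟩⟩
  loopless := ⟨fun _ h => h.1 rfl⟩

/-- `H ≤ G`: there is a cohomomorphism, i.e. a homomorphism between the complements. -/
def CohomLE (H G : FinGraph) : Prop := Nonempty (H.graphᶜ →g G.graphᶜ)

theorem CohomLE.trans {G H K : FinGraph} (h₁ : CohomLE G H) (h₂ : CohomLE H K) : CohomLE G K :=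
  let ⟨f⟩ := h₁
  let ⟨g⟩ := h₂
  ⟨g.comp f⟩

theorem cohomLE_of_iso {G H : FinGraph} (h : G ≈ H) : CohomLE G H := by
  obtain ⟨e⟩ := h
  refine ⟨⟨e, ?_⟩⟩
  intro a b hab
  rw [SimpleGraph.compl_adj] at hab ⊢
  exact ⟨fun h => hab.1 (e.injective h), fun h => hab.2 (e.map_rel_iff.1 h)⟩

theorem iso_of_adjEq {G H : FinGraph} (e : G.V ≃ H.V)
    (h : ∀ x y, H.AdjEq (e x) (e y) ↔ G.AdjEq x y) : G ≈ H := by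
  refine ⟨⟨e, ?_⟩⟩
  intro a b
  have := h a b
  unfold AdjEq at this
  by_cases hab : a = b
  · subst hab; simp
  · simpa [hab] using this

theorem adjEq_iff_of_iso {G H : FinGraph} (e : G.graph ≃g H.graph) (x y : G.V) :
    H.AdjEq (e x) (e y) ↔ G.AdjEq x y := by
  unfold AdjEq
  rw [e.map_adj_iff, e.injective.eq_iff]

theorem strongProd_adjEq {G H : FinGraph} (x y : G.V × H.V) :
    (G.strongProd H).AdjEq x y ↔ G.AdjEq x.1 y.1 ∧ H.AdjEq x.2 y.2 := by
  constructor
  · rintro (h | h)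
    · subst h; exact ⟨AdjEq.refl _, AdjEq.refl _⟩
    · exact h.2
  · intro h
    by_cases hxy : x = y
    · exact Or.inl hxy
    · exact Or.inr ⟨hxy, h⟩

theorem disjUnion_adjEq {G H : FinGraph} (x y : G.V ⊕ H.V) :
    (G.disjUnion H).AdjEq x y ↔ Sum.LiftRel G.AdjEq H.AdjEq x y := by
  rcases x with x | x <;> rcases y with y | y <;>
    simp [AdjEq, disjUnion]

theorem disjUnion_congr {G G' H H' : FinGraph} (hG : G ≈ G') (hH : H ≈ H') :
    G.disjUnion H ≈ G'.disjUnion H' :=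
  let ⟨e⟩ := hG
  let ⟨f⟩ := hH
  ⟨e.sumCongr f⟩

theorem strongProd_congr {G G' H H' : FinGraph} (hG : G ≈ G') (hH : H ≈ H') :
    G.strongProd H ≈ G'.strongProd H' := by
  obtain ⟨e⟩ := hG
  obtain ⟨f⟩ := hH
  refine iso_of_adjEq (e.toEquiv.prodCongr f.toEquiv) fun x y => ?_
  rw [strongProd_adjEq, strongProd_adjEq]
  exact and_congr (adjEq_iff_of_iso e _ _) (adjEq_iff_of_iso f _ _)

end FinGraph

open FinGraph

/-- The set `𝒢` of isomorphism classes of finite graphs. -/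
def GraphClass : Type 1 := Quotient FinGraph.isoSetoid

/-- The isomorphism class of a graph. -/
def FinGraph.toClass (G : FinGraph) : GraphClass := Quotient.mk _ G

namespace GraphClass

instance : Zero GraphClass := ⟨FinGraph.empty.toClass⟩
instance : One GraphClass := ⟨FinGraph.point.toClass⟩
instance : Add GraphClass :=
  ⟨Quotient.map₂ FinGraph.disjUnion fun _ _ h _ _ h' => disjUnion_congr h h'⟩
instance : Mul GraphClass :=
  ⟨Quotient.map₂ FinGraph.strongProd fun _ _ h _ _ h' => strongProd_congr h h'⟩

protected theorem add_comm (a b : GraphClass) : a + b = b + a :=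
  Quotient.inductionOn₂ a b fun _ _ => Quotient.sound ⟨SimpleGraph.Iso.sumComm⟩

protected theorem mul_comm (a b : GraphClass) : a * b = b * a :=
  Quotient.inductionOn₂ a b fun _ _ => Quotient.sound <|
    iso_of_adjEq (Equiv.prodComm _ _) fun x y => by
      rw [strongProd_adjEq, strongProd_adjEq]; exact and_comm

protected theorem zero_add (a : GraphClass) : 0 + a = a :=
  Quotient.inductionOn a fun _ => Quotient.sound <|
    iso_of_adjEq (Equiv.emptySum PEmpty _) fun x y => by
      rw [disjUnion_adjEq]
      rcases x with x | x <;> rcases y with y | y <;> first | exact x.elim | exact y.elim | simp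

protected theorem one_mul (a : GraphClass) : 1 * a = a :=
  Quotient.inductionOn a fun _ => Quotient.sound <|
    iso_of_adjEq (Equiv.punitProd _) fun x y => by
      rw [strongProd_adjEq]
      exact ⟨fun h => ⟨Or.inl rfl, h⟩, fun h => h.2⟩

protected theorem zero_mul (a : GraphClass) : 0 * a = 0 :=
  Quotient.inductionOn a fun _ => Quotient.sound <|
    iso_of_adjEq (Equiv.pemptyProd _) fun x _ => x.1.elim

protected theorem add_mul (a b c : GraphClass) : (a + b) * c = a * c + b * c :=
  Quotient.inductionOn₃ a b c fun _ _ _ => Quotient.sound <|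
    iso_of_adjEq (Equiv.sumProdDistrib _ _ _) fun x y => by
      rw [strongProd_adjEq, disjUnion_adjEq, disjUnion_adjEq]
      rcases x with ⟨x | x, z⟩ <;> rcases y with ⟨y | y, w⟩ <;> simp [strongProd_adjEq]

instance : CommSemiring GraphClass where
  add_assoc a b c := Quotient.inductionOn₃ a b c fun _ _ _ =>
    Quotient.sound ⟨SimpleGraph.Iso.sumAssoc⟩
  zero_add := GraphClass.zero_add
  add_zero a := (GraphClass.add_comm a 0).trans (GraphClass.zero_add a)
  add_comm := GraphClass.add_comm
  nsmul := nsmulRec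
  mul_assoc a b c := Quotient.inductionOn₃ a b c fun _ _ _ => Quotient.sound <|
    iso_of_adjEq (Equiv.prodAssoc _ _ _) fun x y => by
      simp only [strongProd_adjEq]
      exact and_assoc.symm
  one_mul := GraphClass.one_mul
  mul_one a := (GraphClass.mul_comm a 1).trans (GraphClass.one_mul a)
  mul_comm := GraphClass.mul_comm
  zero_mul := GraphClass.zero_mul
  mul_zero a := (GraphClass.mul_comm a 0).trans (GraphClass.zero_mul a)
  right_distrib := GraphClass.add_mul
  left_distrib a b c := by
    rw [GraphClass.mul_comm, GraphClass.add_mul, GraphClass.mul_comm b, GraphClass.mul_comm c]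

/-- The cohomomorphism preorder on `𝒢`. -/
instance : Preorder GraphClass where
  le := Quotient.lift₂ FinGraph.CohomLE fun _ _ _ _ h h' => propext
    ⟨fun k => ((cohomLE_of_iso (Setoid.symm h)).trans k).trans (cohomLE_of_iso h'),
      fun k => ((cohomLE_of_iso h).trans k).trans (cohomLE_of_iso (Setoid.symm h'))⟩
  le_refl a := Quotient.inductionOn a fun _ => cohomLE_of_iso (Setoid.refl _)
  le_trans a b c := Quotient.inductionOn₃ a b c fun _ _ _ h₁ h₂ => CohomLE.trans h₁ h₂

end GraphClass

/-! ## The preordered semiring of noncommutative graphs -/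

/-- A noncommutative graph: a self-adjoint subspace of `B(ℂ^ι)` containing the identity. The
Hilbert space `ℂ^ι` comes with its standard orthonormal basis and the operators are written as
matrices; up to unitary isomorphism this covers all finite dimensional Hilbert spaces. -/
structure NCGraph : Type 1 where
  ι : Type
  [fintypeι : Fintype ι]
  [decEqι : DecidableEq ι]
  space : Submodule ℂ (Matrix ι ι ℂ)
  one_mem : (1 : Matrix ι ι ℂ) ∈ space
  star_mem : ∀ A ∈ space, Aᴴ ∈ space

attribute [instance] NCGraph.fintypeι NCGraph.decEqι

namespace NCGraph

/-- `U S U* = T` for a unitary `U`. -/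
def Iso (S T : NCGraph) : Prop :=
  ∃ U : Matrix T.ι S.ι ℂ, Uᴴ * U = 1 ∧ U * Uᴴ = 1 ∧
    (fun A => U * A * Uᴴ) '' (S.space : Set (Matrix S.ι S.ι ℂ)) = T.space

/-- `T ≤ S`: there is a cohomomorphism from `T` to `S`, i.e. a finite family of operators `E i`
with `∑ i, (E i)* (E i) = I` and `(E i)* S (E j) ⊆ T`. -/
def CohomLE (T S : NCGraph) : Prop :=
  ∃ (m : ℕ) (E : Fin m → Matrix S.ι T.ι ℂ), ∑ i, (E i)ᴴ * E i = 1 ∧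
    ∀ i j, ∀ A ∈ S.space, (E i)ᴴ * A * E j ∈ T.space

/-- The noncommutative graph on the zero space. -/
abbrev zero : NCGraph := ⟨PEmpty, ⊤, trivial, fun _ _ => trivial⟩

/-- The identity channel `ℂ I ⊆ B(ℂ^ι)`. -/
abbrev scalars (ι : Type) [Fintype ι] [DecidableEq ι] : NCGraph where
  ι := ι
  space := Submodule.span ℂ {1}
  one_mem := Submodule.subset_span rfl
  star_mem A hA := by
    obtain ⟨c, rfl⟩ := Submodule.mem_span_singleton.1 hA
    rw [conjTranspose_smul, conjTranspose_one]
    exact Submodule.smul_mem _ _ (Submodule.subset_span rfl)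

/-- The confusability graph `ℂ I ⊆ B(ℂ^d)` of the noiseless `d`-dimensional quantum channel. -/
abbrev idealQuantum (d : ℕ) : NCGraph := scalars (Fin d)

/-- The noncommutative graph of a graph, spanned by `|x⟩⟨y|` with `x ≃ y`. -/
abbrev ofGraph (G : FinGraph) : NCGraph where
  ι := G.V
  space := Submodule.span ℂ {M | ∃ x y, G.AdjEq x y ∧ M = Matrix.single x y 1}
  one_mem := by
    rw [Matrix.matrix_eq_sum_single (1 : Matrix G.V G.V ℂ)]
    refine Submodule.sum_mem _ fun i _ => Submodule.sum_mem _ fun j _ => ?_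
    by_cases h : i = j
    · subst h
      rw [Matrix.one_apply_eq]
      exact Submodule.subset_span ⟨i, i, AdjEq.refl _, rfl⟩
    · rw [Matrix.one_apply_ne h, Matrix.single_zero]
      exact Submodule.zero_mem _
  star_mem A hA := by
    induction hA using Submodule.span_induction with
    | mem x h =>
      obtain ⟨x, y, h, rfl⟩ := h
      refine Submodule.subset_span ⟨y, x, h.symm, ?_⟩
      rw [Matrix.conjTranspose_single, star_one]
    | zero => rw [conjTranspose_zero]; exact Submodule.zero_mem _
    | add x y _ _ hx hy => rw [conjTranspose_add]; exact Submodule.add_mem _ hx hy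
    | smul a x _ hx => rw [conjTranspose_smul]; exact Submodule.smul_mem _ _ hx

/-- Direct sum `S ⊕ T = {A ⊕ B | A ∈ S, B ∈ T}`. -/
abbrev directSum (S T : NCGraph) : NCGraph where
  ι := S.ι ⊕ T.ι
  space :=
    { carrier := {M | ∃ A ∈ S.space, ∃ B ∈ T.space, M = fromBlocks A 0 0 B}
      zero_mem' := ⟨0, S.space.zero_mem, 0, T.space.zero_mem, fromBlocks_zero.symm⟩
      add_mem' := by
        rintro _ _ ⟨A, hA, B, hB, rfl⟩ ⟨A', hA', B', hB', rfl⟩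
        exact ⟨_, S.space.add_mem hA hA', _, T.space.add_mem hB hB', by simp [fromBlocks_add]⟩
      smul_mem' := by
        rintro c _ ⟨A, hA, B, hB, rfl⟩
        exact ⟨_, S.space.smul_mem c hA, _, T.space.smul_mem c hB, by simp [fromBlocks_smul]⟩ }
  one_mem := ⟨1, S.one_mem, 1, T.one_mem, fromBlocks_one.symm⟩
  star_mem := by
    rintro _ ⟨A, hA, B, hB, rfl⟩
    exact ⟨_, S.star_mem _ hA, _, T.star_mem _ hB, by simp [fromBlocks_conjTranspose]⟩

/-- Tensor product `S ⊗ T = span {A ⊗ B | A ∈ S, B ∈ T}`. -/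
abbrev tensor (S T : NCGraph) : NCGraph where
  ι := S.ι × T.ι
  space := Submodule.span ℂ {M | ∃ A ∈ S.space, ∃ B ∈ T.space, M = A ⊗ₖ B}
  one_mem := Submodule.subset_span ⟨1, S.one_mem, 1, T.one_mem, one_kronecker_one.symm⟩
  star_mem M hM := by
    induction hM using Submodule.span_induction with
    | mem x h =>
      obtain ⟨A, hA, B, hB, rfl⟩ := h
      exact Submodule.subset_span ⟨_, S.star_mem _ hA, _, T.star_mem _ hB, conjTranspose_kronecker _ _⟩
    | zero => rw [conjTranspose_zero]; exact Submodule.zero_mem _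
    | add x y _ _ hx hy => rw [conjTranspose_add]; exact Submodule.add_mem _ hx hy
    | smul a x _ hx => rw [conjTranspose_smul]; exact Submodule.smul_mem _ _ hx

theorem Iso.of_mem {S T : NCGraph} (U : Matrix T.ι S.ι ℂ) (h₁ : Uᴴ * U = 1) (h₂ : U * Uᴴ = 1)
    (hS : ∀ A ∈ S.space, U * A * Uᴴ ∈ T.space) (hT : ∀ B ∈ T.space, Uᴴ * B * U ∈ S.space) :
    S.Iso T := by
  refine ⟨U, h₁, h₂, Set.Subset.antisymm ?_ ?_⟩
  · rintro _ ⟨A, hA, rfl⟩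
    exact hS A hA
  · intro B hB
    refine ⟨_, hT B hB, ?_⟩
    calc U * (Uᴴ * B * U) * Uᴴ = (U * Uᴴ) * B * (U * Uᴴ) := by simp only [Matrix.mul_assoc]
      _ = B := by rw [h₂, Matrix.one_mul, Matrix.mul_one]

theorem Iso.exists_mem {S T : NCGraph} (h : S.Iso T) : ∃ U : Matrix T.ι S.ι ℂ,
    Uᴴ * U = 1 ∧ U * Uᴴ = 1 ∧ (∀ A ∈ S.space, U * A * Uᴴ ∈ T.space) ∧
      ∀ B ∈ T.space, Uᴴ * B * U ∈ S.space := by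
  obtain ⟨U, h₁, h₂, h⟩ := h
  refine ⟨U, h₁, h₂, fun A hA => ?_, fun B hB => ?_⟩
  · have : U * A * Uᴴ ∈ (T.space : Set _) := h ▸ ⟨A, hA, rfl⟩
    exact this
  · have hB' : B ∈ (T.space : Set _) := hB
    rw [← h] at hB'
    obtain ⟨A, hA, rfl⟩ := hB'
    have : Uᴴ * (U * A * Uᴴ) * U = A := by
      calc Uᴴ * (U * A * Uᴴ) * U = (Uᴴ * U) * A * (Uᴴ * U) := by simp only [Matrix.mul_assoc]
        _ = A := by rw [h₁, Matrix.one_mul, Matrix.mul_one]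
    rwa [← this] at hA

theorem Iso.refl (S : NCGraph) : S.Iso S :=
  Iso.of_mem 1 (by simp) (by simp) (by simp) (by simp)

theorem Iso.symm {S T : NCGraph} (h : S.Iso T) : T.Iso S := by
  obtain ⟨U, h₁, h₂, hS, hT⟩ := h.exists_mem
  exact Iso.of_mem Uᴴ (by simpa using h₂) (by simpa using h₁) (by simpa using hT)
    (by simpa using hS)

theorem Iso.trans {S T R : NCGraph} (h : S.Iso T) (h' : T.Iso R) : S.Iso R := by
  obtain ⟨U, h₁, h₂, hS, hT⟩ := h.exists_mem
  obtain ⟨W, k₁, k₂, kS, kT⟩ := h'.exists_mem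
  refine Iso.of_mem (W * U) ?_ ?_ (fun A hA => ?_) (fun B hB => ?_)
  · rw [conjTranspose_mul, Matrix.mul_assoc, ← Matrix.mul_assoc Wᴴ, k₁, Matrix.one_mul, h₁]
  · rw [conjTranspose_mul, Matrix.mul_assoc, ← Matrix.mul_assoc U, h₂, Matrix.one_mul, k₂]
  · have := kS _ (hS A hA)
    simpa only [conjTranspose_mul, Matrix.mul_assoc] using this
  · have := hT _ (kT B hB)
    simpa only [conjTranspose_mul, Matrix.mul_assoc] using this

/-- Unitary isomorphism of noncommutative graphs. -/
instance isoSetoid : Setoid NCGraph where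
  r := Iso
  iseqv := ⟨Iso.refl, Iso.symm, Iso.trans⟩

/-- A bijection of the standard bases that matches the spaces is an isomorphism. -/
theorem iso_of_equiv {S T : NCGraph} (e : S.ι ≃ T.ι)
    (hS : ∀ A ∈ S.space, A.submatrix e.symm e.symm ∈ T.space)
    (hT : ∀ B ∈ T.space, B.submatrix e e ∈ S.space) : S ≈ T := by
  have hU : ((1 : Matrix S.ι S.ι ℂ).submatrix e.symm id)ᴴ
      = (1 : Matrix S.ι S.ι ℂ).submatrix id e.symm := by
    rw [conjTranspose_submatrix, conjTranspose_one]
  have key (A : Matrix S.ι S.ι ℂ) : (1 : Matrix S.ι S.ι ℂ).submatrix e.symm id * A *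
      (1 : Matrix S.ι S.ι ℂ).submatrix id e.symm = A.submatrix e.symm e.symm := by
    ext i j
    simp [Matrix.mul_apply, Matrix.one_apply]
  have key' (B : Matrix T.ι T.ι ℂ) : (1 : Matrix S.ι S.ι ℂ).submatrix id e.symm * B *
      (1 : Matrix S.ι S.ι ℂ).submatrix e.symm id = B.submatrix e e := by
    ext i j
    simp [Matrix.mul_apply, Matrix.one_apply, Equiv.eq_symm_apply, Equiv.symm_apply_eq]
  refine Iso.of_mem ((1 : Matrix S.ι S.ι ℂ).submatrix e.symm id) ?_ ?_ ?_ ?_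
  · have := key' 1
    rw [Matrix.mul_one] at this
    rw [hU, this, submatrix_one_equiv]
  · have := key 1
    rw [Matrix.mul_one] at this
    rw [hU, this, submatrix_one_equiv]
  · intro A hA
    rw [hU, key]
    exact hS A hA
  · intro B hB
    rw [hU, key']
    exact hT B hB

theorem cohomLE_of_iso {S T : NCGraph} (h : S ≈ T) : CohomLE S T := by
  obtain ⟨U, h₁, -, -, hT⟩ := Iso.exists_mem h
  exact ⟨1, fun _ => U, by simpa using h₁, fun _ _ => hT⟩

theorem CohomLE.trans {R S T : NCGraph} (h : CohomLE R S) (h' : CohomLE S T) : CohomLE R T := by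
  obtain ⟨m, E, hE, hE'⟩ := h
  obtain ⟨n, F, hF, hF'⟩ := h'
  refine ⟨m * n, fun k => F (finProdFinEquiv.symm k).2 * E (finProdFinEquiv.symm k).1, ?_, ?_⟩
  · rw [Equiv.sum_comp finProdFinEquiv.symm (fun p : Fin m × Fin n => (F p.2 * E p.1)ᴴ *
      (F p.2 * E p.1)), Fintype.sum_prod_type, ← hE]
    refine Finset.sum_congr rfl fun i _ => ?_
    calc ∑ j, (F j * E i)ᴴ * (F j * E i) = ∑ j, (E i)ᴴ * ((F j)ᴴ * F j) * E i := by
          simp only [conjTranspose_mul, Matrix.mul_assoc]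
      _ = (E i)ᴴ * (∑ j, (F j)ᴴ * F j) * E i := by
          rw [Matrix.mul_sum, Matrix.sum_mul]
      _ = (E i)ᴴ * E i := by rw [hF, Matrix.mul_one]
  · intro i j A hA
    have := hE' (finProdFinEquiv.symm i).1 (finProdFinEquiv.symm j).1 _
      (hF' (finProdFinEquiv.symm i).2 (finProdFinEquiv.symm j).2 A hA)
    simpa only [conjTranspose_mul, Matrix.mul_assoc] using this

/-- Induction on the elements of a tensor product, for linear conditions. -/
theorem tensor_mem {S T : NCGraph} {κ : Type} {P : Submodule ℂ (Matrix κ κ ℂ)}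
    (L : Matrix (S.ι × T.ι) (S.ι × T.ι) ℂ →ₗ[ℂ] Matrix κ κ ℂ)
    (h : ∀ A ∈ S.space, ∀ B ∈ T.space, L (A ⊗ₖ B) ∈ P) :
    ∀ M ∈ (S.tensor T).space, L M ∈ P := by
  have : (S.tensor T).space ≤ P.comap L := by
    refine Submodule.span_le.2 ?_
    rintro _ ⟨A, hA, B, hB, rfl⟩
    exact h A hA B hB
  exact this

/-- `M ↦ U M W` as a linear map. -/
def sandwich {κ ι : Type} [Fintype ι] (U : Matrix κ ι ℂ) (W : Matrix ι κ ℂ) :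
    Matrix ι ι ℂ →ₗ[ℂ] Matrix κ κ ℂ where
  toFun M := U * M * W
  map_add' := by simp [Matrix.mul_add, Matrix.add_mul]
  map_smul' := by simp

/-- `M ↦ M.submatrix e e` as a linear map. -/
def submatrixL {κ ι : Type} (e : κ → ι) : Matrix ι ι ℂ →ₗ[ℂ] Matrix κ κ ℂ where
  toFun M := M.submatrix e e
  map_add' _ _ := rfl
  map_smul' _ _ := rfl

/-- `M ↦ M ⊗ B` as a linear map. -/
def kronL {κ ι : Type} (B : Matrix κ κ ℂ) : Matrix ι ι ℂ →ₗ[ℂ] Matrix (ι × κ) (ι × κ) ℂ where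
  toFun M := M ⊗ₖ B
  map_add' _ _ := add_kronecker _ _ _
  map_smul' _ _ := smul_kronecker _ _ _

/-- `M ↦ A ⊗ M` as a linear map. -/
def kronR {κ ι : Type} (A : Matrix ι ι ℂ) : Matrix κ κ ℂ →ₗ[ℂ] Matrix (ι × κ) (ι × κ) ℂ where
  toFun M := A ⊗ₖ M
  map_add' _ _ := kronecker_add _ _ _
  map_smul' _ _ := kronecker_smul _ _ _

theorem kron_mem {S T : NCGraph} {A : Matrix S.ι S.ι ℂ} {B : Matrix T.ι T.ι ℂ}
    (hA : A ∈ S.space) (hB : B ∈ T.space) : A ⊗ₖ B ∈ (S.tensor T).space :=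
  Submodule.subset_span ⟨A, hA, B, hB, rfl⟩

theorem directSum_congr {S S' T T' : NCGraph} (hS : S ≈ S') (hT : T ≈ T') :
    S.directSum T ≈ S'.directSum T' := by
  obtain ⟨U, h₁, h₂, h₃, h₄⟩ := Iso.exists_mem hS
  obtain ⟨W, k₁, k₂, k₃, k₄⟩ := Iso.exists_mem hT
  refine Iso.of_mem (S := S.directSum T) (T := S'.directSum T') (fromBlocks U 0 0 W) ?_ ?_ ?_ ?_
  · rw [fromBlocks_conjTranspose]
    refine (fromBlocks_multiply _ _ _ _ _ _ _ _).trans ?_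
    simp [h₁, k₁]
  · rw [fromBlocks_conjTranspose]
    refine (fromBlocks_multiply _ _ _ _ _ _ _ _).trans ?_
    simp [h₂, k₂]
  · rintro _ ⟨A, hA, B, hB, rfl⟩
    refine ⟨_, h₃ A hA, _, k₃ B hB, ?_⟩
    rw [fromBlocks_conjTranspose]
    refine (congrArg (· * _) (fromBlocks_multiply _ _ _ _ _ _ _ _)).trans ?_
    refine (fromBlocks_multiply _ _ _ _ _ _ _ _).trans ?_
    simp
  · rintro _ ⟨A, hA, B, hB, rfl⟩
    refine ⟨_, h₄ A hA, _, k₄ B hB, ?_⟩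
    rw [fromBlocks_conjTranspose]
    refine (congrArg (· * _) (fromBlocks_multiply _ _ _ _ _ _ _ _)).trans ?_
    refine (fromBlocks_multiply _ _ _ _ _ _ _ _).trans ?_
    simp

theorem tensor_congr {S S' T T' : NCGraph} (hS : S ≈ S') (hT : T ≈ T') :
    S.tensor T ≈ S'.tensor T' := by
  obtain ⟨U, h₁, h₂, h₃, h₄⟩ := Iso.exists_mem hS
  obtain ⟨W, k₁, k₂, k₃, k₄⟩ := Iso.exists_mem hT
  refine Iso.of_mem (S := S.tensor T) (T := S'.tensor T') (U ⊗ₖ W) ?_ ?_ ?_ ?_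
  · rw [conjTranspose_kronecker]
    refine (mul_kronecker_mul _ _ _ _).symm.trans ?_
    rw [h₁, k₁]
    exact one_kronecker_one
  · rw [conjTranspose_kronecker]
    refine (mul_kronecker_mul _ _ _ _).symm.trans ?_
    rw [h₂, k₂]
    exact one_kronecker_one
  · refine tensor_mem (sandwich (U ⊗ₖ W) (U ⊗ₖ W)ᴴ) fun A hA B hB => ?_
    have : sandwich (U ⊗ₖ W) (U ⊗ₖ W)ᴴ (A ⊗ₖ B) = (U * A * Uᴴ) ⊗ₖ (W * B * Wᴴ) := by
      simp only [sandwich, LinearMap.coe_mk, AddHom.coe_mk, conjTranspose_kronecker,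
        mul_kronecker_mul]
    rw [this]
    exact kron_mem (h₃ A hA) (k₃ B hB)
  · refine tensor_mem (sandwich (U ⊗ₖ W)ᴴ (U ⊗ₖ W)) fun A hA B hB => ?_
    have : sandwich (U ⊗ₖ W)ᴴ (U ⊗ₖ W) (A ⊗ₖ B) = (Uᴴ * A * U) ⊗ₖ (Wᴴ * B * W) := by
      simp only [sandwich, LinearMap.coe_mk, AddHom.coe_mk, conjTranspose_kronecker,
        mul_kronecker_mul]
    rw [this]
    exact kron_mem (h₄ A hA) (k₄ B hB)

theorem ofGraph_congr {G H : FinGraph} (h : G ≈ H) : ofGraph G ≈ ofGraph H := by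
  have aux {G H : FinGraph} (e : G.graph ≃g H.graph) : ∀ A ∈ (ofGraph G).space,
      A.submatrix e.toEquiv.symm e.toEquiv.symm ∈ (ofGraph H).space := by
    have : (ofGraph G).space ≤ (ofGraph H).space.comap (submatrixL e.toEquiv.symm) := by
      refine Submodule.span_le.2 ?_
      rintro _ ⟨x, y, hxy, rfl⟩
      refine Submodule.subset_span ⟨e x, e y, (adjEq_iff_of_iso e x y).2 hxy, ?_⟩
      exact Matrix.submatrix_single_equiv e.toEquiv.symm e.toEquiv.symm x y 1
    exact this
  obtain ⟨e⟩ := h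
  exact iso_of_equiv (S := ofGraph G) (T := ofGraph H) e.toEquiv (aux e) (aux e.symm)

end NCGraph

open NCGraph

/-- The set `𝒢_nc` of isomorphism classes of noncommutative graphs. -/
def NCClass : Type 1 := Quotient NCGraph.isoSetoid

/-- The isomorphism class of a noncommutative graph. -/
def NCGraph.toClass (S : NCGraph) : NCClass := Quotient.mk _ S

namespace NCClass

instance : Zero NCClass := ⟨NCGraph.zero.toClass⟩
instance : One NCClass := ⟨(NCGraph.scalars PUnit).toClass⟩
instance : Add NCClass :=
  ⟨Quotient.map₂ NCGraph.directSum fun _ _ h _ _ h' => directSum_congr h h'⟩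
instance : Mul NCClass :=
  ⟨Quotient.map₂ NCGraph.tensor fun _ _ h _ _ h' => tensor_congr h h'⟩

protected theorem add_comm (a b : NCClass) : a + b = b + a :=
  Quotient.inductionOn₂ a b fun S T => Quotient.sound <| by
    refine iso_of_equiv (S := S.directSum T) (T := T.directSum S) (Equiv.sumComm _ _) ?_ ?_
    all_goals
      rintro _ ⟨A, hA, B, hB, rfl⟩
      exact ⟨B, hB, A, hA, by ext (i | i) (j | j) <;> rfl⟩

protected theorem add_assoc (a b c : NCClass) : a + b + c = a + (b + c) :=
  Quotient.inductionOn₃ a b c fun S T R => Quotient.sound <| by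
    refine iso_of_equiv (S := (S.directSum T).directSum R) (T := S.directSum (T.directSum R))
      (Equiv.sumAssoc _ _ _) ?_ ?_
    · rintro _ ⟨_, ⟨A, hA, B, hB, rfl⟩, C, hC, rfl⟩
      exact ⟨A, hA, _, ⟨B, hB, C, hC, rfl⟩, by ext (i | i | i) (j | j | j) <;> rfl⟩
    · rintro _ ⟨A, hA, _, ⟨B, hB, C, hC, rfl⟩, rfl⟩
      exact ⟨_, ⟨A, hA, B, hB, rfl⟩, C, hC, by ext ((i | i) | i) ((j | j) | j) <;> rfl⟩

protected theorem zero_add (a : NCClass) : 0 + a = a :=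
  Quotient.inductionOn a fun S => Quotient.sound <| by
    refine iso_of_equiv (S := NCGraph.zero.directSum S) (T := S) (Equiv.emptySum PEmpty _) ?_ ?_
    · rintro _ ⟨A, hA, B, hB, rfl⟩
      exact hB
    · intro B hB
      exact ⟨0, trivial, B, hB, by
        ext (i | i) (j | j) <;> first | exact i.elim | exact j.elim | rfl⟩

protected theorem mul_comm (a b : NCClass) : a * b = b * a :=
  Quotient.inductionOn₂ a b fun S T => Quotient.sound <| by
    have aux (S T : NCGraph) : ∀ M ∈ (S.tensor T).space,
        M.submatrix (Equiv.prodComm T.ι S.ι) (Equiv.prodComm T.ι S.ι) ∈ (T.tensor S).space := by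
      refine tensor_mem (submatrixL (Equiv.prodComm T.ι S.ι)) fun A hA B hB => ?_
      have : submatrixL (Equiv.prodComm T.ι S.ι) (A ⊗ₖ B) = B ⊗ₖ A := by
        ext i j
        exact mul_comm _ _
      rw [this]
      exact kron_mem hB hA
    exact iso_of_equiv (S := S.tensor T) (T := T.tensor S) (Equiv.prodComm _ _)
      (aux S T) (aux T S)

protected theorem mul_assoc (a b c : NCClass) : a * b * c = a * (b * c) :=
  Quotient.inductionOn₃ a b c fun S T R => Quotient.sound <| by
    refine iso_of_equiv (S := (S.tensor T).tensor R) (T := S.tensor (T.tensor R))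
      (Equiv.prodAssoc _ _ _) ?_ ?_
    · refine tensor_mem (S := S.tensor T) (T := R)
        (submatrixL (Equiv.prodAssoc S.ι T.ι R.ι).symm) fun M hM C hC => ?_
      refine tensor_mem (S := S) (T := T)
        ((submatrixL (Equiv.prodAssoc S.ι T.ι R.ι).symm).comp (kronL C))
        (fun A hA B hB => ?_) M hM
      have : (submatrixL (Equiv.prodAssoc S.ι T.ι R.ι).symm) (kronL C (A ⊗ₖ B))
          = A ⊗ₖ (B ⊗ₖ C) := by
        ext i j
        exact mul_assoc _ _ _
      rw [LinearMap.comp_apply, this]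
      exact kron_mem (S := S) (T := T.tensor R) hA (kron_mem hB hC)
    · refine tensor_mem (S := S) (T := T.tensor R)
        (submatrixL (Equiv.prodAssoc S.ι T.ι R.ι)) fun A hA M hM => ?_
      refine tensor_mem (S := T) (T := R)
        ((submatrixL (Equiv.prodAssoc S.ι T.ι R.ι)).comp (kronR A))
        (fun B hB C hC => ?_) M hM
      have : (submatrixL (Equiv.prodAssoc S.ι T.ι R.ι)) (kronR A (B ⊗ₖ C))
          = (A ⊗ₖ B) ⊗ₖ C := by
        ext i j
        exact (mul_assoc _ _ _).symm
      rw [LinearMap.comp_apply, this]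
      exact kron_mem (S := S.tensor T) (T := R) (kron_mem hA hB) hC

protected theorem one_mul (a : NCClass) : 1 * a = a :=
  Quotient.inductionOn a fun S => Quotient.sound <| by
    refine iso_of_equiv (S := (NCGraph.scalars PUnit).tensor S) (T := S) (Equiv.punitProd _) ?_ ?_
    · refine tensor_mem (S := NCGraph.scalars PUnit) (T := S)
        (submatrixL (Equiv.punitProd S.ι).symm) fun A hA B hB => ?_
      have : submatrixL (Equiv.punitProd S.ι).symm (A ⊗ₖ B) = A PUnit.unit PUnit.unit • B := by
        ext i j
        rfl
      rw [this]
      exact S.space.smul_mem _ hB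
    · intro B hB
      have : B.submatrix (Equiv.punitProd S.ι) (Equiv.punitProd S.ι)
          = (1 : Matrix PUnit PUnit ℂ) ⊗ₖ B := by
        ext i j
        simp
      rw [this]
      exact kron_mem (S := NCGraph.scalars PUnit) (NCGraph.scalars PUnit).one_mem hB

protected theorem zero_mul (a : NCClass) : 0 * a = 0 :=
  Quotient.inductionOn a fun S => Quotient.sound <| by
    refine iso_of_equiv (S := NCGraph.zero.tensor S) (T := NCGraph.zero)
      (Equiv.pemptyProd _) (fun _ _ => trivial) fun B _ => ?_
    have : B.submatrix (Equiv.pemptyProd S.ι) (Equiv.pemptyProd S.ι) = 0 := by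
      ext i j
      exact i.1.elim
    rw [this]
    exact Submodule.zero_mem _

protected theorem add_mul (a b c : NCClass) : (a + b) * c = a * c + b * c :=
  Quotient.inductionOn₃ a b c fun S T R => Quotient.sound <| by
    refine iso_of_equiv (S := (S.directSum T).tensor R)
      (T := (S.tensor R).directSum (T.tensor R)) (Equiv.sumProdDistrib _ _ _) ?_ ?_
    · refine tensor_mem (S := S.directSum T) (T := R)
        (submatrixL (Equiv.sumProdDistrib S.ι T.ι R.ι).symm) ?_
      rintro _ ⟨A, hA, B, hB, rfl⟩ C hC
      refine ⟨_, kron_mem hA hC, _, kron_mem hB hC, ?_⟩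
      change ((fromBlocks A 0 0 B) ⊗ₖ C).submatrix (Equiv.sumProdDistrib S.ι T.ι R.ι).symm
        (Equiv.sumProdDistrib S.ι T.ι R.ι).symm = _
      ext (i | i) (j | j) <;> simp
    · rintro _ ⟨M, hM, N, hN, rfl⟩
      have h₁ : (fromBlocks M 0 0 (0 : Matrix (T.ι × R.ι) (T.ι × R.ι) ℂ)).submatrix
          (Equiv.sumProdDistrib S.ι T.ι R.ι) (Equiv.sumProdDistrib S.ι T.ι R.ι)
          ∈ ((S.directSum T).tensor R).space := by
        refine tensor_mem (S := S) (T := R)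
          ((submatrixL (Equiv.sumProdDistrib S.ι T.ι R.ι)).comp
            ({ toFun := fun M => fromBlocks M 0 0 0
               map_add' := by simp [fromBlocks_add]
               map_smul' := by simp [fromBlocks_smul] } :
              Matrix (S.ι × R.ι) (S.ι × R.ι) ℂ →ₗ[ℂ]
                Matrix (S.ι × R.ι ⊕ T.ι × R.ι) (S.ι × R.ι ⊕ T.ι × R.ι) ℂ))
          (fun A hA C hC => ?_) M hM
        have : (fromBlocks (A ⊗ₖ C) 0 0 (0 : Matrix (T.ι × R.ι) (T.ι × R.ι) ℂ)).submatrix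
            (Equiv.sumProdDistrib S.ι T.ι R.ι) (Equiv.sumProdDistrib S.ι T.ι R.ι)
            = (fromBlocks A 0 0 0) ⊗ₖ C := by
          ext ⟨i | i, k⟩ ⟨j | j, l⟩ <;> simp
        refine (congrArg (· ∈ ((S.directSum T).tensor R).space) this).mpr ?_
        exact kron_mem (S := S.directSum T) ⟨A, hA, 0, T.space.zero_mem, rfl⟩ hC
      have h₂ : (fromBlocks (0 : Matrix (S.ι × R.ι) (S.ι × R.ι) ℂ) 0 0 N).submatrix
          (Equiv.sumProdDistrib S.ι T.ι R.ι) (Equiv.sumProdDistrib S.ι T.ι R.ι)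
          ∈ ((S.directSum T).tensor R).space := by
        refine tensor_mem (S := T) (T := R)
          ((submatrixL (Equiv.sumProdDistrib S.ι T.ι R.ι)).comp
            ({ toFun := fun M => fromBlocks 0 0 0 M
               map_add' := by simp [fromBlocks_add]
               map_smul' := by simp [fromBlocks_smul] } :
              Matrix (T.ι × R.ι) (T.ι × R.ι) ℂ →ₗ[ℂ]
                Matrix (S.ι × R.ι ⊕ T.ι × R.ι) (S.ι × R.ι ⊕ T.ι × R.ι) ℂ))
          (fun A hA C hC => ?_) N hN
        have : (fromBlocks (0 : Matrix (S.ι × R.ι) (S.ι × R.ι) ℂ) 0 0 (A ⊗ₖ C)).submatrix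
            (Equiv.sumProdDistrib S.ι T.ι R.ι) (Equiv.sumProdDistrib S.ι T.ι R.ι)
            = (fromBlocks 0 0 0 A) ⊗ₖ C := by
          ext ⟨i | i, k⟩ ⟨j | j, l⟩ <;> simp
        refine (congrArg (· ∈ ((S.directSum T).tensor R).space) this).mpr ?_
        exact kron_mem (S := S.directSum T) ⟨0, S.space.zero_mem, A, hA, rfl⟩ hC
      have := Submodule.add_mem _ h₁ h₂
      have h₃ : fromBlocks M 0 0 N = fromBlocks M 0 0 (0 : Matrix (T.ι × R.ι) (T.ι × R.ι) ℂ) +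
          fromBlocks (0 : Matrix (S.ι × R.ι) (S.ι × R.ι) ℂ) 0 0 N := by
        simp [fromBlocks_add]
      rw [h₃]
      exact this

instance : CommSemiring NCClass where
  add_assoc := NCClass.add_assoc
  zero_add := NCClass.zero_add
  add_zero a := (NCClass.add_comm a 0).trans (NCClass.zero_add a)
  add_comm := NCClass.add_comm
  nsmul := nsmulRec
  mul_assoc := NCClass.mul_assoc
  one_mul := NCClass.one_mul
  mul_one a := (NCClass.mul_comm a 1).trans (NCClass.one_mul a)
  mul_comm := NCClass.mul_comm
  zero_mul := NCClass.zero_mul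
  mul_zero a := (NCClass.mul_comm a 0).trans (NCClass.zero_mul a)
  right_distrib := NCClass.add_mul
  left_distrib a b c := by
    rw [NCClass.mul_comm, NCClass.add_mul, NCClass.mul_comm b, NCClass.mul_comm c]

/-- The cohomomorphism preorder on `𝒢_nc`. -/
instance : Preorder NCClass where
  le := Quotient.lift₂ NCGraph.CohomLE fun _ _ _ _ h h' => propext
    ⟨fun k => ((NCGraph.cohomLE_of_iso (Setoid.symm h)).trans k).trans (NCGraph.cohomLE_of_iso h'),
      fun k => ((NCGraph.cohomLE_of_iso h).trans k).trans
        (NCGraph.cohomLE_of_iso (Setoid.symm h'))⟩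
  le_refl a := Quotient.inductionOn a fun _ => NCGraph.cohomLE_of_iso (Setoid.refl _)
  le_trans a b c := Quotient.inductionOn₃ a b c fun _ _ _ h₁ h₂ => NCGraph.CohomLE.trans h₁ h₂

/-- The map `𝒢 → 𝒢_nc` that sends a graph to its noncommutative graph. -/
def ofGraphClass : GraphClass → NCClass :=
  Quotient.map NCGraph.ofGraph fun _ _ h => ofGraph_congr h

end NCClass

/-! ## Asymptotic spectra and the intermediate semiring -/

/-- The asymptotic spectrum: monotone semiring homomorphisms to the nonnegative reals. -/
def asymptoticSpectrum (S : Type*) [CommSemiring S] [Preorder S] : Set (S →+* ℝ≥0) :=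
  {φ | Monotone φ}

/-- The subsemiring `𝒜` of `𝒢_nc` generated by the graphs and the noiseless quantum channels,
with the preorder of `𝒢_nc`. -/
def algA : Subsemiring NCClass :=
  Subsemiring.closure
    (Set.range NCClass.ofGraphClass ∪ Set.range fun d : ℕ => (NCGraph.idealQuantum d).toClass)

/-- A graph as an element of `𝒜`. -/
def graphA (G : FinGraph) : algA :=
  ⟨NCClass.ofGraphClass G.toClass, Subsemiring.subset_closure (Or.inl ⟨_, rfl⟩)⟩

/-- The noiseless `d`-dimensional quantum channel as an element of `𝒜`. -/
def quantumA (d : ℕ) : algA :=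
  ⟨(NCGraph.idealQuantum d).toClass, Subsemiring.subset_closure (Or.inr ⟨d, rfl⟩)⟩

/-- The element `⨁_{d=1}^r G_d ⊗ ℂ I_d` of `𝒜`. The graph `G_d` has the index `d - 1` in the family
`G : Fin r → FinGraph`. -/
def familyA {r : ℕ} (G : Fin r → FinGraph) : algA := ∑ d : Fin r, graphA (G d) * quantumA ((d : ℕ) + 1)

/-- `φ` is the homomorphism `f_α`, given by `f_α (⨁_d G_d ⊗ ℂ I_d) = ∑_d f (G_d) d ^ α`. -/
def IsFAlpha (f : GraphClass →+* ℝ≥0) (α : ℝ) (φ : algA →+* ℝ≥0) : Prop :=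
  ∀ (r : ℕ) (G : Fin r → FinGraph),
    φ (familyA G) = ∑ d : Fin r, f (G d).toClass * ((d : ℝ≥0) + 1) ^ α

/-- `α ∈ [1, ∞)` is an admissible exponent for `f`: the map `f_α` is an element of the asymptotic
spectrum of `𝒜`. -/
def IsAdmissible (f : GraphClass →+* ℝ≥0) (α : ℝ) : Prop :=
  1 ≤ α ∧ ∃ φ ∈ asymptoticSpectrum algA, IsFAlpha f α φ

/-! ## Probabilistic refinements -/

/-- The subgraph of the `n`-th strong power of `G` induced on the type class of the words in which
every vertex `v` occurs exactly `c v` times. -/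
abbrev typeGraph (G : FinGraph) (n : ℕ) (c : G.V → ℕ) : FinGraph :=
  ⟨{x : Fin n → G.V // ∀ v, (Finset.univ.filter fun i => x i = v).card = c v},
    (G.strongPow n).comap Subtype.val⟩

/-- For every sequence of `n`-types `Q_n = c n / n` on `V(G)` that converges to `Q`, the `n`-th root
of the value of `f` on the type graph of `Q_n` converges to `L`. -/
def IsRefinementValue (f : GraphClass →+* ℝ≥0) (G : FinGraph) (Q : G.V → ℝ) (L : ℝ) : Prop :=
  ∀ c : ℕ → G.V → ℕ, (∀ n, ∑ v, c n v = n) →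
    (∀ v, Tendsto (fun n : ℕ => (c n v : ℝ) / n) atTop (𝓝 (Q v))) →
    Tendsto (fun n : ℕ => ((f (typeGraph G n (c n)).toClass : ℝ≥0) : ℝ) ^ (1 / (n : ℝ)))
      atTop (𝓝 L)

/-- The probabilistic refinement `f (G, Q)`: the common limit along all such sequences. -/
noncomputable def probRefinement (f : GraphClass →+* ℝ≥0) (G : FinGraph) (Q : G.V → ℝ) : ℝ :=
  Classical.epsilon (IsRefinementValue f G Q)

/-- A pair `(S, Q)` with `S = ⨁_{d=1}^r G_d ⊗ ℂ I_d` and `Q` a probability distribution on the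
disjoint union of the vertex sets. -/
structure ProbFamily : Type 1 where
  r : ℕ
  G : Fin r → FinGraph
  Q : (Σ d, (G d).V) → ℝ
  Q_mem : Q ∈ stdSimplex ℝ (Σ d, (G d).V)

namespace ProbFamily

/-- The marginal `π_* Q`. -/
def marginal (X : ProbFamily) (d : Fin X.r) : ℝ := ∑ v, X.Q ⟨d, v⟩

/-- The normalized restriction `Q_d` of `Q` to `V(G_d)`. -/
noncomputable def cond (X : ProbFamily) (d : Fin X.r) (v : (X.G d).V) : ℝ :=
  X.Q ⟨d, v⟩ / X.marginal d

end ProbFamily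

/-- `log f_α (S, Q) = H(π_* Q) + ∑_d π_* Q (d) (log f (G_d, Q_d) + α log d)`. -/
noncomputable def logRefinement (f : GraphClass →+* ℝ≥0) (α : ℝ) (X : ProbFamily) : ℝ :=
  ∑ d, Real.negMulLog (X.marginal d) +
    ∑ d, X.marginal d *
      (Real.log (probRefinement f (X.G d) (X.cond d)) + α * Real.log ((d : ℝ) + 1))

/-- The functionals `(S, Q) ↦ log f_α (S, Q)` with `f_α` in the asymptotic spectrum of `𝒜`. -/
def logFunctionals : Set (ProbFamily → ℝ) :=
  {F | ∃ f ∈ asymptoticSpectrum GraphClass, ∃ α : ℝ, IsAdmissible f α ∧ F = logRefinement f α}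

end ZeroError

namespace ZeroError

open FinGraph NCGraph

/-! ## Classes of graphs -/

namespace FinGraph

/-! The natural candidate for `h` is the geometric mean `F = f ^ a * g ^ b`. It is monotone,
multiplicative and correct on edgeless graphs, but not additive. Additivity is restored by passing
to growth rates on type graphs: `value F G` is the supremum of `F (typeClass G c) ^ (1 / n)` over
all nonzero multiplicity vectors `c`, where `n` is the total of `c`. Since there are only
polynomially many types of length `n`, suprema and sums over types have the same exponential growth,
and this makes `value F` a semiring homomorphism.

Additivity (`value_disjUnion`) is the binomial theorem: the type graph of `G ⊔ H` at `(c, d)` is, up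
to `≤` in both directions, a binomial coefficient times the product of the two type graphs.
Multiplicativity (`value_strongProd`) needs a joint type whose type graph is almost as large as the
product of two given type graphs. That product is vertex transitive, its vertices are labelled by
polynomially many joint types, and in a vertex transitive graph polynomially many translates of the
most frequent label class cover everything (`exists_covering`, `exists_jointType`).

Existence and positivity of `f (G, Q)`: `log F` is superadditive in the type by concatenation of
words, and changing a small fraction of the letters changes the rate by little, with an error
controlled by binary entropy. Hence the rates converge as the size grows and the frequencies
approach `Q` (`exists_hasLogRate`). The limit is the exponential of a finite rate, hence positive.
For a geometric mean, log rates combine linearly. Passing from `F` to `value F` does not change them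
(`HasLogRate.of_value`): on one side type graphs are vertex transitive, on the other a word of words
is a long word with the same frequencies.

For admissibility, each element of `𝒜` is represented by a graph with dimensions on its vertices,
constant along edges, and the candidate homomorphism is `value F` with the weights `dim v ^ γ`,
where `γ = a * α + b * β`. The crux is monotonicity. A cohomomorphism between two such objects
yields a map `φ` of vertices together with isometries between the attached spaces
(`exists_isometries`). On a type graph the total dimension is constant, so tensor powers of these
isometries compare a graph tensor one ideal channel with another of the same kind, the type being
pushed forward along `φ` (`exists_map_typeClass`). There admissibility of `(f, α)` and of `(g, β)`
gives two numerical inequalities, and their geometric mean is the inequality needed for `value F`.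
Convexity of the log functionals follows, since the entropy term does not depend on the
homomorphism. -/

theorem toClass_le_iff {G H : FinGraph} :
    G.toClass ≤ H.toClass ↔ ∃ φ : G.V → H.V, ∀ x y, H.AdjEq (φ x) (φ y) → G.AdjEq x y := by
  constructor
  · rintro ⟨φ⟩
    refine ⟨φ, fun x y h => ?_⟩
    by_contra hn
    have : G.graphᶜ.Adj x y := by
      rw [SimpleGraph.compl_adj]
      exact ⟨fun h => hn (Or.inl h), fun h => hn (Or.inr h)⟩
    have := φ.map_adj this
    rw [SimpleGraph.compl_adj] at this
    exact h.elim this.1 this.2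
  · rintro ⟨φ, hφ⟩
    refine ⟨⟨φ, fun {x y} h => ?_⟩⟩
    rw [SimpleGraph.compl_adj] at h ⊢
    have hn : ¬ G.AdjEq x y := fun h' => h'.elim h.1 h.2
    exact ⟨fun h' => hn (hφ _ _ (Or.inl h')), fun h' => hn (hφ _ _ (Or.inr h'))⟩

theorem toClass_eq {G H : FinGraph} (e : G.V ≃ H.V)
    (h : ∀ x y, H.AdjEq (e x) (e y) ↔ G.AdjEq x y) : G.toClass = H.toClass :=
  Quotient.sound (iso_of_adjEq e h)

theorem toClass_strongProd (G H : FinGraph) :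
    (G.strongProd H).toClass = G.toClass * H.toClass := rfl

/-- The graph without edges. -/
abbrev edgeless (K : Type) [Fintype K] [DecidableEq K] : FinGraph := ⟨K, ⊥⟩

theorem edgeless_adjEq {K : Type} [Fintype K] [DecidableEq K] (x y : K) :
    (edgeless K).AdjEq x y ↔ x = y := by simp [AdjEq]

theorem toClass_edgeless_fin (n : ℕ) : (edgeless (Fin n)).toClass = (n : GraphClass) := by
  induction n with
  | zero =>
    rw [Nat.cast_zero]
    exact toClass_eq (H := FinGraph.empty) finZeroEquiv' fun x => x.elim0
  | succ n ih =>
    rw [Nat.cast_succ, ← ih]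
    refine toClass_eq (H := (edgeless (Fin n)).disjUnion FinGraph.point)
      (finSumFinEquiv.symm.trans
        ((Equiv.refl _).sumCongr (Equiv.equivPUnit (Fin 1)))) fun x y => ?_
    obtain ⟨x, rfl⟩ := finSumFinEquiv.surjective x
    obtain ⟨y, rfl⟩ := finSumFinEquiv.surjective y
    rw [disjUnion_adjEq, edgeless_adjEq, finSumFinEquiv.injective.eq_iff]
    rcases x with x | x <;> rcases y with y | y <;>
      simp [edgeless_adjEq, AdjEq.refl, eq_iff_true_of_subsingleton]

theorem toClass_edgeless (K : Type) [Fintype K] [DecidableEq K] :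
    (edgeless K).toClass = (Fintype.card K : GraphClass) := by
  rw [← toClass_edgeless_fin]
  exact toClass_eq (H := edgeless (Fin (Fintype.card K))) (Fintype.equivFin K) fun x y => by
    rw [edgeless_adjEq, edgeless_adjEq, (Fintype.equivFin K).injective.eq_iff]

/-- A graph covered by the images of homomorphisms of reflexive graphs is bounded by the number of
these times the source. -/
theorem toClass_le_card_mul {X Y : FinGraph} {K : Type} [Fintype K] (j : K → Y.V → X.V)
    (hj : ∀ k y y', Y.AdjEq y y' → X.AdjEq (j k y) (j k y')) (hs : ∀ x, ∃ k y, j k y = x) :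
    X.toClass ≤ Fintype.card K * Y.toClass := by
  classical
  rw [← toClass_edgeless, ← toClass_strongProd, toClass_le_iff]
  choose k y h using hs
  -- Each vertex is sent to a chosen preimage. If two preimages are `≃`, they lie in the same copy,
  -- and the map `j k` of that copy transports the relation back to `X`.
  refine ⟨fun x => (k x, y x), fun x x' hx => ?_⟩
  rw [strongProd_adjEq, edgeless_adjEq] at hx
  obtain ⟨h₁, h₂⟩ := hx
  dsimp only at h₁ h₂
  have := hj (k x) _ _ h₂
  rwa [h, h₁, h] at this

theorem one_le_toClass {G : FinGraph} (x : G.V) : (1 : GraphClass) ≤ G.toClass := by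
  change FinGraph.point.toClass ≤ _
  rw [toClass_le_iff]
  exact ⟨fun _ => x, fun _ _ _ => Or.inl rfl⟩

theorem toClass_le_card (G : FinGraph) : G.toClass ≤ (Fintype.card G.V : GraphClass) := by
  rw [← toClass_edgeless, toClass_le_iff]
  exact ⟨id, fun x y h => Or.inl ((edgeless_adjEq _ _).1 h)⟩

end FinGraph

/-! ## Words and their types -/

section Words

set_option linter.unusedSectionVars false

variable {I J U V W : Type} [Fintype I] [Fintype J] [DecidableEq U] [DecidableEq V] [DecidableEq W]

/-- The number of occurrences of the letter `v` in the word `x`. -/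
def wordCount (x : I → V) (v : V) : ℕ := (Finset.univ.filter fun i => x i = v).card

theorem wordCount_eq_sum (x : I → V) (v : V) : wordCount x v = ∑ i, if x i = v then 1 else 0 :=
  Finset.card_filter _ _

theorem sum_wordCount [Fintype V] (x : I → V) : ∑ v, wordCount x v = Fintype.card I := by
  simp only [wordCount_eq_sum]
  rw [Finset.sum_comm]
  simp

theorem wordCount_comp_equiv (x : I → V) (e : J ≃ I) : wordCount (x ∘ e) = wordCount x := by
  ext v
  simp only [wordCount_eq_sum, Function.comp_apply]
  exact Equiv.sum_comp e fun i => if x i = v then 1 else 0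

theorem wordCount_sumElim (x : I → V) (y : J → V) :
    wordCount (Sum.elim x y) = wordCount x + wordCount y := by
  ext v
  simp only [Pi.add_apply, wordCount_eq_sum, Fintype.sum_sum_type, Sum.elim_inl, Sum.elim_inr]
  rfl

theorem wordCount_uncurry (x : J → I → V) (v : V) :
    wordCount (fun p : J × I => x p.1 p.2) v = ∑ j, wordCount (x j) v := by
  simp only [wordCount_eq_sum]
  exact Fintype.sum_prod_type _

/-- The push-forward of a vector of multiplicities. -/
def pushCount [Fintype U] (φ : U → V) (c : U → ℕ) (v : V) : ℕ := ∑ u, if φ u = v then c u else 0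

theorem wordCount_comp [Fintype U] (φ : U → V) (x : I → U) :
    wordCount (φ ∘ x) = pushCount φ (wordCount x) := by
  ext v
  simp only [wordCount_eq_sum, pushCount, Function.comp_apply]
  have : ∀ u, (if φ u = v then ∑ i, (if x i = u then 1 else 0) else 0)
      = ∑ i, if φ u = v then (if x i = u then 1 else 0) else 0 := fun u => by
    split_ifs <;> simp
  simp only [this]
  rw [Finset.sum_comm]
  refine Finset.sum_congr rfl fun i _ => ?_
  rw [Finset.sum_eq_single (x i)]
  · simp
  · intro u _ hu
    simp [hu.symm]
  · simp

theorem sum_pushCount [Fintype U] [Fintype V] (φ : U → V) (c : U → ℕ) :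
    ∑ v, pushCount φ c v = ∑ u, c u := by
  simp only [pushCount]
  rw [Finset.sum_comm]
  simp

/-- Corresponding fibres have equal size, so they can be matched letter by letter. Words of one type
thus form a single orbit under permutations of the positions; this is the source of vertex
transitivity of type graphs. -/
theorem exists_perm_of_wordCount_eq [DecidableEq I] {x y : I → V}
    (h : wordCount x = wordCount y) : ∃ σ : Equiv.Perm I, x ∘ σ = y := by
  have e : ∀ v, {i // y i = v} ≃ {i // x i = v} := fun v => by
    refine Fintype.equivOfCardEq ?_
    rw [Fintype.card_subtype, Fintype.card_subtype]
    exact (congrFun h v).symm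
  exact ⟨Equiv.ofFiberEquiv e, funext fun i => Equiv.ofFiberEquiv_map e i⟩

theorem exists_word [Fintype V] (c : V → ℕ) (h : Fintype.card I = ∑ v, c v) :
    ∃ x : I → V, wordCount x = c := by
  have e : Nonempty (I ≃ Σ v, Fin (c v)) := ⟨Fintype.equivOfCardEq (by simp [h])⟩
  obtain ⟨e⟩ := e
  refine ⟨fun i => (e i).1, ?_⟩
  have := wordCount_comp_equiv (Sigma.fst : (Σ v, Fin (c v)) → V) e
  refine this.trans ?_
  ext v
  rw [wordCount_eq_sum, Fintype.sum_sigma, Finset.sum_eq_single v] <;> simp +contextual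

/-- A word whose letters are images can be lifted to a word of prescribed type. -/
theorem exists_lift [DecidableEq I] [Fintype U] (φ : U → V) (c : U → ℕ) (x : I → V)
    (hI : Fintype.card I = ∑ u, c u) (h : wordCount x = pushCount φ c) :
    ∃ y : I → U, wordCount y = c ∧ φ ∘ y = x := by
  obtain ⟨y, hy⟩ := exists_word c hI
  obtain ⟨σ, hσ⟩ := exists_perm_of_wordCount_eq (x := φ ∘ y) (y := x) (by
    rw [wordCount_comp, hy, h])
  exact ⟨y ∘ σ, by rw [wordCount_comp_equiv, hy], hσ⟩

end Words

/-- The graph on the words with positions in `I` in which the letter `v` occurs `c v` times. -/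
abbrev wordGraph (I : Type) [Fintype I] [DecidableEq I] (G : FinGraph) (c : G.V → ℕ) : FinGraph where
  V := {x : I → G.V // wordCount x = c}
  graph :=
    { Adj := fun x y => x ≠ y ∧ ∀ i, G.AdjEq (x.1 i) (y.1 i)
      symm := ⟨fun _ _ h => ⟨h.1.symm, fun i => (h.2 i).symm⟩⟩
      loopless := ⟨fun _ h => h.1 rfl⟩ }

theorem wordGraph_adjEq {I : Type} [Fintype I] [DecidableEq I] {G : FinGraph} {c : G.V → ℕ}
    (x y : (wordGraph I G c).V) :
    (wordGraph I G c).AdjEq x y ↔ ∀ i, G.AdjEq (x.1 i) (y.1 i) := by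
  constructor
  · rintro (h | h)
    · subst h; exact fun i => AdjEq.refl _
    · exact h.2
  · intro h
    by_cases hxy : x = y
    · exact Or.inl hxy
    · exact Or.inr ⟨hxy, h⟩

theorem wordGraph_congr {I J : Type} [Fintype I] [DecidableEq I] [Fintype J] [DecidableEq J]
    (e : I ≃ J) (G : FinGraph) (c : G.V → ℕ) :
    (wordGraph I G c).toClass = (wordGraph J G c).toClass := by
  refine toClass_eq (H := wordGraph J G c)
    ⟨fun x => ⟨x.1 ∘ e.symm, by rw [wordCount_comp_equiv, x.2]⟩,
      fun x => ⟨x.1 ∘ e, by rw [wordCount_comp_equiv, x.2]⟩,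
      fun x => Subtype.ext (by ext; simp), fun x => Subtype.ext (by ext; simp)⟩ fun x y => ?_
  rw [wordGraph_adjEq, wordGraph_adjEq]
  exact ⟨fun h i => by simpa using h (e i), fun h j => h (e.symm j)⟩

theorem toClass_typeGraph (G : FinGraph) (n : ℕ) (c : G.V → ℕ) :
    (typeGraph G n c).toClass = (wordGraph (Fin n) G c).toClass := by
  refine toClass_eq (H := wordGraph (Fin n) G c)
    (Equiv.subtypeEquivRight fun x => by
      rw [funext_iff]; rfl) fun x y => ?_
  rw [wordGraph_adjEq]
  constructor
  · intro h
    by_cases hxy : x = y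
    · exact Or.inl hxy
    · exact Or.inr ⟨fun h' => hxy (Subtype.ext h'), h⟩
  · rintro (h | h)
    · subst h; exact fun i => AdjEq.refl _
    · exact h.2

/-! ## The classes of the type graphs -/

/-- The class of the type graph of a vector of multiplicities. -/
def typeClass (G : FinGraph) (c : G.V → ℕ) : GraphClass :=
  (wordGraph (Fin (∑ v, c v)) G c).toClass

theorem toClass_wordGraph {I : Type} [Fintype I] [DecidableEq I] {G : FinGraph} {c : G.V → ℕ}
    (h : Fintype.card I = ∑ v, c v) : (wordGraph I G c).toClass = typeClass G c :=
  wordGraph_congr (Fintype.equivOfCardEq (by simpa using h)) G c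

theorem one_le_typeClass (G : FinGraph) (c : G.V → ℕ) : 1 ≤ typeClass G c := by
  obtain ⟨x, hx⟩ := exists_word (I := Fin (∑ v, c v)) c (by simp)
  exact one_le_toClass (G := wordGraph _ G c) ⟨x, hx⟩

theorem card_words_le {I V : Type} [Fintype I] [DecidableEq I] [Fintype V] [DecidableEq V]
    (c : V → ℕ) :
    Fintype.card {x : I → V // wordCount x = c} ≤ Fintype.card V ^ Fintype.card I :=
  (Fintype.card_subtype_le _).trans (by simp)

theorem typeClass_le_card_pow (G : FinGraph) (c : G.V → ℕ) :
    typeClass G c ≤ ((Fintype.card {x : Fin (∑ v, c v) → G.V // wordCount x = c} : ℕ) :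
      GraphClass) :=
  toClass_le_card _

/-- Concatenation of words; this is the superadditivity behind all growth rates. -/
theorem typeClass_mul_le (G : FinGraph) (c d : G.V → ℕ) :
    typeClass G c * typeClass G d ≤ typeClass G (c + d) := by
  rw [← toClass_wordGraph (I := Fin (∑ v, c v) ⊕ Fin (∑ v, d v)) (c := c + d)
    (by simp [Finset.sum_add_distrib]), typeClass, typeClass, ← toClass_strongProd, toClass_le_iff]
  refine ⟨fun x => ⟨Sum.elim x.1.1 x.2.1, by rw [wordCount_sumElim, x.1.2, x.2.2]⟩,
    fun x y h => ?_⟩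
  rw [wordGraph_adjEq] at h
  rw [strongProd_adjEq, wordGraph_adjEq, wordGraph_adjEq]
  exact ⟨fun i => h (Sum.inl i), fun i => h (Sum.inr i)⟩

theorem typeClass_map {G H : FinGraph} (φ : G.V → H.V)
    (hφ : ∀ x y, H.AdjEq (φ x) (φ y) → G.AdjEq x y) (c : G.V → ℕ) :
    typeClass G c ≤ typeClass H (pushCount φ c) := by
  rw [← toClass_wordGraph (I := Fin (∑ v, c v)) (c := pushCount φ c)
    (by rw [sum_pushCount]; simp), typeClass, toClass_le_iff]
  refine ⟨fun x => ⟨φ ∘ x.1, by rw [wordCount_comp, x.2]⟩, fun x y h => ?_⟩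
  rw [wordGraph_adjEq] at h ⊢
  exact fun i => hφ _ _ (h i)

/-- A word of pairs is a pair of words, whose types are the marginals. The converse bound fails for
a general `c` and holds, up to a polynomial factor, for a well chosen one: see `exists_jointType`.
-/
theorem typeClass_strongProd_le (G H : FinGraph) (c : G.V × H.V → ℕ) :
    typeClass (G.strongProd H) c ≤
      typeClass G (pushCount Prod.fst c) * typeClass H (pushCount Prod.snd c) := by
  rw [← toClass_wordGraph (I := Fin (∑ v, c v)) (c := pushCount Prod.fst c)
    (by rw [sum_pushCount]; simp), ← toClass_wordGraph (I := Fin (∑ v, c v))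
    (c := pushCount Prod.snd c) (by rw [sum_pushCount]; simp), typeClass, ← toClass_strongProd,
    toClass_le_iff]
  refine ⟨fun x => (⟨Prod.fst ∘ x.1, by rw [wordCount_comp, x.2]⟩,
    ⟨Prod.snd ∘ x.1, by rw [wordCount_comp, x.2]⟩), fun x y h => ?_⟩
  rw [strongProd_adjEq, wordGraph_adjEq, wordGraph_adjEq] at h
  rw [wordGraph_adjEq]
  exact fun i => (strongProd_adjEq _ _).2 ⟨h.1 i, h.2 i⟩

/-- A word whose letters are words of type `c` is flattened to a long word. Each block contributes
`c`, so the resulting type depends only on the number of blocks. -/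
theorem typeClass_wordGraph_le {I : Type} [Fintype I] [DecidableEq I] {G : FinGraph}
    {c : G.V → ℕ} (hI : Fintype.card I = ∑ v, c v) (k : (wordGraph I G c).V → ℕ) :
    typeClass (wordGraph I G c) k ≤ typeClass G ((∑ x, k x) • c) := by
  rw [← toClass_wordGraph (I := Fin (∑ v, k v) × I) (c := (∑ x, k x) • c)
    (by simp [hI, Finset.mul_sum]), typeClass, toClass_le_iff]
  refine ⟨fun z => ⟨fun p => (z.1 p.1).1 p.2, ?_⟩, fun x y h => ?_⟩
  · ext v
    refine (wordCount_uncurry (fun j => (z.1 j).1) v).trans ?_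
    simp [(z.1 _).2]
  · rw [wordGraph_adjEq] at h ⊢
    exact fun j => (wordGraph_adjEq _ _).2 fun i => h (j, i)

/-! ### Type graphs of disjoint unions and of sums of types -/

section Binomial

variable {I : Type} [Fintype I] [DecidableEq I] {n m : ℕ}

/-- A bijection that sends the left positions to the set `B`. -/
noncomputable def splitEquiv (hI : Fintype.card I = n + m) (B : {B : Finset I // B.card = n}) :
    Fin n ⊕ Fin m ≃ I :=
  ((Fintype.equivOfCardEq (by simp [B.2]) : Fin n ≃ {i // i ∈ B.1}).sumCongr
    (Fintype.equivOfCardEq (by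
      rw [Fintype.card_subtype_compl, Fintype.card_coe, B.2, hI]; simp) :
      Fin m ≃ {i // ¬ i ∈ B.1})).trans (Equiv.sumCompl fun i => i ∈ B.1)

theorem splitEquiv_inl_mem (hI : Fintype.card I = n + m) (B : {B : Finset I // B.card = n})
    (i : Fin n) : splitEquiv hI B (Sum.inl i) ∈ B.1 := by
  simp [splitEquiv]

theorem splitEquiv_inr_notMem (hI : Fintype.card I = n + m) (B : {B : Finset I // B.card = n})
    (i : Fin m) : splitEquiv hI B (Sum.inr i) ∉ B.1 := by
  simp only [splitEquiv, Equiv.trans_apply, Equiv.sumCongr_apply, Sum.map_inr,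
    Equiv.sumCompl_apply_inr]
  exact ((Fintype.equivOfCardEq _ : Fin m ≃ {i // ¬ i ∈ B.1}) i).2

theorem wordCount_sumMap {J K V W : Type} [Fintype J] [Fintype K] [DecidableEq V] [DecidableEq W]
    (x : J → V) (y : K → W) :
    wordCount (Sum.map x y) = Sum.elim (wordCount x) (wordCount y) := by
  ext (v | w)
  · simp only [wordCount_eq_sum, Sum.elim_inl, Fintype.sum_sum_type, Sum.map_inl, Sum.map_inr,
      Sum.inl.injEq, reduceCtorEq, if_false, Finset.sum_const_zero, add_zero]
  · simp only [wordCount_eq_sum, Sum.elim_inr, Fintype.sum_sum_type, Sum.map_inl, Sum.map_inr,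
      Sum.inr.injEq, reduceCtorEq, if_false, Finset.sum_const_zero, zero_add]

/-- A word over the disjoint union is determined by the set `B` of positions carrying letters of
`G`, a word over `G` and a word over `H`. There are no edges between `G` and `H`, so words with
different `B` are never `≃`, and the binomial coefficient counts the possible sets `B`. -/
theorem typeClass_disjUnion (G H : FinGraph) (c : G.V → ℕ) (d : H.V → ℕ) :
    typeClass (G.disjUnion H) (Sum.elim c d) ≤
        (((∑ v, c v) + ∑ v, d v).choose (∑ v, c v) : GraphClass) *
          (typeClass G c * typeClass H d) ∧
      (((∑ v, c v) + ∑ v, d v).choose (∑ v, c v) : GraphClass) *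
          (typeClass G c * typeClass H d) ≤ typeClass (G.disjUnion H) (Sum.elim c d) := by
  set n := ∑ v, c v with hn
  set m := ∑ v, d v with hm
  have hI : Fintype.card (Fin (n + m)) = n + m := by simp
  let j : {B : Finset (Fin (n + m)) // B.card = n} →
      ((wordGraph (Fin n) G c).strongProd (wordGraph (Fin m) H d)).V →
      (wordGraph (Fin (n + m)) (G.disjUnion H) (Sum.elim c d)).V := fun B x =>
    ⟨Sum.map x.1.1 x.2.1 ∘ (splitEquiv hI B).symm, by
      rw [wordCount_comp_equiv, wordCount_sumMap, x.1.2, x.2.2]⟩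
  have hj : ∀ B x i, (j B x).1 (splitEquiv hI B i) = Sum.map x.1.1 x.2.1 i := fun B x i => by
    simp [j]
  have hB : Fintype.card {B : Finset (Fin (n + m)) // B.card = n} = (n + m).choose n := by
    simp
  have e : typeClass (G.disjUnion H) (Sum.elim c d)
      = (wordGraph (Fin (n + m)) (G.disjUnion H) (Sum.elim c d)).toClass :=
    (toClass_wordGraph (by simp [hn, hm])).symm
  rw [← hB, e, typeClass, typeClass, ← toClass_strongProd]
  have key : ∀ B x y, (∀ i, (G.disjUnion H).AdjEq ((j B x).1 i) ((j B y).1 i)) ↔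
      ((wordGraph (Fin n) G c).strongProd (wordGraph (Fin m) H d)).AdjEq x y := by
    intro B x y
    rw [strongProd_adjEq, wordGraph_adjEq, wordGraph_adjEq]
    constructor
    · intro h
      constructor
      · intro i
        have := h (splitEquiv hI B (Sum.inl i))
        rw [hj, hj, disjUnion_adjEq] at this
        simpa using this
      · intro i
        have := h (splitEquiv hI B (Sum.inr i))
        rw [hj, hj, disjUnion_adjEq] at this
        simpa using this
    · intro h i
      obtain ⟨i, rfl⟩ := (splitEquiv hI B).surjective i
      rw [hj, hj, disjUnion_adjEq]
      rcases i with i | i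
      · simpa using h.1 i
      · simpa using h.2 i
  constructor
  · refine toClass_le_card_mul j (fun B x y h => (wordGraph_adjEq _ _).2 ((key B x y).2 h)) ?_
    rintro ⟨z, hz⟩
    let B : Finset (Fin (n + m)) := Finset.univ.filter fun i => (z i).isLeft
    have hB : B.card = n := by
      have : ∀ v, wordCount z (Sum.inl v) = c v := fun v => by rw [hz]; rfl
      refine Eq.trans ?_ hn.symm
      simp only [← this, wordCount_eq_sum, B, Finset.card_filter]
      rw [Finset.sum_comm]
      refine Finset.sum_congr rfl fun i _ => ?_
      rcases z i with a | a <;> simp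
    have hl : ∀ i : Fin n, ∃ v, z (splitEquiv hI ⟨B, hB⟩ (Sum.inl i)) = Sum.inl v := fun i => by
      have := splitEquiv_inl_mem hI ⟨B, hB⟩ i
      simp only [B, Finset.mem_filter, Finset.mem_univ, true_and] at this
      exact Sum.isLeft_iff.1 this
    have hr : ∀ i : Fin m, ∃ v, z (splitEquiv hI ⟨B, hB⟩ (Sum.inr i)) = Sum.inr v := fun i => by
      have := splitEquiv_inr_notMem hI ⟨B, hB⟩ i
      simp only [B, Finset.mem_filter, Finset.mem_univ, true_and, Sum.not_isLeft] at this
      exact Sum.isRight_iff.1 this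
    choose x hx using hl
    choose y hy using hr
    have hxy : z ∘ splitEquiv hI ⟨B, hB⟩ = Sum.map x y := by
      ext (i | i)
      · simp [hx]
      · simp [hy]
    have hc : Sum.elim (wordCount x) (wordCount y) = Sum.elim c d := by
      rw [← wordCount_sumMap, ← hxy, wordCount_comp_equiv]
      exact hz
    refine ⟨⟨B, hB⟩, (⟨x, funext fun v => congrFun hc (Sum.inl v)⟩,
      ⟨y, funext fun v => congrFun hc (Sum.inr v)⟩), Subtype.ext ?_⟩
    change Sum.map x y ∘ (splitEquiv hI ⟨B, hB⟩).symm = z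
    rw [← hxy]
    ext i
    simp
  · rw [← toClass_edgeless, ← toClass_strongProd, toClass_le_iff]
    refine ⟨fun p => j p.1 p.2, ?_⟩
    rintro ⟨B, x⟩ ⟨B', y⟩ h
    rw [wordGraph_adjEq] at h
    have hmem : ∀ B x i, ((j B x).1 i).isLeft = true ↔ i ∈ B.1 := by
      intro B x i
      obtain ⟨i, rfl⟩ := (splitEquiv hI B).surjective i
      rw [hj]
      rcases i with i | i
      · simpa using splitEquiv_inl_mem hI B i
      · simpa using splitEquiv_inr_notMem hI B i
    have hBB : B = B' := by
      refine Subtype.ext (Finset.ext fun i => ?_)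
      rw [← hmem B x i, ← hmem B' y i]
      have := h i
      rw [disjUnion_adjEq] at this
      dsimp only at this
      generalize (j B x).1 i = a at this
      generalize (j B' y).1 i = b at this
      cases this <;> simp
    subst hBB
    rw [strongProd_adjEq, edgeless_adjEq]
    exact ⟨rfl, (key B x y).1 h⟩

/-- A word of type `c + d` lifts to a word over `G ⊔ G` with `c` letters in the first copy and `d`
in the second. Folding the copies together recovers the word and preserves `≃`, so the lift is a
cohomomorphism, and `typeClass_disjUnion` applies. This is the converse of `typeClass_mul_le` at the
price of a binomial coefficient. -/
theorem typeClass_add_le (G : FinGraph) (c d : G.V → ℕ) :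
    typeClass G (c + d) ≤ (((∑ v, c v) + ∑ v, d v).choose (∑ v, c v) : GraphClass) *
          (typeClass G c * typeClass G d) := by
  refine le_trans ?_ (typeClass_disjUnion G G c d).1
  have hI : Fintype.card (Fin (∑ v, (c + d) v)) = ∑ v, Sum.elim c d v := by
    simp [Finset.sum_add_distrib]
  rw [typeClass, ← toClass_wordGraph (G := G.disjUnion G) (c := Sum.elim c d) hI, toClass_le_iff]
  have h := fun x : (wordGraph (Fin (∑ v, (c + d) v)) G (c + d)).V =>
    exists_lift (Sum.elim id id : G.V ⊕ G.V → G.V) (Sum.elim c d) x.1 hI (by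
      rw [x.2]
      ext v
      simp only [pushCount, Fintype.sum_sum_type, Sum.elim_inl, Sum.elim_inr, id]
      rw [Finset.sum_eq_single v, Finset.sum_eq_single v] <;> simp +contextual)
  choose y hy hyx using h
  refine ⟨fun x => ⟨y x, hy x⟩, fun x x' hxx => ?_⟩
  rw [wordGraph_adjEq] at hxx ⊢
  intro i
  have := hxx i
  rw [disjUnion_adjEq] at this
  rw [← congrFun (hyx x) i, ← congrFun (hyx x') i]
  simp only [Function.comp_apply]
  dsimp only at this
  generalize y x i = a at this
  generalize y x' i = b at this
  cases this <;> simpa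

end Binomial

/-! ## Coverings by translates -/

section Covering

set_option linter.unusedSectionVars false

variable {Γ X : Type*} [Group Γ] [Fintype Γ] [Fintype X] [DecidableEq X] [MulAction Γ X]
  [MulAction.IsPretransitive Γ X]

/-- Translation by group elements on both sides gives a bijection of the two transporters, by
transitivity. Hence a random translate of a fixed point is uniformly distributed. -/
theorem card_smul_eq (b u b' u' : X) :
    (Finset.univ.filter fun σ : Γ => σ • b = u).card =
      (Finset.univ.filter fun σ : Γ => σ • b' = u').card := by
  obtain ⟨τ, hτ⟩ := MulAction.exists_smul_eq Γ b' b
  obtain ⟨τ', hτ'⟩ := MulAction.exists_smul_eq Γ u u'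
  refine Finset.card_equiv ((Equiv.mulLeft τ').trans (Equiv.mulRight τ)) fun σ => ?_
  simp only [Finset.mem_filter, Finset.mem_univ, true_and, Equiv.trans_apply, Equiv.coe_mulLeft,
    Equiv.coe_mulRight, mul_smul, hτ, ← hτ']
  exact (smul_left_cancel_iff τ').symm

/-- Some translate of `B` contains at least the average proportion of `U`. -/
theorem exists_translate (B U : Finset X) :
    ∃ σ : Γ, B.card * U.card ≤ Fintype.card X * (U.filter fun u => σ⁻¹ • u ∈ B).card := by
  by_contra! hlt
  -- Double counting of the triples `(σ, b, u)` with `σ • b = u`: the sum is `|U| |B| M` with `M`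
  -- the common transporter size, and `|Γ| = |X| M`. If all translates were below the average `|B|
  -- |U| / |X|`, the sum would be too small.
  have h₁ : ∑ σ : Γ, (U.filter fun u => σ⁻¹ • u ∈ B).card
      = ∑ u ∈ U, ∑ b ∈ B, (Finset.univ.filter fun σ : Γ => σ • b = u).card := by
    have : ∀ σ : Γ, (U.filter fun u => σ⁻¹ • u ∈ B).card
        = ∑ u ∈ U, ∑ b ∈ B, if σ • b = u then 1 else 0 := fun σ => by
      rw [Finset.card_filter]
      refine Finset.sum_congr rfl fun u _ => ?_
      simp only [← eq_inv_smul_iff (g := σ)]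
      rw [Finset.sum_ite_eq']
    simp only [this, Finset.card_filter]
    rw [Finset.sum_comm]
    refine Finset.sum_congr rfl fun u _ => ?_
    rw [Finset.sum_comm]
  obtain h0 | ⟨⟨x₀⟩⟩ := isEmpty_or_nonempty X
  · have := hlt 1
    have hU : U = ∅ := Finset.eq_empty_of_isEmpty U
    simp [hU] at this
  set M := (Finset.univ.filter fun σ : Γ => σ • x₀ = x₀).card
  have h₂ : ∀ b u : X, (Finset.univ.filter fun σ : Γ => σ • b = u).card = M :=
    fun b u => card_smul_eq b u x₀ x₀
  have h₃ : Fintype.card Γ = Fintype.card X * M := by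
    have := Finset.card_eq_sum_card_fiberwise (s := (Finset.univ : Finset Γ)) (t := Finset.univ)
      (f := fun σ => σ • x₀) (fun _ _ => Finset.mem_coe.2 (Finset.mem_univ _))
    simp only [h₂] at this
    simpa using this
  have h₄ : ∑ σ : Γ, Fintype.card X * (U.filter fun u => σ⁻¹ • u ∈ B).card
      < ∑ σ : Γ, B.card * U.card :=
    Finset.sum_lt_sum_of_nonempty ⟨1, Finset.mem_univ _⟩ fun σ _ => hlt σ
  rw [← Finset.mul_sum, h₁] at h₄
  simp only [h₂, Finset.sum_const, Finset.card_univ, smul_eq_mul] at h₄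
  rw [h₃] at h₄
  exact absurd h₄ (not_lt.2 (by apply le_of_eq; ring))

/-- Greedy covering: by `exists_translate` the next translate can be chosen to meet at least a
fraction `1 / P` of the uncovered set, so that set shrinks by a factor `1 - 1 / P ≤ exp (-1 / P)`
each time. -/
theorem exists_translates {B : Finset X} {P : ℕ} (hP : 0 < P)
    (hB : Fintype.card X ≤ P * B.card) (t : ℕ) :
    ∃ σ : Fin t → Γ, ((Finset.univ.filter fun x => ∀ i, (σ i)⁻¹ • x ∉ B).card : ℝ) ≤
      Fintype.card X * Real.exp (-(t / P : ℝ)) := by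
  induction t with
  | zero => exact ⟨Fin.elim0, by simp⟩
  | succ t ih =>
    obtain ⟨σ, hσ⟩ := ih
    set U := Finset.univ.filter fun x => ∀ i, (σ i)⁻¹ • x ∉ B with hU
    obtain ⟨τ, hτ⟩ := exists_translate (Γ := Γ) B U
    refine ⟨Fin.cons τ σ, ?_⟩
    have hU' : (Finset.univ.filter fun x => ∀ i, ((Fin.cons τ σ : Fin (t + 1) → Γ) i)⁻¹ • x ∉ B)
        = U.filter fun u => ¬ τ⁻¹ • u ∈ B := by
      ext x
      simp [hU, Fin.forall_fin_succ, and_comm]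
    rw [hU']
    have hsplit := Finset.card_filter_add_card_filter_not (s := U) (fun u => τ⁻¹ • u ∈ B)
    set p := (U.filter fun u => τ⁻¹ • u ∈ B).card
    set q := (U.filter fun u => ¬ τ⁻¹ • u ∈ B).card
    have hP' : (0 : ℝ) < P := by exact_mod_cast hP
    have hpU : U.card ≤ P * p := by
      by_cases hB0 : B.card = 0
      · have : Fintype.card X = 0 := by rw [hB0] at hB; simpa using hB
        have := U.card_le_univ
        omega
      · have h1 : B.card * U.card ≤ B.card * (P * p) :=
          hτ.trans ((Nat.mul_le_mul_right _ hB).trans (le_of_eq (by ring)))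
        exact Nat.le_of_mul_le_mul_left h1 (Nat.pos_of_ne_zero hB0)
    have hq : (q : ℝ) ≤ U.card * (1 - 1 / P) := by
      have h1 : (p : ℝ) + q = U.card := by exact_mod_cast hsplit
      have h2 : (U.card : ℝ) ≤ P * p := by exact_mod_cast hpU
      have h3 : (U.card : ℝ) / P ≤ p := by rw [div_le_iff₀ hP']; linarith
      have h4 : (U.card : ℝ) * (1 - 1 / P) = U.card - U.card / P := by ring
      linarith
    calc (q : ℝ) ≤ U.card * (1 - 1 / P) := hq
      _ ≤ U.card * Real.exp (-(1 / P : ℝ)) := by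
          gcongr
          exact Real.one_sub_le_exp_neg _
      _ ≤ (Fintype.card X * Real.exp (-(t / P : ℝ))) * Real.exp (-(1 / P : ℝ)) := by gcongr
      _ = Fintype.card X * Real.exp (-((t + 1 : ℕ) / P : ℝ)) := by
          rw [mul_assoc, ← Real.exp_add]
          push_cast
          ring_nf

/-- After `P * L` greedy steps the uncovered set has fewer than `|X| exp (-L) < 1` elements. The
number of translates is thus the inverse density times a logarithm of `|X|`, hence polynomial in the
word length in the applications. -/
theorem exists_covering {B : Finset X} {P L : ℕ} (hP : 0 < P)
    (hB : Fintype.card X ≤ P * B.card) (hL : (Fintype.card X : ℝ) < Real.exp L) :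
    ∃ σ : Fin (P * L) → Γ, ∀ x, ∃ i, ∃ b ∈ B, σ i • b = x := by
  obtain ⟨σ, hσ⟩ := exists_translates (Γ := Γ) hP hB (P * L)
  refine ⟨σ, fun x => ?_⟩
  by_contra! hx
  have h₁ : 0 < (Finset.univ.filter fun x => ∀ i, (σ i)⁻¹ • x ∉ B).card := by
    refine Finset.card_pos.2 ⟨x, ?_⟩
    simp only [Finset.mem_filter, Finset.mem_univ, true_and]
    exact fun i hi => hx i _ hi (smul_inv_smul _ _)
  have h₂ : (1 : ℝ) ≤ (Finset.univ.filter fun x => ∀ i, (σ i)⁻¹ • x ∉ B).card := by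
    exact_mod_cast h₁
  have hP' : (P : ℝ) ≠ 0 := by exact_mod_cast hP.ne'
  have h₃ : ((P * L : ℕ) : ℝ) / P = L := by push_cast; field_simp
  rw [h₃, Real.exp_neg] at hσ
  have := Real.exp_pos (L : ℝ)
  have : (Fintype.card X : ℝ) * (Real.exp L)⁻¹ < 1 := by
    rw [← div_eq_mul_inv, div_lt_one this]
    exact hL
  linarith

end Covering

/-! ## Vertex transitive graphs -/

namespace FinGraph

/-- The group of automorphisms of the relation `≃`. -/
def autGroup (X : FinGraph) : Subgroup (Equiv.Perm X.V) where
  carrier := {e | ∀ a b, X.AdjEq (e a) (e b) ↔ X.AdjEq a b}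
  mul_mem' := fun {e f} he hf a b => (he _ _).trans (hf _ _)
  one_mem' := fun _ _ => Iff.rfl
  inv_mem' := fun {e} he a b => by
    rw [← he]
    simp

/-- Any two vertices are related by an automorphism. -/
def IsVertexTransitive (X : FinGraph) : Prop := ∀ x y, ∃ e ∈ X.autGroup, e x = y

/-- The subgraph induced on the fibre of a labelling of the vertices. -/
abbrev fiber {K : Type*} [DecidableEq K] (X : FinGraph) (κ : X.V → K) (k : K) : FinGraph :=
  ⟨{x // κ x = k}, X.graph.comap Subtype.val⟩

theorem fiber_adjEq {K : Type*} [DecidableEq K] {X : FinGraph} {κ : X.V → K} {k : K}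
    (x y : (X.fiber κ k).V) : (X.fiber κ k).AdjEq x y ↔ X.AdjEq x.1 y.1 :=
  or_congr Subtype.ext_iff Iff.rfl

/-- A vertex transitive graph is bounded by a few copies of a fibre of any labelling. -/
theorem IsVertexTransitive.exists_le_fiber {X : FinGraph} (hX : X.IsVertexTransitive)
    [Nonempty X.V] {K : Type*} [DecidableEq K] (κ : X.V → K) (T : Finset K) (hT : ∀ x, κ x ∈ T)
    {L : ℕ} (hL : (Fintype.card X.V : ℝ) < Real.exp L) :
    ∃ x, X.toClass ≤ ((T.card * L : ℕ) : GraphClass) * (X.fiber κ (κ x)).toClass := by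
  classical
  have hTpos : 0 < T.card := Finset.card_pos.2 ⟨_, hT (Classical.arbitrary _)⟩
  -- Pigeonhole: the most frequent label has density at least `1 / |T|`.
  obtain ⟨k, -, hk⟩ : ∃ k ∈ T, Fintype.card X.V ≤
      T.card * (Finset.univ.filter fun x => κ x = k).card := by
    by_contra! h
    have h₁ := Finset.card_eq_sum_card_fiberwise (s := (Finset.univ : Finset X.V)) (t := T)
      (f := κ) (fun x _ => Finset.mem_coe.2 (hT x))
    have h₂ : ∑ k ∈ T, T.card * (Finset.univ.filter fun x => κ x = k).card
        < ∑ k ∈ T, Fintype.card X.V := Finset.sum_lt_sum_of_nonempty (Finset.card_pos.1 hTpos) h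
    rw [← Finset.mul_sum, ← h₁] at h₂
    simp at h₂
  obtain ⟨x₀, hx₀⟩ : ∃ x, κ x = k := by
    by_contra! h
    have h0 : (Finset.univ.filter fun x => κ x = k).card = 0 := by
      simp [h]
    rw [h0, Nat.mul_zero] at hk
    exact absurd hk (not_le.2 Fintype.card_pos)
  refine ⟨x₀, ?_⟩
  subst hx₀
  have : MulAction.IsPretransitive X.autGroup X.V :=
    ⟨fun x y => by
      obtain ⟨e, he, h⟩ := hX x y
      exact ⟨⟨e, he⟩, h⟩⟩
  obtain ⟨σ, hσ⟩ := exists_covering (Γ := X.autGroup) hTpos hk hL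
  have := toClass_le_card_mul (X := X) (Y := X.fiber κ (κ x₀)) (K := Fin (T.card * L))
    (fun i y => σ i • y.1) (fun i y y' h => ((σ i).2 _ _).2 ((fiber_adjEq _ _).1 h)) (fun x => by
      obtain ⟨i, b, hb, h⟩ := hσ x
      exact ⟨i, ⟨b, by simpa using hb⟩, h⟩)
  rwa [Fintype.card_fin] at this

theorem isVertexTransitive_wordGraph (I : Type) [Fintype I] [DecidableEq I] (G : FinGraph)
    (c : G.V → ℕ) : (wordGraph I G c).IsVertexTransitive := by
  intro x y
  obtain ⟨σ, hσ⟩ := exists_perm_of_wordCount_eq (x.2.trans y.2.symm)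
  refine ⟨⟨fun z => ⟨z.1 ∘ σ, by rw [wordCount_comp_equiv, z.2]⟩,
      fun z => ⟨z.1 ∘ σ.symm, by rw [wordCount_comp_equiv, z.2]⟩,
      fun z => Subtype.ext (by ext; simp), fun z => Subtype.ext (by ext; simp)⟩, fun a b => ?_,
      Subtype.ext hσ⟩
  rw [wordGraph_adjEq, wordGraph_adjEq]
  exact ⟨fun h i => by simpa using h (σ.symm i), fun h i => h (σ i)⟩

theorem IsVertexTransitive.strongProd {X Y : FinGraph} (hX : X.IsVertexTransitive)
    (hY : Y.IsVertexTransitive) : (X.strongProd Y).IsVertexTransitive := by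
  rintro ⟨x, y⟩ ⟨x', y'⟩
  obtain ⟨e, he, hex⟩ := hX x x'
  obtain ⟨f, hf, hfy⟩ := hY y y'
  refine ⟨e.prodCongr f, fun a b => ?_, Prod.ext hex hfy⟩
  rw [strongProd_adjEq, strongProd_adjEq]
  exact and_congr (he _ _) (hf _ _)

/-- The strong power with factors indexed by a finite type. -/
abbrev power (X : FinGraph) (J : Type) [Fintype J] [DecidableEq J] : FinGraph where
  V := J → X.V
  graph :=
    { Adj := fun x y => x ≠ y ∧ ∀ i, X.AdjEq (x i) (y i)
      symm := ⟨fun _ _ h => ⟨h.1.symm, fun i => (h.2 i).symm⟩⟩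
      loopless := ⟨fun _ h => h.1 rfl⟩ }

theorem power_adjEq {X : FinGraph} {J : Type} [Fintype J] [DecidableEq J] (x y : J → X.V) :
    (X.power J).AdjEq x y ↔ ∀ i, X.AdjEq (x i) (y i) := by
  constructor
  · rintro (h | h)
    · subst h; exact fun i => AdjEq.refl _
    · exact h.2
  · intro h
    by_cases hxy : x = y
    · exact Or.inl hxy
    · exact Or.inr ⟨hxy, h⟩

theorem toClass_power (X : FinGraph) (m : ℕ) : (X.power (Fin m)).toClass = X.toClass ^ m := by
  induction m with
  | zero =>
    rw [pow_zero]
    exact toClass_eq (H := FinGraph.point) (Equiv.ofUnique _ _) fun x y =>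
      ⟨fun _ => Or.inl (Subsingleton.elim _ _), fun _ => Or.inl rfl⟩
  | succ m ih =>
    rw [pow_succ', ← ih, ← toClass_strongProd]
    refine (toClass_eq (G := X.strongProd (X.power (Fin m))) (Fin.consEquiv fun _ => X.V)
      fun x y => ?_).symm
    rw [power_adjEq, strongProd_adjEq, power_adjEq, Fin.forall_fin_succ]
    simp [Fin.consEquiv]

theorem IsVertexTransitive.power {X : FinGraph} (hX : X.IsVertexTransitive) (J : Type) [Fintype J]
    [DecidableEq J] : (X.power J).IsVertexTransitive := by
  intro x y
  choose e he hxy using fun i => hX (x i) (y i)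
  refine ⟨Equiv.piCongrRight e, fun a b => ?_, funext hxy⟩
  rw [power_adjEq, power_adjEq]
  exact forall_congr' fun i => he i _ _

end FinGraph

theorem wordCount_mem_piFinset {I V : Type} [Fintype I] [Fintype V] [DecidableEq V] (x : I → V) :
    wordCount x ∈ Fintype.piFinset fun _ : V => Finset.range (Fintype.card I + 1) := by
  rw [Fintype.mem_piFinset]
  intro v
  rw [Finset.mem_range, Nat.lt_succ_iff]
  exact Finset.card_le_univ _

/-- A natural number `L` with `|X| < exp L`, growing only linearly in the word length `n`. The `+ 1`
makes the inequality strict, as the covering argument requires. -/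
theorem pow_card_lt_exp (a n : ℕ) : ((a ^ n : ℕ) : ℝ) < Real.exp ((a * n + 1 : ℕ) : ℝ) := by
  have h : (a : ℝ) ≤ Real.exp a := by
    have := Real.add_one_le_exp (a : ℝ)
    linarith
  calc ((a ^ n : ℕ) : ℝ) = (a : ℝ) ^ n := by push_cast; rfl
    _ ≤ Real.exp a ^ n := by gcongr
    _ = Real.exp ((a * n : ℕ) : ℝ) := by rw [← Real.exp_nat_mul]; push_cast; ring_nf
    _ < _ := by
      rw [Real.exp_lt_exp]
      push_cast
      linarith

/-- Two types of the same size are the marginals of a joint type with a large type graph. -/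
theorem exists_jointType (G H : FinGraph) {n : ℕ} (c : G.V → ℕ) (d : H.V → ℕ)
    (hc : ∑ v, c v = n) (hd : ∑ v, d v = n) :
    ∃ e : (G.strongProd H).V → ℕ, pushCount Prod.fst e = c ∧ pushCount Prod.snd e = d ∧
      typeClass G c * typeClass H d ≤
        (((n + 1) ^ (Fintype.card (G.V × H.V)) *
          (Fintype.card G.V * Fintype.card H.V * n + 1) : ℕ) : GraphClass) *
          typeClass (G.strongProd H) e := by
  set X := (wordGraph (Fin n) G c).strongProd (wordGraph (Fin n) H d) with hX
  have hXt : X.IsVertexTransitive :=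
    (isVertexTransitive_wordGraph _ _ _).strongProd (isVertexTransitive_wordGraph _ _ _)
  obtain ⟨x₀, hx₀⟩ := exists_word (I := Fin n) c (by simp [hc])
  obtain ⟨y₀, hy₀⟩ := exists_word (I := Fin n) d (by simp [hd])
  have : Nonempty X.V := ⟨(⟨x₀, hx₀⟩, ⟨y₀, hy₀⟩)⟩
  -- A pair of words is labelled by its joint type; a vector of `|V(G)| |V(H)|` numbers at most `n`
  -- leaves only polynomially many labels.
  let κ : X.V → (G.V × H.V → ℕ) := fun z => wordCount fun i => (z.1.1 i, z.2.1 i)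
  have hL : (Fintype.card X.V : ℝ) <
      Real.exp ((Fintype.card G.V * Fintype.card H.V * n + 1 : ℕ) : ℝ) := by
    refine lt_of_le_of_lt ?_ (pow_card_lt_exp (Fintype.card G.V * Fintype.card H.V) n)
    rw [Nat.cast_le, mul_pow]
    refine (Fintype.card_prod _ _).le.trans (Nat.mul_le_mul ?_ ?_)
    · simpa using card_words_le (I := Fin n) c
    · simpa using card_words_le (I := Fin n) d
  obtain ⟨z, hz⟩ := hXt.exists_le_fiber κ
    (Fintype.piFinset fun _ => Finset.range (n + 1))
    (fun x => by simpa using wordCount_mem_piFinset fun i => (x.1.1 i, x.2.1 i)) hL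
  have h₁ : pushCount Prod.fst (κ z) = c := by
    rw [← z.1.2]
    exact (wordCount_comp Prod.fst fun i => (z.1.1 i, z.2.1 i)).symm
  have h₂ : pushCount Prod.snd (κ z) = d := by
    rw [← z.2.2]
    exact (wordCount_comp Prod.snd fun i => (z.1.1 i, z.2.1 i)).symm
  refine ⟨κ z, h₁, h₂, ?_⟩
  have hsum : ∑ p, κ z p = n := by
    have := sum_pushCount Prod.fst (κ z)
    rw [h₁, hc] at this
    exact this.symm
  rw [← toClass_wordGraph (I := Fin n) (by simp [hc]), ← toClass_wordGraph (I := Fin n) (c := d)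
    (by simp [hd]), ← toClass_wordGraph (G := G.strongProd H) (I := Fin n) (c := κ z)
    (by simp [hsum]), ← toClass_strongProd]
  refine hz.trans ?_
  rw [Fintype.card_piFinset]
  simp only [Finset.card_range, Finset.prod_const, Finset.card_univ]
  rw [← toClass_edgeless_fin, ← toClass_strongProd, ← toClass_strongProd, toClass_le_iff]
  refine ⟨fun p => (p.1, ⟨fun i => (p.2.1.1.1 i, p.2.1.2.1 i), p.2.2⟩), fun p q h => ?_⟩
  rw [strongProd_adjEq] at h ⊢
  refine ⟨h.1, ?_⟩
  have h' := (wordGraph_adjEq _ _).1 h.2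
  refine (fiber_adjEq _ _).2 ((strongProd_adjEq _ _).2 ⟨(wordGraph_adjEq _ _).2 fun i => ?_,
    (wordGraph_adjEq _ _).2 fun i => ?_⟩)
  · exact ((strongProd_adjEq _ _).1 (h' i)).1
  · exact ((strongProd_adjEq _ _).1 (h' i)).2

/-- Some type graph of a vertex transitive graph is nearly as large as the strong power. -/
theorem FinGraph.IsVertexTransitive.exists_type {X : FinGraph} (hX : X.IsVertexTransitive)
    [Nonempty X.V] (m : ℕ) :
    ∃ k : X.V → ℕ, ∑ x, k x = m ∧ X.toClass ^ m ≤
      (((m + 1) ^ Fintype.card X.V * (Fintype.card X.V * m + 1) : ℕ) : GraphClass) *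
        typeClass X k := by
  have hL : (Fintype.card (X.power (Fin m)).V : ℝ) <
      Real.exp ((Fintype.card X.V * m + 1 : ℕ) : ℝ) := by
    refine lt_of_le_of_lt (le_of_eq ?_) (pow_card_lt_exp (Fintype.card X.V) m)
    simp
  obtain ⟨z, hz⟩ := (hX.power (Fin m)).exists_le_fiber (fun z : Fin m → X.V => wordCount z)
    (Fintype.piFinset fun _ => Finset.range (m + 1))
    (fun x => by simpa using wordCount_mem_piFinset x) hL
  have hsum : ∑ x, wordCount z x = m := by simpa using sum_wordCount z
  refine ⟨wordCount z, hsum, ?_⟩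
  rw [← toClass_power, ← toClass_wordGraph (I := Fin m) (c := wordCount z) (by simp [hsum])]
  refine hz.trans ?_
  rw [Fintype.card_piFinset]
  simp only [Finset.card_range, Finset.prod_const, Finset.card_univ]
  rw [← toClass_edgeless_fin, ← toClass_strongProd, ← toClass_strongProd, toClass_le_iff]
  refine ⟨id, fun p q h => ?_⟩
  rw [strongProd_adjEq] at h ⊢
  exact ⟨h.1, (fiber_adjEq _ _).2 ((power_adjEq _ _).2 ((wordGraph_adjEq _ _).1 h.2))⟩

/-! ## Multiplicative functionals and their values -/

/-- A multiplicative monotone functional that is normalized on the edgeless graphs. -/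
structure IsNormalized (F : GraphClass →* ℝ≥0) : Prop where
  mono : Monotone F
  map_natCast : ∀ n : ℕ, F n = n

theorem isNormalized_of_mem {f : GraphClass →+* ℝ≥0} (hf : f ∈ asymptoticSpectrum GraphClass) :
    IsNormalized (f : GraphClass →* ℝ≥0) :=
  ⟨hf, fun n => map_natCast f n⟩

/-- The weighted geometric mean of two functionals. -/
noncomputable def geomMean (F F' : GraphClass →* ℝ≥0) (a b : ℝ) : GraphClass →* ℝ≥0 where
  toFun X := F X ^ a * F' X ^ b
  map_one' := by simp
  map_mul' X Y := by
    rw [map_mul, map_mul, NNReal.mul_rpow, NNReal.mul_rpow]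
    ring

theorem IsNormalized.geomMean {F F' : GraphClass →* ℝ≥0} (hF : IsNormalized F)
    (hF' : IsNormalized F') {a b : ℝ} (ha : 0 ≤ a) (hb : 0 ≤ b) (hab : a + b = 1) :
    IsNormalized (geomMean F F' a b) where
  mono X Y h := mul_le_mul' (NNReal.rpow_le_rpow (hF.mono h) ha)
    (NNReal.rpow_le_rpow (hF'.mono h) hb)
  map_natCast n := by
    change F n ^ a * F' n ^ b = n
    rw [hF.map_natCast, hF'.map_natCast, ← NNReal.rpow_add_of_nonneg _ ha hb, hab,
      NNReal.rpow_one]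

/-- The value of a functional on a type graph with weights on the letters. -/
noncomputable def typeValue (F : GraphClass →* ℝ≥0) (G : FinGraph) (w : G.V → ℝ≥0)
    (c : G.V → ℕ) : ℝ≥0 :=
  F (typeClass G c) * ∏ v, w v ^ c v

/-- The growth rate of the values on the type graphs. -/
noncomputable def value (F : GraphClass →* ℝ≥0) (G : FinGraph) (w : G.V → ℝ≥0) : ℝ≥0 :=
  ⨆ c : {c : G.V → ℕ // c ≠ 0}, typeValue F G w c.1 ^ (((∑ v, c.1 v : ℕ) : ℝ)⁻¹)

theorem sum_ne_zero_of_ne_zero {V : Type} [Fintype V] {c : V → ℕ} (hc : c ≠ 0) :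
    ∑ v, c v ≠ 0 := by
  intro h
  refine hc (funext fun v => ?_)
  exact (Finset.sum_eq_zero_iff.1 h) v (Finset.mem_univ v)

theorem prod_pow_pushCount {U V : Type} [Fintype U] [Fintype V] [DecidableEq V] (φ : U → V)
    (c : U → ℕ) (w : V → ℝ≥0) : ∏ v, w v ^ pushCount φ c v = ∏ u, w (φ u) ^ c u := by
  simp only [pushCount, ← Finset.prod_pow_eq_pow_sum]
  rw [Finset.prod_comm]
  refine Finset.prod_congr rfl fun u _ => ?_
  rw [Finset.prod_eq_single (φ u)] <;> simp +contextual [eq_comm]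

theorem value_le {F : GraphClass →* ℝ≥0} {G : FinGraph} {w : G.V → ℝ≥0} {K : ℝ≥0}
    (h : ∀ c : G.V → ℕ, c ≠ 0 → typeValue F G w c ≤ K ^ ∑ v, c v) : value F G w ≤ K := by
  refine ciSup_le' fun ⟨c, hc⟩ => ?_
  have := NNReal.rpow_le_rpow (h c hc) (inv_nonneg.2 (Nat.cast_nonneg (∑ v, c v)))
  rwa [NNReal.pow_rpow_inv_natCast _ (sum_ne_zero_of_ne_zero hc)] at this

theorem IsNormalized.one_le {F : GraphClass →* ℝ≥0} (hF : IsNormalized F)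
    (G : FinGraph) (c : G.V → ℕ) : 1 ≤ F (typeClass G c) := by
  rw [← map_one F]
  exact hF.mono (one_le_typeClass G c)

theorem IsNormalized.le_pow {F : GraphClass →* ℝ≥0} (hF : IsNormalized F)
    (G : FinGraph) (c : G.V → ℕ) :
    F (typeClass G c) ≤ (Fintype.card G.V : ℝ≥0) ^ ∑ v, c v := by
  refine (hF.mono (typeClass_le_card_pow G c)).trans ?_
  rw [hF.map_natCast]
  have := card_words_le (I := Fin (∑ v, c v)) c
  rw [Fintype.card_fin] at this
  exact_mod_cast this

theorem one_le_typeValue {F : GraphClass →* ℝ≥0} (hF : IsNormalized F)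
    {G : FinGraph} {w : G.V → ℝ≥0} (hw : ∀ v, 1 ≤ w v) (c : G.V → ℕ) :
    1 ≤ typeValue F G w c :=
  one_le_mul (hF.one_le G c) (Finset.one_le_prod' fun v _ => one_le_pow₀ (hw v))

theorem typeValue_le_pow {F : GraphClass →* ℝ≥0} (hF : IsNormalized F)
    (G : FinGraph) (w : G.V → ℝ≥0) (c : G.V → ℕ) :
    typeValue F G w c ≤ (Fintype.card G.V * ∑ v, w v) ^ ∑ v, c v := by
  rw [mul_pow]
  refine mul_le_mul' (hF.le_pow G c) ?_
  rw [← Finset.prod_pow_eq_pow_sum]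
  refine Finset.prod_le_prod' fun v _ => ?_
  gcongr
  exact Finset.single_le_sum (f := w) (fun _ _ => zero_le) (Finset.mem_univ v)

theorem typeValue_mul_le {F : GraphClass →* ℝ≥0} (hF : IsNormalized F)
    (G : FinGraph) (w : G.V → ℝ≥0) (c d : G.V → ℕ) :
    typeValue F G w c * typeValue F G w d ≤ typeValue F G w (c + d) := by
  have h := hF.mono (typeClass_mul_le G c d)
  rw [map_mul] at h
  calc typeValue F G w c * typeValue F G w d
      = (F (typeClass G c) * F (typeClass G d)) * ∏ v, w v ^ (c + d) v := by
        simp only [typeValue, Pi.add_apply, pow_add, Finset.prod_mul_distrib]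
        ring
    _ ≤ _ := mul_le_mul_left h _

theorem typeValue_pow_le {F : GraphClass →* ℝ≥0} (hF : IsNormalized F)
    (G : FinGraph) (w : G.V → ℝ≥0) (c : G.V → ℕ) (n : ℕ) :
    typeValue F G w c ^ n ≤ typeValue F G w (n • c) := by
  induction n with
  | zero =>
    rw [pow_zero, zero_smul, typeValue]
    simpa using hF.one_le G 0
  | succ n ih =>
    rw [pow_succ, succ_nsmul]
    exact (mul_le_mul_left ih _).trans (typeValue_mul_le hF G w _ _)

theorem bddAbove_typeValue {F : GraphClass →* ℝ≥0} (hF : IsNormalized F)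
    (G : FinGraph) (w : G.V → ℝ≥0) :
    BddAbove (Set.range fun c : {c : G.V → ℕ // c ≠ 0} =>
      typeValue F G w c.1 ^ (((∑ v, c.1 v : ℕ) : ℝ)⁻¹)) := by
  refine ⟨Fintype.card G.V * ∑ v, w v, ?_⟩
  rintro _ ⟨⟨c, hc⟩, rfl⟩
  have := NNReal.rpow_le_rpow (typeValue_le_pow hF G w c)
    (inv_nonneg.2 (Nat.cast_nonneg (∑ v, c v)))
  rwa [NNReal.pow_rpow_inv_natCast _ (sum_ne_zero_of_ne_zero hc)] at this

theorem typeValue_zero {F : GraphClass →* ℝ≥0} (hF : IsNormalized F)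
    (G : FinGraph) (w : G.V → ℝ≥0) : typeValue F G w 0 = 1 := by
  refine le_antisymm ?_ ?_
  · simpa using typeValue_le_pow hF G w 0
  · rw [typeValue]
    simpa using hF.one_le G 0

theorem typeValue_le_value_pow {F : GraphClass →* ℝ≥0} (hF : IsNormalized F)
    (G : FinGraph) (w : G.V → ℝ≥0) (c : G.V → ℕ) :
    typeValue F G w c ≤ value F G w ^ ∑ v, c v := by
  by_cases hc : c = 0
  · subst hc
    rw [typeValue_zero hF]
    simp
  · have h₁ := le_ciSup (bddAbove_typeValue hF G w) ⟨c, hc⟩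
    have h₂ := pow_le_pow_left' h₁ (∑ v, c v)
    dsimp only at h₂
    rwa [NNReal.rpow_inv_natCast_pow _ (sum_ne_zero_of_ne_zero hc)] at h₂

/-- A single type `c` of some size `m` already beats `K`. Its multiples keep the rate, and `n % m`
further copies of an arbitrary letter reach every length `n`; since the weights are at least `1`,
this padding cannot decrease the value. The constant absorbs the missing factor `K ^ (n % m)`. -/
theorem exists_of_lt_value {F : GraphClass →* ℝ≥0} (hF : IsNormalized F)
    {G : FinGraph} {w : G.V → ℝ≥0} (hw : ∀ v, 1 ≤ w v) {K : ℝ≥0}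
    (hK : K < value F G w) :
    ∃ C : ℝ≥0, ∀ n, ∃ c : G.V → ℕ, ∑ v, c v = n ∧ K ^ n ≤ C * typeValue F G w c := by
  obtain ⟨⟨c, hc⟩, hlt⟩ := exists_lt_of_lt_ciSup' hK
  have hm : ∑ v, c v ≠ 0 := sum_ne_zero_of_ne_zero hc
  set m := ∑ v, c v with hmdef
  have hKm : K ^ m ≤ typeValue F G w c := by
    have := pow_le_pow_left' hlt.le m
    rwa [NNReal.rpow_inv_natCast_pow _ hm] at this
  obtain ⟨v₀⟩ : Nonempty G.V := by
    by_contra h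
    rw [not_nonempty_iff] at h
    exact hc (Subsingleton.elim _ _)
  refine ⟨max 1 K ^ m, fun n => ⟨(n / m) • c + (n % m) • Pi.single v₀ 1, ?_, ?_⟩⟩
  · simp only [Pi.add_apply, Pi.smul_apply, smul_eq_mul, Finset.sum_add_distrib,
      ← Finset.mul_sum, ← hmdef]
    simp [Nat.div_add_mod']
  · have h₁ : typeValue F G w c ^ (n / m) ≤
        typeValue F G w ((n / m) • c + (n % m) • Pi.single v₀ 1) := by
      refine le_trans ?_ (typeValue_mul_le hF G w _ _)
      exact le_mul_of_le_of_one_le (typeValue_pow_le hF G w c _) (one_le_typeValue hF hw _)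
    calc K ^ n = K ^ (n % m) * (K ^ m) ^ (n / m) := by
          rw [← pow_mul, ← pow_add, Nat.mod_add_div]
      _ ≤ max 1 K ^ m * typeValue F G w c ^ (n / m) := by
          refine mul_le_mul' ?_ (pow_le_pow_left' hKm _)
          exact (pow_le_pow_left' (le_max_right 1 K) _).trans
            (pow_le_pow_right₀ (le_max_left 1 K) (Nat.mod_lt n (Nat.pos_of_ne_zero hm)).le)
      _ ≤ _ := mul_le_mul_right h₁ _

/-- The summands must be nonzero: there is no `K < 0` in `ℝ≥0`, so for `x = 0` the hypothesis would
be void. -/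
theorem add_le_of_forall_lt_of_ne_zero {x y z : ℝ≥0} (hx : x ≠ 0) (hy : y ≠ 0)
    (h : ∀ K < x, ∀ K' < y, K + K' ≤ z) : x + y ≤ z := by
  refine NNReal.le_of_forall_lt_one_mul_le fun a ha => ?_
  rw [mul_add]
  exact h _ (mul_lt_of_lt_one_left (pos_iff_ne_zero.2 hx) ha) _
    (mul_lt_of_lt_one_left (pos_iff_ne_zero.2 hy) ha)

theorem nnreal_mul_le_of_forall_lt {x y z : ℝ≥0} (h : ∀ K < x, ∀ K' < y, K * K' ≤ z) :
    x * y ≤ z := by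
  rcases eq_or_ne x 0 with rfl | hx
  · simp
  rcases eq_or_ne y 0 with rfl | hy
  · simp
  refine NNReal.le_of_forall_lt_one_mul_le fun a ha => ?_
  refine NNReal.le_of_forall_lt_one_mul_le fun b hb => ?_
  have := h _ (mul_lt_of_lt_one_left (pos_iff_ne_zero.2 hx) ha) _
    (mul_lt_of_lt_one_left (pos_iff_ne_zero.2 hy) hb)
  calc b * (a * (x * y)) = a * x * (b * y) := by ring
    _ ≤ z := this

/-- Polynomial factors disappear under `n`-th roots. This is how the numbers of types and of
translates drop out of all comparisons of growth rates. -/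
theorem le_of_pow_le_poly_mul_pow {K L C : ℝ≥0} {k : ℕ}
    (h : ∀ n : ℕ, K ^ n ≤ C * ((n : ℝ≥0) + 1) ^ k * L ^ n) : K ≤ L := by
  by_contra! hlt
  by_cases hL : L = 0
  · have := h 1
    rw [hL] at this hlt
    simp at this
    exact hlt.ne' this
  · have hL' : 0 < L := pos_iff_ne_zero.2 hL
    obtain ⟨r, hrdef⟩ : ∃ r : ℝ, r = ((K / L : ℝ≥0) : ℝ) := ⟨_, rfl⟩
    have hr : 1 < r := by
      rw [hrdef, ← NNReal.coe_one, NNReal.coe_lt_coe]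
      exact (one_lt_div hL').2 hlt
    have hb : ∀ n : ℕ, r ^ n ≤ C * ((n : ℝ) + 1) ^ k := by
      intro n
      rw [hrdef]
      have h1 : (K / L) ^ n ≤ C * ((n : ℝ≥0) + 1) ^ k := by
        rw [div_pow, div_le_iff₀ (pow_pos hL' n)]
        exact h n
      exact_mod_cast h1
    -- The extra factor `r` compensates the shift `n ↦ n + 1`: after the shift the expression is `C
    -- (n + 1) ^ k / r ^ n`, which is at least `1` and yet tends to `0`.
    have ht := (tendsto_pow_const_div_const_pow_of_one_lt k hr).const_mul (C * r : ℝ)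
    rw [mul_zero] at ht
    have ht' := ht.comp (tendsto_add_atTop_nat 1)
    have : ∀ n : ℕ, (1 : ℝ) ≤ ((fun n : ℕ => (C * r : ℝ) * ((n : ℝ) ^ k / r ^ n)) ∘
        fun a => a + 1) n := by
      intro n
      have hrn : 0 < r ^ n := pow_pos (by linarith) n
      have hr0 : r ≠ 0 := by linarith
      simp only [Function.comp_apply, Nat.cast_add, Nat.cast_one]
      rw [pow_succ, show (C * r : ℝ) * (((n : ℝ) + 1) ^ k / (r ^ n * r))
        = (C * ((n : ℝ) + 1) ^ k) / r ^ n by field_simp, le_div_iff₀ hrn, one_mul]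
      exact hb n
    have := ge_of_tendsto' ht' this
    linarith

/-! ### Additivity and multiplicativity of the growth rates -/

theorem value_eq_zero {F : GraphClass →* ℝ≥0} {G : FinGraph} [IsEmpty G.V] (w : G.V → ℝ≥0) : value F G w = 0 :=
  le_antisymm (value_le fun _ hc => absurd (Subsingleton.elim _ _) hc) zero_le

theorem value_mono {F : GraphClass →* ℝ≥0} (hF : IsNormalized F)
    {G H : FinGraph} {w : G.V → ℝ≥0} {w' : H.V → ℝ≥0} (φ : G.V → H.V)
    (h : ∀ c, typeValue F G w c ≤ typeValue F H w' (pushCount φ c)) :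
    value F G w ≤ value F H w' :=
  value_le fun c _ => (h c).trans <| by
    simpa [sum_pushCount] using typeValue_le_value_pow hF H w' (pushCount φ c)

theorem value_mono_of_hom {F : GraphClass →* ℝ≥0} (hF : IsNormalized F)
    {G H : FinGraph} {w : G.V → ℝ≥0} {w' : H.V → ℝ≥0} (φ : G.V → H.V)
    (hφ : ∀ x y, H.AdjEq (φ x) (φ y) → G.AdjEq x y) (hw : ∀ x, w x ≤ w' (φ x)) :
    value F G w ≤ value F H w' := by
  refine value_mono hF φ fun c => ?_
  rw [typeValue, typeValue, prod_pow_pushCount]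
  exact mul_le_mul' (hF.mono (typeClass_map φ hφ c))
    (Finset.prod_le_prod' fun v _ => pow_le_pow_left' (hw v) _)

theorem typeValue_disjUnion {F : GraphClass →* ℝ≥0} (hF : IsNormalized F)
    (G H : FinGraph) (w : G.V → ℝ≥0) (w' : H.V → ℝ≥0) (c : G.V → ℕ)
    (d : H.V → ℕ) :
    typeValue F (G.disjUnion H) (Sum.elim w w') (Sum.elim c d) =
      ((∑ v, c v) + ∑ v, d v).choose (∑ v, c v) * (typeValue F G w c * typeValue F H w' d) := by
  have h := typeClass_disjUnion G H c d
  have h₁ := le_antisymm (hF.mono h.1) (hF.mono h.2)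
  rw [map_mul, map_mul, hF.map_natCast] at h₁
  rw [typeValue, h₁, typeValue, typeValue]
  simp only [Fintype.prod_sum_type, Sum.elim_inl, Sum.elim_inr]
  ring

/-- The value at `(c, d)` is a binomial coefficient times two values, that is, bounded by one term
in the binomial expansion of the `N`-th power of the right side. Conversely, each of the `N + 1`
terms of that expansion is nearly attained by some type of the union. -/
theorem value_disjUnion {F : GraphClass →* ℝ≥0} (hF : IsNormalized F)
    {G H : FinGraph} {w : G.V → ℝ≥0} {w' : H.V → ℝ≥0} (hw : ∀ v, 1 ≤ w v)
    (hw' : ∀ v, 1 ≤ w' v) :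
    value F (G.disjUnion H) (Sum.elim w w') = value F G w + value F H w' := by
  have hl : value F G w ≤ value F (G.disjUnion H) (Sum.elim w w') :=
    value_mono_of_hom hF Sum.inl (fun x y h => by simpa [disjUnion_adjEq] using h)
      fun x => le_rfl
  have hr : value F H w' ≤ value F (G.disjUnion H) (Sum.elim w w') :=
    value_mono_of_hom hF Sum.inr (fun x y h => by simpa [disjUnion_adjEq] using h)
      fun x => le_rfl
  refine le_antisymm (value_le fun e _ => ?_) ?_
  · obtain ⟨c, d, rfl⟩ : ∃ c d, e = Sum.elim c d := ⟨e ∘ Sum.inl, e ∘ Sum.inr, by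
      ext (v | v) <;> rfl⟩
    rw [typeValue_disjUnion hF]
    have hsum : ∑ v : (G.disjUnion H).V, Sum.elim c d v = (∑ v, c v) + ∑ v, d v :=
      Fintype.sum_sum_type _
    rw [hsum]
    set n := ∑ v, c v
    set m := ∑ v, d v
    rw [add_pow (value F G w)]
    refine le_trans ?_ (Finset.single_le_sum (f := fun k => value F G w ^ k *
      value F H w' ^ (n + m - k) * ((n + m).choose k : ℝ≥0)) (fun _ _ => zero_le)
      (Finset.mem_range.2 (by omega : n < n + m + 1)))
    rw [Nat.add_sub_cancel_left, mul_comm]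
    exact mul_le_mul_left (mul_le_mul' (typeValue_le_value_pow hF G w c)
      (typeValue_le_value_pow hF H w' d)) _
  -- Approximation from below by `K` and `K'` needs both rates to be positive; if one is zero,
  -- monotonicity under inclusion suffices.
  · rcases eq_or_ne (value F G w) 0 with h0 | h0
    · rwa [h0, zero_add]
    rcases eq_or_ne (value F H w') 0 with h0' | h0'
    · rwa [h0', add_zero]
    refine add_le_of_forall_lt_of_ne_zero h0 h0' fun K hK K' hK' => ?_
    obtain ⟨C, hC⟩ := exists_of_lt_value hF hw hK
    obtain ⟨C', hC'⟩ := exists_of_lt_value hF hw' hK'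
    refine le_of_pow_le_poly_mul_pow (C := C * C') (k := 1) fun N => ?_
    rw [add_pow, pow_one]
    calc _ ≤ ∑ _k ∈ Finset.range (N + 1), C * C' *
          value F (G.disjUnion H) (Sum.elim w w') ^ N := by
          refine Finset.sum_le_sum fun k hk => ?_
          have hkN : k ≤ N := Nat.lt_succ_iff.1 (Finset.mem_range.1 hk)
          obtain ⟨c, hc, hcK⟩ := hC k
          obtain ⟨d, hd, hdK⟩ := hC' (N - k)
          have h₁ := typeValue_disjUnion hF G H w w' c d
          rw [hc, hd, Nat.add_sub_cancel' hkN] at h₁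
          have h₂ := typeValue_le_value_pow hF (G.disjUnion H) (Sum.elim w w') (Sum.elim c d)
          have hsum : ∑ v : (G.disjUnion H).V, Sum.elim c d v = (∑ v, c v) + ∑ v, d v :=
            Fintype.sum_sum_type _
          rw [hsum, hc, hd, Nat.add_sub_cancel' hkN] at h₂
          calc K ^ k * K' ^ (N - k) * (N.choose k : ℝ≥0)
              ≤ (C * typeValue F G w c) * (C' * typeValue F H w' d) * N.choose k := by gcongr
            _ = C * C' * typeValue F (G.disjUnion H) (Sum.elim w w') (Sum.elim c d) := by
              rw [h₁]; ring
            _ ≤ _ := by gcongr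
      _ = _ := by
          rw [Finset.sum_const, Finset.card_range, nsmul_eq_mul]
          push_cast
          ring

/-- A joint type is bounded by the product of its marginals, which gives `≤`. For `≥`, nearly
optimal types of equal length are coupled by `exists_jointType`. The product weights depend on a
joint type only through its marginals, so they play no role in the choice of the coupling. -/
theorem value_strongProd {F : GraphClass →* ℝ≥0} (hF : IsNormalized F)
    {G H : FinGraph} {w : G.V → ℝ≥0} {w' : H.V → ℝ≥0} (hw : ∀ v, 1 ≤ w v)
    (hw' : ∀ v, 1 ≤ w' v) :
    value F (G.strongProd H) (fun v => w v.1 * w' v.2) = value F G w * value F H w' := by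
  have hprod : ∀ e : G.V × H.V → ℕ, ∏ v : (G.strongProd H).V, (w v.1 * w' v.2) ^ e v =
      (∏ v, w v ^ pushCount Prod.fst e v) * ∏ v, w' v ^ pushCount Prod.snd e v := fun e => by
    rw [prod_pow_pushCount, prod_pow_pushCount, ← Finset.prod_mul_distrib]
    simp only [mul_pow]
  refine le_antisymm (value_le fun e _ => ?_) ?_
  · have h := hF.mono (typeClass_strongProd_le G H e)
    rw [map_mul] at h
    have h₁ := typeValue_le_value_pow hF G w (pushCount Prod.fst e)
    have h₂ := typeValue_le_value_pow hF H w' (pushCount Prod.snd e)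
    rw [sum_pushCount] at h₁ h₂
    rw [typeValue, hprod, mul_pow]
    calc _ ≤ (F (typeClass G (pushCount Prod.fst e)) * F (typeClass H (pushCount Prod.snd e))) *
          ((∏ v, w v ^ pushCount Prod.fst e v) * ∏ v, w' v ^ pushCount Prod.snd e v) := by gcongr
      _ = typeValue F G w (pushCount Prod.fst e) * typeValue F H w' (pushCount Prod.snd e) := by
          rw [typeValue, typeValue]; ring
      _ ≤ _ := mul_le_mul' h₁ h₂
  · refine nnreal_mul_le_of_forall_lt fun K hK K' hK' => ?_
    obtain ⟨C, hC⟩ := exists_of_lt_value hF hw hK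
    obtain ⟨C', hC'⟩ := exists_of_lt_value hF hw' hK'
    set A := Fintype.card (G.V × H.V)
    set B := Fintype.card G.V * Fintype.card H.V
    refine le_of_pow_le_poly_mul_pow (C := C * C' * (B + 1)) (k := A + 1) fun n => ?_
    obtain ⟨c, hc, hcK⟩ := hC n
    obtain ⟨d, hd, hdK⟩ := hC' n
    obtain ⟨e, rfl, rfl, he⟩ := exists_jointType G H c d hc hd
    have he' := hF.mono he
    rw [map_mul, map_mul, hF.map_natCast] at he'
    have h₂ := typeValue_le_value_pow hF (G.strongProd H) (fun v => w v.1 * w' v.2) e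
    rw [sum_pushCount] at hc
    have hc' : ∑ v : (G.strongProd H).V, e v = n := hc
    rw [hc'] at h₂
    have hpoly : (((n + 1) ^ A * (B * n + 1) : ℕ) : ℝ≥0) ≤ (B + 1) * ((n : ℝ≥0) + 1) ^ (A + 1) := by
      have : (n + 1) ^ A * (B * n + 1) ≤ (B + 1) * (n + 1) ^ (A + 1) := by
        rw [pow_succ]
        have : B * n + 1 ≤ (B + 1) * (n + 1) := by nlinarith
        calc _ ≤ (n + 1) ^ A * ((B + 1) * (n + 1)) := Nat.mul_le_mul_left _ this
          _ = _ := by ring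
      exact_mod_cast this
    calc (K * K') ^ n = K ^ n * K' ^ n := mul_pow _ _ _
      _ ≤ (C * typeValue F G w (pushCount Prod.fst e)) *
          (C' * typeValue F H w' (pushCount Prod.snd e)) := mul_le_mul' hcK hdK
      _ = C * C' * (F (typeClass G (pushCount Prod.fst e)) *
          F (typeClass H (pushCount Prod.snd e))) *
          ((∏ v, w v ^ pushCount Prod.fst e v) * ∏ v, w' v ^ pushCount Prod.snd e v) := by
          rw [typeValue, typeValue]; ring
      _ ≤ C * C' * ((((n + 1) ^ A * (B * n + 1) : ℕ) : ℝ≥0) * F (typeClass (G.strongProd H) e)) *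
          ((∏ v, w v ^ pushCount Prod.fst e v) * ∏ v, w' v ^ pushCount Prod.snd e v) := by gcongr
      _ = C * C' * (((n + 1) ^ A * (B * n + 1) : ℕ) : ℝ≥0) *
          typeValue F (G.strongProd H) (fun v => w v.1 * w' v.2) e := by
          rw [typeValue, hprod]; ring
      _ ≤ C * C' * ((B + 1) * ((n : ℝ≥0) + 1) ^ (A + 1)) *
          value F (G.strongProd H) (fun v => w v.1 * w' v.2) ^ n := by gcongr
      _ = _ := by ring

theorem value_point {F : GraphClass →* ℝ≥0} (hF : IsNormalized F)
    (w : ℝ≥0) : value F FinGraph.point (fun _ => w) = w := by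
  have h : ∀ c : FinGraph.point.V → ℕ,
      typeValue F FinGraph.point (fun _ => w) c = w ^ ∑ v, c v := fun c => by
    have h₁ : F (typeClass FinGraph.point c) = 1 :=
      le_antisymm (by simpa using hF.le_pow FinGraph.point c) (hF.one_le _ _)
    rw [typeValue, h₁, one_mul, Finset.prod_pow_eq_pow_sum]
  refine le_antisymm (value_le fun c _ => (h c).le) ?_
  have := typeValue_le_value_pow hF FinGraph.point (fun _ => w) fun _ => 1
  rw [h] at this
  simpa using this

/-! ## Probabilistic refinements -/

/-- The frequencies of a vector of multiplicities. -/
noncomputable def freq {V : Type} [Fintype V] (c : V → ℕ) (v : V) : ℝ := c v / (∑ u, c u : ℕ)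

/-- Large vectors of multiplicities with frequencies close to `Q`. -/
noncomputable def typeFilter {V : Type} [Fintype V] (Q : V → ℝ) : Filter (V → ℕ) :=
  comap (fun c => ∑ v, c v) atTop ⊓ comap freq (𝓝 Q)

/-- The values on the type graphs with frequencies close to `Q` grow at the rate `L`. -/
def HasLogRate (F : GraphClass →* ℝ≥0) (G : FinGraph) (Q : G.V → ℝ) (L : ℝ) : Prop :=
  Tendsto (fun c => Real.log (F (typeClass G c)) / (∑ v, c v : ℕ)) (typeFilter Q) (𝓝 L)

theorem tendsto_typeFilter {V : Type} [Fintype V] {Q : V → ℝ} {c : ℕ → V → ℕ}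
    (hc : ∀ n, ∑ v, c n v = n)
    (hQ : ∀ v, Tendsto (fun n : ℕ => (c n v : ℝ) / n) atTop (𝓝 (Q v))) :
    Tendsto c atTop (typeFilter Q) := by
  refine tendsto_inf.2 ⟨tendsto_comap_iff.2 ?_, tendsto_comap_iff.2 (tendsto_pi_nhds.2 fun v => ?_)⟩
  · simp only [Function.comp_def, hc]
    exact tendsto_id
  · simpa only [Function.comp_def, freq, hc] using hQ v

/-- Round `n Q` down and give the missing letters to one vertex; the rounding error is `o(n)`. -/
theorem exists_typeSequence {V : Type} [Fintype V] [DecidableEq V] {Q : V → ℝ}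
    (hQ : Q ∈ stdSimplex ℝ V) : ∃ c : ℕ → V → ℕ, (∀ n, ∑ v, c n v = n) ∧
      ∀ v, Tendsto (fun n : ℕ => (c n v : ℝ) / n) atTop (𝓝 (Q v)) := by
  obtain ⟨v₀⟩ : Nonempty V := by
    by_contra h
    rw [not_nonempty_iff] at h
    have := hQ.2
    simp at this
  have hle : ∀ n : ℕ, ∑ v, ⌊Q v * n⌋₊ ≤ n := fun n => by
    have h₁ : ((∑ v, ⌊Q v * n⌋₊ : ℕ) : ℝ) ≤ n := by
      push_cast
      calc ∑ v, (⌊Q v * n⌋₊ : ℝ) ≤ ∑ v, Q v * n :=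
            Finset.sum_le_sum fun v _ => Nat.floor_le (mul_nonneg (hQ.1 v) (Nat.cast_nonneg n))
        _ = n := by rw [← Finset.sum_mul, hQ.2, one_mul]
    exact_mod_cast h₁
  have hfl : ∀ v, Tendsto (fun n : ℕ => (⌊Q v * n⌋₊ : ℝ) / n) atTop (𝓝 (Q v)) := fun v =>
    (tendsto_nat_floor_mul_div_atTop (R := ℝ) (hQ.1 v)).comp tendsto_natCast_atTop_atTop
  refine ⟨fun n v => ⌊Q v * n⌋₊ + if v = v₀ then n - ∑ u, ⌊Q u * n⌋₊ else 0, fun n => ?_,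
    fun v => ?_⟩
  · rw [Finset.sum_add_distrib]
    have := hle n
    simp
    omega
  · have hrest : Tendsto (fun n : ℕ => ((n - ∑ u, ⌊Q u * n⌋₊ : ℕ) : ℝ) / n) atTop (𝓝 0) := by
      have h₁ : Tendsto (fun n : ℕ => (1 : ℝ) - ∑ u, (⌊Q u * n⌋₊ : ℝ) / n) atTop (𝓝 0) := by
        have := (tendsto_finsetSum Finset.univ fun u _ => hfl u).const_sub 1
        rwa [hQ.2, sub_self] at this
      refine h₁.congr' ?_
      filter_upwards [eventually_gt_atTop 0] with n hn
      have hn' : (n : ℝ) ≠ 0 := by exact_mod_cast hn.ne'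
      rw [Nat.cast_sub (hle n), ← Finset.sum_div, sub_div, div_self hn']
      push_cast
      rfl
    by_cases hv : v = v₀
    · subst hv
      have := (hfl v).add hrest
      rw [add_zero] at this
      refine this.congr fun n => ?_
      simp [add_div]
    · simpa [hv] using hfl v

theorem typeFilter_neBot {V : Type} [Fintype V] [DecidableEq V] {Q : V → ℝ}
    (hQ : Q ∈ stdSimplex ℝ V) : (typeFilter Q).NeBot := by
  obtain ⟨c, hc, hcQ⟩ := exists_typeSequence hQ
  exact (tendsto_typeFilter hc hcQ).neBot

/-- With `p = k / N`, the `k`-th term of `(p + (1 - p)) ^ N = 1` is at most `1`, and `p ^ k (1 - p)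
^ (N - k)` is the exponential of minus `N` times the binary entropy of `p`. -/
theorem choose_le_exp_binEntropy {N k : ℕ} (hk : k ≤ N) (hN : 0 < N) :
    (N.choose k : ℝ) ≤ Real.exp (N * Real.binEntropy (k / N)) := by
  have hN' : (0 : ℝ) < N := by exact_mod_cast hN
  rcases Nat.eq_zero_or_pos k with rfl | hk0
  · simp
  rcases hk.eq_or_lt with rfl | hlt
  · simp [hN'.ne']
  set p : ℝ := k / N with hp
  have hk0' : (0 : ℝ) < k := by exact_mod_cast hk0
  have hlt' : (k : ℝ) < N := by exact_mod_cast hlt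
  have hp0 : 0 < p := by positivity
  have hp1 : 0 < 1 - p := by
    have : p < 1 := by rw [hp, div_lt_one hN']; exact hlt'
    linarith
  have h₁ : p ^ k * (1 - p) ^ (N - k) * N.choose k ≤ 1 := by
    have h := add_pow p (1 - p) N
    rw [add_sub_cancel, one_pow] at h
    refine le_of_le_of_eq ?_ h.symm
    exact Finset.single_le_sum (f := fun k => p ^ k * (1 - p) ^ (N - k) * (N.choose k : ℝ))
      (fun i _ => by positivity) (Finset.mem_range.2 (Nat.lt_succ_of_le hk))
  have h₂ : p ^ k * (1 - p) ^ (N - k) = Real.exp (-(N * Real.binEntropy p)) := by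
    have e₁ : p ^ k = Real.exp (k * Real.log p) := by
      rw [Real.exp_nat_mul, Real.exp_log hp0]
    have e₂ : (1 - p) ^ (N - k) = Real.exp ((N - k : ℕ) * Real.log (1 - p)) := by
      rw [Real.exp_nat_mul, Real.exp_log hp1]
    rw [e₁, e₂, ← Real.exp_add, Nat.cast_sub hk, Real.binEntropy_eq_negMulLog_add_negMulLog_one_sub,
      Real.negMulLog, Real.negMulLog]
    congr 1
    have : (k : ℝ) = N * p := by rw [hp]; field_simp
    rw [this]
    ring
  rw [h₂, Real.exp_neg, inv_mul_eq_div, div_le_one (Real.exp_pos _)] at h₁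
  exact h₁

/-! ### Continuity of the rates in the type and existence of the limit -/

theorem log_nonneg_typeClass {F : GraphClass →* ℝ≥0} (hF : IsNormalized F)
    (G : FinGraph) (c : G.V → ℕ) : 0 ≤ Real.log (F (typeClass G c)) :=
  Real.log_nonneg (by exact_mod_cast hF.one_le G c)

theorem pos_typeClass {F : GraphClass →* ℝ≥0} (hF : IsNormalized F)
    (G : FinGraph) (c : G.V → ℕ) : (0 : ℝ) < F (typeClass G c) :=
  lt_of_lt_of_le one_pos (by exact_mod_cast hF.one_le G c)

theorem log_typeClass_le {F : GraphClass →* ℝ≥0} (hF : IsNormalized F)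
    (G : FinGraph) (c : G.V → ℕ) :
    Real.log (F (typeClass G c)) ≤ (∑ v, c v : ℕ) * Real.log (Fintype.card G.V) := by
  rw [← Real.log_pow]
  exact Real.log_le_log (pos_typeClass hF G c) (by exact_mod_cast hF.le_pow G c)

theorem log_typeClass_add {F : GraphClass →* ℝ≥0} (hF : IsNormalized F)
    (G : FinGraph) (c d : G.V → ℕ) :
    Real.log (F (typeClass G c)) + Real.log (F (typeClass G d)) ≤
      Real.log (F (typeClass G (c + d))) := by
  rw [← Real.log_mul (pos_typeClass hF G c).ne' (pos_typeClass hF G d).ne']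
  refine Real.log_le_log (mul_pos (pos_typeClass hF G c) (pos_typeClass hF G d)) ?_
  have h := hF.mono (typeClass_mul_le G c d)
  rw [map_mul] at h
  exact_mod_cast h

theorem log_typeClass_nsmul {F : GraphClass →* ℝ≥0} (hF : IsNormalized F)
    (G : FinGraph) (c : G.V → ℕ) (k : ℕ) :
    k * Real.log (F (typeClass G c)) ≤ Real.log (F (typeClass G (k • c))) := by
  induction k with
  | zero => simpa using log_nonneg_typeClass hF G _
  | succ k ih =>
    have := log_typeClass_add hF G (k • c) c
    rw [succ_nsmul]
    push_cast
    linarith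

/-- Adding `d` costs at most the trivial bound on its type graph and a binomial coefficient. Per
letter, the loss is a continuous function of the fraction of letters in `d` which vanishes at `0`.
-/
theorem log_typeClass_add_le {F : GraphClass →* ℝ≥0} (hF : IsNormalized F)
    (G : FinGraph) (c d : G.V → ℕ) (h : 0 < ∑ v, (c + d) v) :
    Real.log (F (typeClass G (c + d))) ≤ Real.log (F (typeClass G c)) +
      (∑ v, (c + d) v : ℕ) * ((∑ v, d v : ℕ) / (∑ v, (c + d) v : ℕ) *
        Real.log (Fintype.card G.V) +
        Real.binEntropy ((∑ v, d v : ℕ) / (∑ v, (c + d) v : ℕ))) := by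
  have h₁ := hF.mono (typeClass_add_le G d c)
  rw [map_mul, map_mul, hF.map_natCast, add_comm d c] at h₁
  have hsum : ∑ v, (c + d) v = (∑ v, d v) + ∑ v, c v := by
    simp [Finset.sum_add_distrib, add_comm]
  rw [← hsum] at h₁
  set N := ∑ v, (c + d) v
  set k := ∑ v, d v
  have hkN : k ≤ N := by omega
  have h₂ : (F (typeClass G (c + d)) : ℝ) ≤ Real.exp (N * Real.binEntropy (k / N)) *
      (F (typeClass G d) * F (typeClass G c)) := by
    refine le_trans (by exact_mod_cast h₁) (mul_le_mul_of_nonneg_right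
      (choose_le_exp_binEntropy hkN h) (by positivity))
  have h₃ := Real.log_le_log (pos_typeClass hF G _) h₂
  have hd := pos_typeClass hF G d
  have hc := pos_typeClass hF G c
  rw [Real.log_mul (Real.exp_pos _).ne' (mul_pos hd hc).ne', Real.log_mul hd.ne' hc.ne',
    Real.log_exp] at h₃
  have h₄ := log_typeClass_le hF G d
  have hN : (N : ℝ) ≠ 0 := by exact_mod_cast h.ne'
  have : (N : ℝ) * (k / N * Real.log (Fintype.card G.V) + Real.binEntropy (k / N))
      = k * Real.log (Fintype.card G.V) + N * Real.binEntropy (k / N) := by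
    field_simp
  rw [this]
  linarith

theorem log_typeClass_mono {F : GraphClass →* ℝ≥0} (hF : IsNormalized F)
    (G : FinGraph) {c d : G.V → ℕ} (h : c ≤ d) :
    Real.log (F (typeClass G c)) ≤ Real.log (F (typeClass G d)) := by
  have h₁ := log_typeClass_add hF G c (d - c)
  rw [add_tsub_cancel_of_le h] at h₁
  have := log_nonneg_typeClass hF G (d - c)
  linarith

/-- The growth rate at a large type is not much smaller than at a small type with similar
frequencies. -/
theorem rate_le_rate_add {F : GraphClass →* ℝ≥0} (hF : IsNormalized F)
    (G : FinGraph) {ε : ℝ} (hε : 0 < ε) : ∃ δ > 0, ∀ c d : G.V → ℕ, 0 < ∑ v, c v →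
    ∑ v, c v ≤ ∑ v, d v → ∑ v, |freq c v - freq d v| ≤ δ →
    Real.log (F (typeClass G c)) / (∑ v, c v : ℕ) ≤
      Real.log (F (typeClass G d)) / (∑ v, d v : ℕ) + ε +
        (∑ v, c v : ℕ) / (∑ v, d v : ℕ) * Real.log (Fintype.card G.V) := by
  have hcont : Continuous fun x : ℝ => x * Real.log (Fintype.card G.V) + Real.binEntropy x :=
    (continuous_id.mul continuous_const).add Real.binEntropy_continuous
  obtain ⟨δ, hδ, hη⟩ := Metric.continuousAt_iff.1 (hcont.continuousAt (x := 0)) ε hε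
  refine ⟨δ / 2, half_pos hδ, fun c d hm hmn hfreq => ?_⟩
  set m := ∑ v, c v with hmdef
  set n := ∑ v, d v with hndef
  have hm' : (0 : ℝ) < m := by exact_mod_cast hm
  have hn' : (0 : ℝ) < n := by exact_mod_cast hm.trans_le hmn
  -- As many copies of `c` as fit into the length of `d`. The type `k • c` is then compared with
  -- `d`.
  set k := n / m with hk
  have hk0 : 0 < k := Nat.div_pos hmn hm
  have hkm : k * m ≤ n := Nat.div_mul_le_self n m
  have hkm' : (k : ℝ) * m ≤ n := by exact_mod_cast hkm
  have hkm1 : (n : ℝ) < (k + 1) * m := by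
    have : n < (k + 1) * m := by
      rw [hk, add_mul, one_mul]
      have := Nat.div_add_mod' n m
      have := Nat.mod_lt n hm
      omega
    exact_mod_cast this
  have hk0' : (0 : ℝ) < k := by exact_mod_cast hk0
  -- Truncated subtraction: `e` is the excess of `k • c` over `d`, and what remains after its
  -- removal is the infimum, which lies below `d`.
  set e := k • c - d with he
  have hsplit : (k • c) ⊓ d + e = k • c := by
    ext v
    simp only [he, Pi.add_apply, Pi.inf_apply, Pi.sub_apply]
    have : min ((k • c) v) (d v) + ((k • c) v - d v) = (k • c) v := by omega
    exact this
  have hsum : ∑ v, (k • c) v = k * m := by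
    simp [hmdef, Finset.mul_sum]
  have h₁ := log_typeClass_add_le hF G ((k • c) ⊓ d) e (by
    rw [hsplit, hsum]; exact Nat.mul_pos hk0 hm)
  rw [hsplit, hsum] at h₁
  have h₂ := log_typeClass_mono hF G (inf_le_right : (k • c) ⊓ d ≤ d)
  have h₃ := log_typeClass_nsmul hF G c k
  have h₄ := log_typeClass_le hF G c
  have hC : 0 ≤ Real.log (Fintype.card G.V) := Real.log_natCast_nonneg _
  rw [← hmdef] at h₄
  -- Since `k m ≤ n`, a positive excess at `v` is at most `k m (freq c v - freq d v)`, so closeness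
  -- of the frequencies bounds the fraction of removed letters.
  have hesum : ((∑ v, e v : ℕ) : ℝ) / (k * m : ℕ) ≤ δ / 2 := by
    refine le_trans ?_ hfreq
    push_cast
    rw [div_le_iff₀ (mul_pos hk0' hm'), Finset.sum_mul]
    refine Finset.sum_le_sum fun v _ => ?_
    have hcv : (c v : ℝ) = freq c v * m := by
      rw [freq, ← hmdef]; field_simp
    have hdv : (d v : ℝ) = freq d v * n := by
      rw [freq, ← hndef]; field_simp
    have hfd : 0 ≤ freq d v := by rw [freq]; positivity
    have habs := le_abs_self (freq c v - freq d v)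
    have hab0 := abs_nonneg (freq c v - freq d v)
    rcases le_total (k * c v) (d v) with hle | hle
    · have : e v = 0 := by simp [he, hle]
      rw [this]
      simp only [Nat.cast_zero]
      positivity
    · have : (e v : ℝ) = k * c v - d v := by
        simp only [he, Pi.sub_apply, Pi.smul_apply, smul_eq_mul]
        rw [Nat.cast_sub hle]
        push_cast
        rfl
      rw [this, hcv, hdv]
      nlinarith [mul_le_mul_of_nonneg_left hkm' hfd,
        mul_le_mul_of_nonneg_right habs (mul_pos hk0' hm').le]
  have hesum0 : 0 ≤ ((∑ v, e v : ℕ) : ℝ) / (k * m : ℕ) := by positivity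
  have hη' := hη (x := ((∑ v, e v : ℕ) : ℝ) / (k * m : ℕ)) (by
    rw [Real.dist_eq, sub_zero, abs_of_nonneg hesum0]
    linarith)
  rw [Real.dist_eq, zero_mul, Real.binEntropy_zero, add_zero, sub_zero] at hη'
  have hη'' := (le_abs_self _).trans hη'.le
  set η := ((∑ v, e v : ℕ) : ℝ) / (k * m : ℕ) * Real.log (Fintype.card G.V) +
    Real.binEntropy (((∑ v, e v : ℕ) : ℝ) / (k * m : ℕ))
  set a := Real.log (F (typeClass G c))
  set b := Real.log (F (typeClass G d))
  set C := Real.log (Fintype.card G.V)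
  have ha : 0 ≤ a := log_nonneg_typeClass hF G c
  push_cast at h₁
  have h₅ : k * a ≤ b + n * ε := by
    have : (k : ℝ) * m * η ≤ n * ε := by
      calc (k : ℝ) * m * η ≤ k * m * ε := by gcongr
        _ ≤ n * ε := by gcongr
    linarith
  have h₆ : n * (a / m) ≤ b + n * ε + m * C := by
    -- The rounding in `k = n / m` loses at most one copy of `c`, whose log value is at most `m *
    -- C`; this is the last term of the claim.
    have : n * (a / m) ≤ (k + 1) * m * (a / m) := by gcongr
    have e₁ : ((k : ℝ) + 1) * m * (a / m) = k * a + a := by field_simp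
    linarith
  have e₂ : b / n + ε + m / n * C = (b + n * ε + m * C) / n := by field_simp
  rw [e₂, le_div_iff₀ hn']
  linarith

/-- A Fekete argument along `typeFilter Q`: one type `c` close to `Q` whose rate nearly attains the
limsup forces, by `rate_le_rate_add`, every sufficiently large type close to `Q` to have nearly that
rate as well. -/
theorem exists_hasLogRate {F : GraphClass →* ℝ≥0} (hF : IsNormalized F)
    (G : FinGraph) {Q : G.V → ℝ} (hQ : Q ∈ stdSimplex ℝ G.V) : ∃ L, HasLogRate F G Q L := by
  have hne := typeFilter_neBot hQ
  set C := Real.log (Fintype.card G.V)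
  have hC : 0 ≤ C := Real.log_natCast_nonneg _
  set x : (G.V → ℕ) → ℝ := fun c => Real.log (F (typeClass G c)) / (∑ v, c v : ℕ) with hx
  have hx0 : ∀ c, 0 ≤ x c := fun c => div_nonneg (log_nonneg_typeClass hF G c) (Nat.cast_nonneg _)
  have hxC : ∀ c, x c ≤ C := fun c =>
    div_le_of_le_mul₀ (Nat.cast_nonneg _) hC ((log_typeClass_le hF G c).trans_eq (mul_comm _ _))
  have hbdd : IsBoundedUnder (· ≤ ·) (typeFilter Q) x := isBoundedUnder_of ⟨C, hxC⟩
  have hcob : IsCoboundedUnder (· ≤ ·) (typeFilter Q) x :=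
    (isBoundedUnder_of ⟨0, hx0⟩ : IsBoundedUnder (· ≥ ·) (typeFilter Q) x).isCoboundedUnder_le
  refine ⟨limsup x (typeFilter Q), ?_⟩
  set L := limsup x (typeFilter Q)
  have hsize : Tendsto (fun c : G.V → ℕ => ∑ v, c v) (typeFilter Q) atTop :=
    tendsto_comap.mono_left inf_le_left
  have hfreq : Tendsto (freq : (G.V → ℕ) → _) (typeFilter Q) (𝓝 Q) :=
    tendsto_comap.mono_left inf_le_right
  have hdist : Tendsto (fun c : G.V → ℕ => ∑ v, |freq c v - Q v|) (typeFilter Q) (𝓝 0) := by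
    have := tendsto_finsetSum Finset.univ fun v _ =>
      (((tendsto_pi_nhds.1 hfreq v).sub_const (Q v)).abs)
    simpa using this
  change Tendsto x (typeFilter Q) (𝓝 L)
  refine tendsto_order.2 ⟨fun y hy => ?_, fun y hy => eventually_lt_of_limsup_lt hy hbdd⟩
  -- Three losses of `ε` occur: for the choice of `c`, for the change of frequencies, and for the
  -- rounding term.
  set ε := (L - y) / 4 with hεdef
  have hε : 0 < ε := by rw [hεdef]; linarith
  obtain ⟨δ, hδ, h⟩ := rate_le_rate_add hF G hε
  have hclose : ∀ᶠ c in typeFilter Q, ∑ v, |freq c v - Q v| < δ / 2 :=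
    hdist.eventually (gt_mem_nhds (half_pos hδ))
  have hfr : ∃ᶠ c in typeFilter Q, L - ε < x c :=
    frequently_lt_of_lt_limsup hcob (by linarith)
  obtain ⟨c, hc, hcδ, hc0⟩ := (hfr.and_eventually
    (hclose.and (hsize.eventually (eventually_gt_atTop 0)))).exists
  have hlast : Tendsto (fun d : G.V → ℕ => ((∑ v, c v : ℕ) : ℝ) / (∑ v, d v : ℕ) * C)
      (typeFilter Q) (𝓝 0) := by
    have := ((tendsto_natCast_atTop_atTop (R := ℝ)).comp hsize).const_div_atTop
      ((∑ v, c v : ℕ) : ℝ)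
    simpa using this.mul_const C
  filter_upwards [hclose, hsize.eventually (eventually_ge_atTop (∑ v, c v)),
    hlast.eventually (gt_mem_nhds hε)] with d hdδ hdc hdε
  have hdist' : ∑ v, |freq c v - freq d v| ≤ δ := by
    calc ∑ v, |freq c v - freq d v| ≤ ∑ v, (|freq c v - Q v| + |freq d v - Q v|) :=
          Finset.sum_le_sum fun v _ => by
            rw [abs_sub_comm (freq d v)]
            exact abs_sub_le _ _ _
      _ ≤ δ := by
          rw [Finset.sum_add_distrib]
          linarith
  have := h c d hc0 hdc hdist'
  have hc' : L - ε < Real.log (F (typeClass G c)) / (∑ v, c v : ℕ) := hc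
  change y < Real.log (F (typeClass G d)) / (∑ v, d v : ℕ)
  linarith

theorem isRefinementValue_of_hasLogRate {f : GraphClass →+* ℝ≥0}
    (hf : f ∈ asymptoticSpectrum GraphClass) {G : FinGraph} {Q : G.V → ℝ} {L : ℝ}
    (h : HasLogRate (f : GraphClass →* ℝ≥0) G Q L) : IsRefinementValue f G Q (Real.exp L) := by
  intro c hc hcQ
  have h₁ := (Real.continuous_exp.tendsto L).comp (h.comp (tendsto_typeFilter hc hcQ))
  refine h₁.congr fun n => ?_
  have hpos := pos_typeClass (isNormalized_of_mem hf) G (c n)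
  have e : typeClass G (c n) = (typeGraph G n (c n)).toClass := by
    rw [toClass_typeGraph]
    exact (toClass_wordGraph (by simp [hc])).symm
  rw [← e]
  change (0 : ℝ) < f (typeClass G (c n)) at hpos
  rw [Real.rpow_def_of_pos hpos]
  simp only [Function.comp_apply, hc]
  congr 1
  rw [mul_one_div]
  rfl

/-- The value picked by `Classical.epsilon` is pinned down because at least one sequence of types
converges to `Q`, and limits along it are unique. -/
theorem probRefinement_eq_exp {f : GraphClass →+* ℝ≥0}
    (hf : f ∈ asymptoticSpectrum GraphClass) {G : FinGraph} {Q : G.V → ℝ}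
    (hQ : Q ∈ stdSimplex ℝ G.V) {L : ℝ}
    (h : HasLogRate (f : GraphClass →* ℝ≥0) G Q L) : probRefinement f G Q = Real.exp L := by
  have h₁ := isRefinementValue_of_hasLogRate hf h
  have h₂ : IsRefinementValue f G Q (probRefinement f G Q) := Classical.epsilon_spec ⟨_, h₁⟩
  obtain ⟨c, hc, hcQ⟩ := exists_typeSequence hQ
  exact tendsto_nhds_unique (h₂ c hc hcQ) (h₁ c hc hcQ)

/-! ### Growth rates of geometric means and of the values -/

theorem HasLogRate.geomMean {F F' : GraphClass →* ℝ≥0} (hF : IsNormalized F)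
    (hF' : IsNormalized F') {a b : ℝ} {G : FinGraph} {Q : G.V → ℝ} {L L' : ℝ}
    (h : HasLogRate F G Q L) (h' : HasLogRate F' G Q L') :
    HasLogRate (geomMean F F' a b) G Q (a * L + b * L') := by
  refine ((h.const_mul a).add (h'.const_mul b)).congr fun c => ?_
  have h₁ := pos_typeClass hF G c
  have h₂ := pos_typeClass hF' G c
  have e : ((ZeroError.geomMean F F' a b (typeClass G c) : ℝ≥0) : ℝ)
      = (F (typeClass G c) : ℝ) ^ a * (F' (typeClass G c) : ℝ) ^ b := by
    change ((F (typeClass G c) ^ a * F' (typeClass G c) ^ b : ℝ≥0) : ℝ) = _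
    push_cast
    rfl
  rw [e, Real.log_mul (Real.rpow_pos_of_pos h₁ a).ne' (Real.rpow_pos_of_pos h₂ b).ne',
    Real.log_rpow h₁, Real.log_rpow h₂]
  ring

/-- A type graph `X` is vertex transitive, so by `IsVertexTransitive.exists_type` its power `X ^ m`
is at most polynomially many copies of a single type graph over `X`. For such `X`, passing from `F`
to growth rates therefore loses nothing. -/
theorem typeClass_le_value {F : GraphClass →* ℝ≥0} (hF : IsNormalized F)
    (G : FinGraph) (c : G.V → ℕ) :
    F (typeClass G c) ≤ value F (wordGraph (Fin (∑ v, c v)) G c) 1 := by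
  set X := wordGraph (Fin (∑ v, c v)) G c
  have hX : X.IsVertexTransitive := isVertexTransitive_wordGraph _ _ _
  obtain ⟨x, hx⟩ := exists_word (I := Fin (∑ v, c v)) c (by simp)
  have : Nonempty X.V := ⟨⟨x, hx⟩⟩
  set A := Fintype.card X.V
  refine le_of_pow_le_poly_mul_pow (C := A + 1) (k := A + 1) fun m => ?_
  obtain ⟨k, hk, h⟩ := hX.exists_type m
  have h' := hF.mono h
  rw [map_mul, map_pow, hF.map_natCast] at h'
  have hpoly : (((m + 1) ^ A * (A * m + 1) : ℕ) : ℝ≥0) ≤ (A + 1) * ((m : ℝ≥0) + 1) ^ (A + 1) := by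
    have : (m + 1) ^ A * (A * m + 1) ≤ (A + 1) * (m + 1) ^ (A + 1) := by
      rw [pow_succ]
      have : A * m + 1 ≤ (A + 1) * (m + 1) := by nlinarith
      calc _ ≤ (m + 1) ^ A * ((A + 1) * (m + 1)) := Nat.mul_le_mul_left _ this
        _ = _ := by ring
    exact_mod_cast this
  have hv := typeValue_le_value_pow hF X 1 k
  rw [hk] at hv
  simp only [typeValue, Pi.one_apply, one_pow, Finset.prod_const_one, mul_one] at hv
  exact h'.trans (mul_le_mul' hpoly hv)

/-- Types over a type graph flatten to multiples of `c`, so bounds at the multiples `m • c` control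
the value. -/
theorem value_wordGraph_le {F : GraphClass →* ℝ≥0} (hF : IsNormalized F)
    {G : FinGraph} {c : G.V → ℕ} {K : ℝ≥0}
    (h : ∀ m ≠ 0, F (typeClass G (m • c)) ≤ K ^ ∑ v, (m • c) v) :
    value F (wordGraph (Fin (∑ v, c v)) G c) 1 ≤ K ^ ∑ v, c v := by
  refine value_le fun k hk => ?_
  simp only [typeValue, Pi.one_apply, one_pow, Finset.prod_const_one, mul_one]
  refine (hF.mono (typeClass_wordGraph_le (by simp) k)).trans
    ((h _ (sum_ne_zero_of_ne_zero hk)).trans_eq ?_)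
  rw [← pow_mul]
  congr 1
  simp only [Pi.smul_apply, smul_eq_mul]
  rw [← Finset.mul_sum, mul_comm]

/-- The values have the same growth rates as the functional. -/
theorem HasLogRate.of_value {F : GraphClass →* ℝ≥0} (hF : IsNormalized F)
    {G : FinGraph} {Q : G.V → ℝ} {L : ℝ} (h : HasLogRate F G Q L)
    {F' : GraphClass →* ℝ≥0} (hF' : ∀ G : FinGraph, F' G.toClass = value F G 1) :
    HasLogRate F' G Q L := by
  have hlow : ∀ c : G.V → ℕ, Real.log (F (typeClass G c)) / (∑ v, c v : ℕ) ≤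
      Real.log (F' (typeClass G c)) / (∑ v, c v : ℕ) := fun c => by
    refine div_le_div_of_nonneg_right (Real.log_le_log (pos_typeClass hF G c) ?_)
      (Nat.cast_nonneg _)
    rw [typeClass, hF']
    exact_mod_cast typeClass_le_value hF G c
  refine tendsto_order.2 ⟨fun y hy => ?_, fun y hy => ?_⟩
  · filter_upwards [h.eventually (lt_mem_nhds hy)] with c hc
    exact hc.trans_le (hlow c)
  -- The bound `rate < z` holds for all types beyond a size `N` with frequencies in a neighbourhood
  -- `t'` of `Q`. If `c` is such a type, so are all its nonzero multiples, which have the same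
  -- frequencies and at least the same size. This uniformity is what `value_wordGraph_le` asks for.
  · obtain ⟨z, hLz, hzy⟩ := exists_between hy
    have hev := h.eventually (gt_mem_nhds hLz)
    rw [typeFilter, eventually_inf] at hev
    obtain ⟨s, hs, t, ht, hst⟩ := hev
    obtain ⟨s', hs', hss⟩ := mem_comap.1 hs
    obtain ⟨N, hN⟩ := mem_atTop_sets.1 hs'
    obtain ⟨t', ht', htt⟩ := mem_comap.1 ht
    have h₁ : ∀ᶠ c : G.V → ℕ in typeFilter Q, N + 1 ≤ ∑ v, c v :=
      (tendsto_comap.mono_left inf_le_left).eventually (eventually_ge_atTop (N + 1))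
    have h₂ : ∀ᶠ c : G.V → ℕ in typeFilter Q, freq c ∈ t' :=
      (tendsto_comap.mono_left inf_le_right).eventually ht'
    filter_upwards [h₁, h₂] with c hcN hct
    have hpos : 0 < ∑ v, c v := by omega
    have hpos' : (0 : ℝ) < (∑ v, c v : ℕ) := by exact_mod_cast hpos
    refine lt_of_le_of_lt ?_ hzy
    have hval : value F (wordGraph (Fin (∑ v, c v)) G c) 1 ≤
        (Real.exp z).toNNReal ^ ∑ v, c v := by
      refine value_wordGraph_le hF fun m hm => ?_
      have hsum : ∑ v, (m • c) v = m * ∑ v, c v := by simp [Finset.mul_sum]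
      have hm' : (m : ℝ) ≠ 0 := by exact_mod_cast hm
      have hfr : freq (m • c) = freq c := by
        ext v
        rw [freq, freq, hsum]
        simp only [Pi.smul_apply, smul_eq_mul, Nat.cast_mul]
        rw [mul_div_mul_left _ _ hm']
      have hmN : N ≤ ∑ v, (m • c) v := by
        rw [hsum]
        have := Nat.le_mul_of_pos_left (∑ v, c v) (Nat.pos_of_ne_zero hm)
        omega
      have hlt := hst (m • c) ⟨hss (hN _ hmN), htt (by rw [Set.mem_preimage, hfr]; exact hct)⟩
      have hmpos : (0 : ℝ) < (∑ v, (m • c) v : ℕ) := by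
        rw [hsum]
        exact_mod_cast Nat.mul_pos (Nat.pos_of_ne_zero hm) hpos
      rw [div_lt_iff₀ hmpos] at hlt
      have := (Real.log_lt_iff_lt_exp (pos_typeClass hF G _)).1 hlt
      rw [mul_comm, Real.exp_nat_mul] at this
      rw [← NNReal.coe_le_coe, NNReal.coe_pow, Real.coe_toNNReal _ (Real.exp_pos z).le]
      exact this.le
    rw [div_le_iff₀ hpos', mul_comm, ← Real.log_exp z, ← Real.log_pow]
    have hF'pos : (0 : ℝ) < F' (typeClass G c) := by
      rw [typeClass, hF']
      exact lt_of_lt_of_le (pos_typeClass hF G c) (by exact_mod_cast typeClass_le_value hF G c)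
    refine Real.log_le_log hF'pos ?_
    rw [typeClass, hF']
    rw [← NNReal.coe_le_coe, NNReal.coe_pow, Real.coe_toNNReal _ (Real.exp_pos z).le] at hval
    exact hval

/-! ## Noncommutative graphs of dimension-labelled graphs -/

/-- A graph whose vertices carry positive dimensions that are constant along the edges. -/
structure DimGraph : Type 1 where
  graph : FinGraph
  dim : graph.V → ℕ
  dim_pos : ∀ v, 0 < dim v
  dim_eq : ∀ x y, graph.AdjEq x y → dim x = dim y

namespace DimGraph

/-- The noncommutative graph in which the vertex `x` is replaced with a space of dimension
`dim x`. -/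
abbrev toNC (W : DimGraph) : NCGraph where
  ι := Σ x : W.graph.V, Fin (W.dim x)
  space :=
    -- The inner indices at `x` and `y` have different types, so they are compared as natural
    -- numbers. The blocks that survive join vertices of equal dimension, where the block is a
    -- multiple of the identity.
    { carrier := {M | ∃ m : W.graph.V → W.graph.V → ℂ, (∀ x y, ¬ W.graph.AdjEq x y → m x y = 0) ∧
        ∀ p q, M p q = if p.2.val = q.2.val then m p.1 q.1 else 0}
      zero_mem' := ⟨0, fun _ _ _ => rfl, fun p q => by simp⟩
      add_mem' := by
        rintro A B ⟨m, hm, hA⟩ ⟨m', hm', hB⟩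
        refine ⟨m + m', fun x y h => by simp [hm x y h, hm' x y h], fun p q => ?_⟩
        rw [Matrix.add_apply, hA, hB]
        split_ifs <;> simp
      smul_mem' := by
        rintro c A ⟨m, hm, hA⟩
        refine ⟨c • m, fun x y h => by simp [hm x y h], fun p q => ?_⟩
        rw [Matrix.smul_apply, hA]
        split_ifs <;> simp }
  one_mem := by
    refine ⟨fun x y => if x = y then 1 else 0, fun x y h => if_neg fun h' => h (Or.inl h'), ?_⟩
    rintro ⟨x, a⟩ ⟨y, b⟩
    rw [Matrix.one_apply]
    by_cases h : x = y
    · subst h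
      simp [Fin.ext_iff]
    · simp [h]
  star_mem := by
    rintro A ⟨m, hm, hA⟩
    refine ⟨fun x y => star (m y x), fun x y h => ?_, fun p q => ?_⟩
    · dsimp only
      rw [hm y x fun h' => h h'.symm, star_zero]
    · rw [Matrix.conjTranspose_apply, hA]
      simp only [eq_comm (a := p.2.val)]
      split_ifs <;> simp

/-- The operator that identifies the spaces at `y` and `x`. -/
def transfer (W : DimGraph) (x y : W.graph.V) : Matrix W.toNC.ι W.toNC.ι ℂ := fun p q =>
  if p.2.val = q.2.val then (if p.1 = x ∧ q.1 = y then 1 else 0) else 0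

theorem transfer_mem {W : DimGraph} {x y : W.graph.V} (h : W.graph.AdjEq x y) :
    W.transfer x y ∈ W.toNC.space :=
  ⟨fun x' y' => if x' = x ∧ y' = y then 1 else 0, fun x' y' h' => if_neg (by
    rintro ⟨rfl, rfl⟩; exact h' h), fun _ _ => rfl⟩

/-- Disjoint union. -/
abbrev disjUnion (W W' : DimGraph) : DimGraph where
  graph := W.graph.disjUnion W'.graph
  dim := Sum.elim W.dim W'.dim
  dim_pos := by rintro (v | v) <;> [exact W.dim_pos v; exact W'.dim_pos v]
  dim_eq := by
    intro x y h
    rw [disjUnion_adjEq] at h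
    cases h with
    | inl h => exact W.dim_eq _ _ h
    | inr h => exact W'.dim_eq _ _ h

/-- Strong product. -/
abbrev strongProd (W W' : DimGraph) : DimGraph where
  graph := W.graph.strongProd W'.graph
  dim v := W.dim v.1 * W'.dim v.2
  dim_pos v := Nat.mul_pos (W.dim_pos _) (W'.dim_pos _)
  dim_eq x y h := by
    rw [strongProd_adjEq] at h
    rw [W.dim_eq _ _ h.1, W'.dim_eq _ _ h.2]

/-- A graph with constant dimension. -/
abbrev const (G : FinGraph) (d : ℕ) (hd : 0 < d) : DimGraph := ⟨G, fun _ => d, fun _ => hd,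
  fun _ _ _ => rfl⟩

theorem toClass_toNC_disjUnion (W W' : DimGraph) :
    (W.disjUnion W').toNC.toClass = W.toNC.toClass + W'.toNC.toClass := by
  refine Quotient.sound (iso_of_equiv (S := (W.disjUnion W').toNC)
    (T := W.toNC.directSum W'.toNC)
    (Equiv.sumSigmaDistrib fun v : W.graph.V ⊕ W'.graph.V => Fin (Sum.elim W.dim W'.dim v)) ?_ ?_)
  · rintro A ⟨m, hm, hA⟩
    refine ⟨fun p q => A ⟨Sum.inl p.1, p.2⟩ ⟨Sum.inl q.1, q.2⟩,
      ⟨fun x y => m (Sum.inl x) (Sum.inl y), fun x y h => hm _ _ fun h' => h ?_,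
        fun p q => hA _ _⟩,
      fun p q => A ⟨Sum.inr p.1, p.2⟩ ⟨Sum.inr q.1, q.2⟩,
      ⟨fun x y => m (Sum.inr x) (Sum.inr y), fun x y h => hm _ _ fun h' => h ?_,
        fun p q => hA _ _⟩, ?_⟩
    · simpa [disjUnion_adjEq] using h'
    · simpa [disjUnion_adjEq] using h'
    · ext (p | p) (q | q)
      · rfl
      · refine (hA _ _).trans ?_
        exact (congrArg (ite _ · _) (hm (Sum.inl p.1) (Sum.inr q.1)
          (by simp [disjUnion_adjEq]))).trans (ite_self _)
      · refine (hA _ _).trans ?_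
        exact (congrArg (ite _ · _) (hm (Sum.inr p.1) (Sum.inl q.1)
          (by simp [disjUnion_adjEq]))).trans (ite_self _)
      · rfl
  · rintro _ ⟨A, ⟨m, hm, hA⟩, B, ⟨m', hm', hB⟩, rfl⟩
    refine ⟨fun x y => match x, y with
      | Sum.inl x, Sum.inl y => m x y
      | Sum.inr x, Sum.inr y => m' x y
      | _, _ => 0, ?_, ?_⟩
    · rintro (x | x) (y | y) h
      · exact hm _ _ (by simpa [disjUnion_adjEq] using h)
      · rfl
      · rfl
      · exact hm' _ _ (by simpa [disjUnion_adjEq] using h)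
    · rintro ⟨x | x, a⟩ ⟨y | y, b⟩
      · exact hA _ _
      · exact (ite_self _).symm
      · exact (ite_self _).symm
      · exact hB _ _

/-- The numerical code of a pair depends on the dimensions, so codes may be compared only between
vertices of equal dimensions, in particular along edges. -/
theorem finProdFinEquiv_val_eq_iff {m n m' n' : ℕ} (hm : m = m') (hn : n = n') (a : Fin m)
    (b : Fin n) (a' : Fin m') (b' : Fin n') :
    (finProdFinEquiv (a, b)).val = (finProdFinEquiv (a', b')).val ↔
      a.val = a'.val ∧ b.val = b'.val := by
  subst hm hn
  rw [← Fin.ext_iff, finProdFinEquiv.injective.eq_iff, Prod.mk.injEq, Fin.ext_iff, Fin.ext_iff]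

/-- The bases of the product. -/
def prodEquiv (W W' : DimGraph) :
    (Σ v : W.graph.V × W'.graph.V, Fin (W.dim v.1 * W'.dim v.2)) ≃
      (Σ x : W.graph.V, Fin (W.dim x)) × (Σ y : W'.graph.V, Fin (W'.dim y)) where
  toFun p := (⟨p.1.1, (finProdFinEquiv.symm p.2).1⟩, ⟨p.1.2, (finProdFinEquiv.symm p.2).2⟩)
  invFun p := ⟨(p.1.1, p.2.1), finProdFinEquiv (p.1.2, p.2.2)⟩
  left_inv p := by
    obtain ⟨v, k⟩ := p
    obtain ⟨k, rfl⟩ := finProdFinEquiv.surjective k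
    simp only [Equiv.symm_apply_apply]
  right_inv p := by simp

theorem mul_ite_and_mul_ite_and (P Q A B C D : Prop) [Decidable P] [Decidable Q] [Decidable A]
    [Decidable B] [Decidable C] [Decidable D] (t : ℂ) :
    t * ((if P then (if A ∧ B then 1 else 0) else 0) *
        (if Q then (if C ∧ D then 1 else 0) else 0)) =
      if A ∧ C then (if B ∧ D then (if P ∧ Q then t else 0) else 0) else 0 := by
  simp only [ite_and]
  split_ifs <;> simp

theorem ite_mul_ite_zero (P Q : Prop) [Decidable P] [Decidable Q] (s t : ℂ) :
    (if P then s else 0) * (if Q then t else 0) = if P ∧ Q then s * t else 0 := by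
  simp only [ite_and]
  split_ifs <;> simp

theorem toClass_toNC_strongProd (W W' : DimGraph) :
    (W.strongProd W').toNC.toClass = W.toNC.toClass * W'.toNC.toClass := by
  refine Quotient.sound (iso_of_equiv (S := (W.strongProd W').toNC)
    (T := W.toNC.tensor W'.toNC) (prodEquiv W W') ?_ ?_)
  · rintro A ⟨m, hm, hA⟩
    -- An element of the product space is a combination of products of elementary transfers, with
    -- the coefficients vanishing off the edges, so that it lies in the span of pure tensors.
    have : A.submatrix (prodEquiv W W').symm (prodEquiv W W').symm =
        ∑ v : W.graph.V × W'.graph.V, ∑ w : W.graph.V × W'.graph.V,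
          m v w • (W.transfer v.1 w.1 ⊗ₖ W'.transfer v.2 w.2) := by
      ext ⟨⟨x, a⟩, ⟨y, b⟩⟩ ⟨⟨x', a'⟩, ⟨y', b'⟩⟩
      have hT : ∀ v w : W.graph.V × W'.graph.V,
          (m v w • (W.transfer v.1 w.1 ⊗ₖ W'.transfer v.2 w.2)) (⟨x, a⟩, ⟨y, b⟩)
            (⟨x', a'⟩, ⟨y', b'⟩) = if v = (x, y) then (if w = (x', y') then
              (if a.val = a'.val ∧ b.val = b'.val then m v w else 0) else 0) else 0 := by
        rintro ⟨x₁, y₁⟩ ⟨x₂, y₂⟩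
        rw [Matrix.smul_apply, Matrix.kroneckerMap_apply, transfer, transfer, smul_eq_mul,
          mul_ite_and_mul_ite_and]
        simp only [Prod.mk.injEq, eq_comm]
      simp only [Matrix.sum_apply, hT]
      simp only [Finset.sum_ite_eq', Finset.mem_univ, if_true, Finset.sum_ite_irrel,
        Finset.sum_const_zero]
      rw [Matrix.submatrix_apply, hA]
      change (if (finProdFinEquiv (a, b)).val = (finProdFinEquiv (a', b')).val
        then m (x, y) (x', y') else 0) = _
      by_cases h : (W.graph.strongProd W'.graph).AdjEq (x, y) (x', y')
      · have h' := (strongProd_adjEq _ _).1 h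
        simp only [finProdFinEquiv_val_eq_iff (W.dim_eq _ _ h'.1) (W'.dim_eq _ _ h'.2)]
      · rw [hm _ _ h, ite_self, ite_self]
    rw [this]
    refine Submodule.sum_mem _ fun v _ => Submodule.sum_mem _ fun w _ => ?_
    by_cases h : (W.graph.strongProd W'.graph).AdjEq v w
    · have h' := (strongProd_adjEq _ _).1 h
      exact Submodule.smul_mem _ _ (kron_mem (transfer_mem h'.1) (transfer_mem h'.2))
    · rw [hm _ _ h, zero_smul]
      exact Submodule.zero_mem _
  · refine tensor_mem (S := W.toNC) (T := W'.toNC) (submatrixL (prodEquiv W W')) ?_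
    rintro A ⟨m, hm, hA⟩ B ⟨m', hm', hB⟩
    refine ⟨fun v w => m v.1 w.1 * m' v.2 w.2, fun v w h => ?_, ?_⟩
    · rw [strongProd_adjEq, not_and_or] at h
      dsimp only
      rcases h with h | h
      · rw [hm _ _ h, zero_mul]
      · rw [hm' _ _ h, mul_zero]
    · rintro ⟨⟨x, y⟩, k⟩ ⟨⟨x', y'⟩, l⟩
      obtain ⟨⟨a, b⟩, rfl⟩ := finProdFinEquiv.surjective k
      obtain ⟨⟨a', b'⟩, rfl⟩ := finProdFinEquiv.surjective l
      change A _ _ * B _ _ = _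
      rw [hA, hB]
      simp only [prodEquiv, Equiv.coe_fn_mk, Equiv.symm_apply_apply]
      by_cases h : W.graph.AdjEq x x' ∧ W'.graph.AdjEq y y'
      · simp only [finProdFinEquiv_val_eq_iff (W.dim_eq _ _ h.1) (W'.dim_eq _ _ h.2)]
        rw [ite_mul_ite_zero]
      · rw [not_and_or] at h
        rcases h with h | h
        · rw [hm _ _ h, ite_self, zero_mul, zero_mul, ite_self]
        · rw [hm' _ _ h, ite_self, mul_zero, mul_zero, ite_self]

end DimGraph

theorem NCGraph.toClass_eq_of_isEmpty {S T : NCGraph} [IsEmpty S.ι] [IsEmpty T.ι] :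
    S.toClass = T.toClass :=
  Quotient.sound (iso_of_equiv (Equiv.equivOfIsEmpty S.ι T.ι)
    (fun A _ => by
      rw [Subsingleton.elim (A.submatrix _ _) 0]
      exact Submodule.zero_mem _)
    fun B _ => by
      rw [Subsingleton.elim (B.submatrix _ _) 0]
      exact Submodule.zero_mem _)

theorem mem_ofGraph {G : FinGraph} {A : Matrix G.V G.V ℂ} :
    A ∈ (ofGraph G).space ↔ ∀ x y, ¬ G.AdjEq x y → A x y = 0 := by
  constructor
  · intro h x y hxy
    induction h using Submodule.span_induction with
    | mem M h =>
      obtain ⟨x', y', h', rfl⟩ := h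
      exact Matrix.single_apply_of_ne _ _ _ _ _ (by rintro ⟨rfl, rfl⟩; exact hxy h')
    | zero => rfl
    | add M N _ _ hM hN => rw [Matrix.add_apply, hM, hN, add_zero]
    | smul c M _ hM => rw [Matrix.smul_apply, hM, smul_zero]
  · intro h
    rw [Matrix.matrix_eq_sum_single A]
    refine Submodule.sum_mem _ fun x _ => Submodule.sum_mem _ fun y _ => ?_
    by_cases hxy : G.AdjEq x y
    · have : Matrix.single x y (A x y) = A x y • Matrix.single x y (1 : ℂ) := by
        rw [Matrix.smul_single, smul_eq_mul, mul_one]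
      rw [this]
      exact Submodule.smul_mem _ _ (Submodule.subset_span ⟨x, y, hxy, rfl⟩)
    · rw [h x y hxy, Matrix.single_zero]
      exact Submodule.zero_mem _

theorem mem_tensor_ofGraph {G : FinGraph} {d : ℕ} {M : Matrix (G.V × Fin d) (G.V × Fin d) ℂ} :
    M ∈ ((ofGraph G).tensor (idealQuantum d)).space ↔
      ∃ m : G.V → G.V → ℂ, (∀ x y, ¬ G.AdjEq x y → m x y = 0) ∧
        ∀ p q, M p q = if p.2 = q.2 then m p.1 q.1 else 0 := by
  constructor
  · intro h
    induction h using Submodule.span_induction with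
    | mem M h =>
      obtain ⟨A, hA, B, hB, rfl⟩ := h
      obtain ⟨c, rfl⟩ := Submodule.mem_span_singleton.1 hB
      refine ⟨fun x y => A x y * c, fun x y h => ?_, fun p q => ?_⟩
      · exact (congrArg (· * c) (mem_ofGraph.1 hA x y h)).trans (zero_mul c)
      · rw [Matrix.kroneckerMap_apply, Matrix.smul_apply, Matrix.one_apply]
        split_ifs <;> simp
    | zero => exact ⟨0, fun _ _ _ => rfl, fun p q => by simp⟩
    | add A B _ _ hA hB =>
      obtain ⟨m, hm, hA⟩ := hA
      obtain ⟨m', hm', hB⟩ := hB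
      refine ⟨m + m', fun x y h => by simp [hm x y h, hm' x y h], fun p q => ?_⟩
      rw [Matrix.add_apply, hA, hB]
      split_ifs <;> simp
    | smul c A _ hA =>
      obtain ⟨m, hm, hA⟩ := hA
      refine ⟨c • m, fun x y h => by simp [hm x y h], fun p q => ?_⟩
      rw [Matrix.smul_apply, hA]
      split_ifs <;> simp
  · rintro ⟨m, hm, hM⟩
    have : M = Matrix.of m ⊗ₖ (1 : Matrix (Fin d) (Fin d) ℂ) := by
      ext p q
      rw [hM, Matrix.kroneckerMap_apply, Matrix.one_apply]
      split_ifs <;> simp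
    rw [this]
    exact kron_mem (S := ofGraph G) (T := idealQuantum d) (mem_ofGraph.2 hm)
      (idealQuantum d).one_mem

theorem toClass_toNC_const_one (G : FinGraph) :
    (DimGraph.const G 1 one_pos).toNC.toClass = NCClass.ofGraphClass G.toClass := by
  refine Quotient.sound (iso_of_equiv (S := (DimGraph.const G 1 one_pos).toNC)
    (T := ofGraph G) (Equiv.sigmaUnique G.V fun _ => Fin 1) ?_ ?_)
  · rintro A ⟨m, hm, hA⟩
    refine mem_ofGraph.2 fun x y h => ?_
    rw [Matrix.submatrix_apply, hA]
    have : m x y = 0 := hm _ _ h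
    simp [this]
  · intro B hB
    refine ⟨fun x y => B x y, fun x y h => mem_ofGraph.1 hB x y h, ?_⟩
    rintro ⟨x, a⟩ ⟨y, b⟩
    simp [Subsingleton.elim a b]

theorem toClass_toNC_const_point (d : ℕ) (hd : 0 < d) :
    (DimGraph.const FinGraph.point d hd).toNC.toClass = (idealQuantum d).toClass := by
  refine Quotient.sound (iso_of_equiv (S := (DimGraph.const FinGraph.point d hd).toNC)
    (T := idealQuantum d) (Equiv.uniqueSigma fun _ : PUnit => Fin d) ?_ ?_)
  · rintro A ⟨m, hm, hA⟩
    refine Submodule.mem_span_singleton.2 ⟨m PUnit.unit PUnit.unit, ?_⟩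
    ext a b
    rw [Matrix.submatrix_apply, hA, Matrix.smul_apply, Matrix.one_apply]
    simp [Fin.ext_iff, Equiv.uniqueSigma]
    rfl
  · intro B hB
    obtain ⟨c, rfl⟩ := Submodule.mem_span_singleton.1 hB
    refine ⟨fun _ _ => c, fun x y h => absurd (Or.inl rfl) h, ?_⟩
    rintro ⟨x, a⟩ ⟨y, b⟩
    rw [Matrix.submatrix_apply, Matrix.smul_apply, Matrix.one_apply]
    simp [Fin.ext_iff]

theorem toClass_idealQuantum_one : (idealQuantum 1).toClass = 1 := by
  refine Quotient.sound (iso_of_equiv (S := idealQuantum 1) (T := NCGraph.scalars PUnit)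
    (Equiv.ofUnique (Fin 1) PUnit) ?_ ?_)
  · intro A hA
    obtain ⟨c, rfl⟩ := Submodule.mem_span_singleton.1 hA
    refine Submodule.mem_span_singleton.2 ⟨c, ?_⟩
    ext a b
    simp
  · intro A hA
    obtain ⟨c, rfl⟩ := Submodule.mem_span_singleton.1 hA
    refine Submodule.mem_span_singleton.2 ⟨c, ?_⟩
    ext a b
    simp [Subsingleton.elim a b]

/-- Every element of `𝒜` is the class of a dimension-labelled graph. -/
theorem exists_dimGraph (a : algA) : ∃ W : DimGraph, W.toNC.toClass = a.1 := by
  obtain ⟨a, ha⟩ := a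
  -- Dimensions are required to be positive, so the zero space, and with it `idealQuantum 0`, is
  -- represented by the empty graph.
  have hzero : ∀ S : NCGraph, IsEmpty S.ι → ∃ W : DimGraph, W.toNC.toClass = S.toClass :=
    fun S hS => ⟨DimGraph.const FinGraph.empty 1 one_pos, by
      have : IsEmpty (DimGraph.const FinGraph.empty 1 one_pos).toNC.ι := ⟨fun p => p.1.elim⟩
      exact NCGraph.toClass_eq_of_isEmpty⟩
  change ∃ W : DimGraph, W.toNC.toClass = a
  induction ha using Subsemiring.closure_induction with
  | mem a ha =>
    rcases ha with ⟨X, rfl⟩ | ⟨d, rfl⟩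
    · induction X using Quotient.inductionOn with
      | h G => exact ⟨DimGraph.const G 1 one_pos, toClass_toNC_const_one G⟩
    · rcases Nat.eq_zero_or_pos d with rfl | hd
      · exact hzero (idealQuantum 0) ⟨fun p => p.elim0⟩
      · exact ⟨DimGraph.const FinGraph.point d hd, toClass_toNC_const_point d hd⟩
  | zero => exact hzero NCGraph.zero ⟨fun p => p.elim⟩
  | one => exact ⟨DimGraph.const FinGraph.point 1 one_pos,
      (toClass_toNC_const_point 1 one_pos).trans toClass_idealQuantum_one⟩
  | add a b _ _ ha hb =>
    obtain ⟨W, rfl⟩ := ha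
    obtain ⟨W', rfl⟩ := hb
    exact ⟨W.disjUnion W', DimGraph.toClass_toNC_disjUnion W W'⟩
  | mul a b _ _ ha hb =>
    obtain ⟨W, rfl⟩ := ha
    obtain ⟨W', rfl⟩ := hb
    exact ⟨W.strongProd W', DimGraph.toClass_toNC_strongProd W W'⟩

/-! ## Cohomomorphisms of dimension-labelled graphs -/

/-- Extension of a vector by zero. -/
def zeroExtend {n : ℕ} (g : Fin n → ℂ) (b : ℕ) : ℂ := if h : b < n then g ⟨b, h⟩ else 0

theorem zeroExtend_val {n : ℕ} (g : Fin n → ℂ) (b : Fin n) : zeroExtend g b = g b := by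
  simp [zeroExtend]

theorem sum_transfer {m n : ℕ} (h : m = n) (g : Fin m → ℂ) (g' : Fin n → ℂ) :
    ∑ b' : Fin n, (∑ b : Fin m, star (g b) * if b.val = b'.val then 1 else 0) * g' b' =
      ∑ b ∈ Finset.range m, star (zeroExtend g b) * zeroExtend g' b := by
  subst h
  rw [Finset.sum_range]
  refine Finset.sum_congr rfl fun b _ => ?_
  rw [zeroExtend_val, zeroExtend_val, Finset.sum_eq_single b]
  · simp
  · intro b' _ hb
    rw [if_neg fun h => hb (Fin.ext h), mul_zero]
  · simp

/-- The entries are inner products of the column slices of `E` at `y` and of `E'` at `y'`. Extending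
the slices by zero to functions on `ℕ` lets slices in different spaces be paired. -/
theorem conjTranspose_mul_transfer_mul {W W' : DimGraph}
    (E E' : Matrix W'.toNC.ι W.toNC.ι ℂ) {y y' : W'.graph.V} (h : W'.dim y = W'.dim y')
    (p q : W.toNC.ι) :
    (Eᴴ * W'.transfer y y' * E') p q = ∑ b ∈ Finset.range (W'.dim y),
      star (zeroExtend (fun b => E ⟨y, b⟩ p) b) * zeroExtend (fun b => E' ⟨y', b⟩ q) b := by
  rw [← sum_transfer h, Matrix.mul_apply, Fintype.sum_sigma, Finset.sum_eq_single y']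
  · refine Finset.sum_congr rfl fun b' _ => ?_
    congr 1
    rw [Matrix.mul_apply, Fintype.sum_sigma, Finset.sum_eq_single y]
    · simp [DimGraph.transfer]
    · intro z _ hz
      refine Finset.sum_eq_zero fun b _ => ?_
      simp [DimGraph.transfer, hz]
    · simp
  · intro z _ hz
    refine Finset.sum_eq_zero fun b _ => ?_
    rw [Matrix.mul_apply, Finset.sum_eq_zero, zero_mul]
    intro r _
    simp [DimGraph.transfer, hz]
  · simp

/-- A cohomomorphism maps the vertices to vertices, with partial isometries between the spaces at
the vertices. -/
theorem exists_isometries {W W' : DimGraph} (h : W.toNC.CohomLE W'.toNC) :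
    ∃ (φ : W.graph.V → W'.graph.V) (v : W.graph.V → ℕ → ℕ → ℂ) (m : W.graph.V → W.graph.V → ℂ),
      (∀ x, m x x = 1) ∧ ∀ x y, W'.graph.AdjEq (φ x) (φ y) → (¬ W.graph.AdjEq x y → m x y = 0) ∧
        ∀ a < W.dim x, ∀ b < W.dim y, ∑ k ∈ Finset.range (W'.dim (φ x)),
          star (v x k a) * v y k b = if a = b then m x y else 0 := by
  classical
  obtain ⟨n, E, hE, hES⟩ := h
  -- Since `∑ (E i)* (E i) = I`, some operator does not kill the first basis vector at `x`. This
  -- selects for each `x` an operator and a vertex `φ x` such that the block from `x` to `φ x` is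
  -- nonzero.
  have hex : ∀ x : W.graph.V, ∃ i y b, E i ⟨y, b⟩ ⟨x, ⟨0, W.dim_pos x⟩⟩ ≠ 0 := by
    intro x
    by_contra! h
    have h₁ := congrFun (congrFun hE ⟨x, ⟨0, W.dim_pos x⟩⟩) ⟨x, ⟨0, W.dim_pos x⟩⟩
    rw [Matrix.sum_apply, Finset.sum_eq_zero, Matrix.one_apply_eq] at h₁
    · exact zero_ne_one h₁
    · intro i _
      rw [Matrix.mul_apply]
      exact Finset.sum_eq_zero fun r _ => by rw [h i r.1 r.2, mul_zero]
  choose i φ b hb using hex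
  let u : W.graph.V → ℕ → ℕ → ℂ := fun x k a =>
    if h : a < W.dim x then zeroExtend (fun b => E (i x) ⟨φ x, b⟩ ⟨x, ⟨a, h⟩⟩) k else 0
  have hm : ∀ x y, W'.graph.AdjEq (φ x) (φ y) → ∃ m : ℂ, (¬ W.graph.AdjEq x y → m = 0) ∧
      ∀ a < W.dim x, ∀ b < W.dim y, ∑ k ∈ Finset.range (W'.dim (φ x)),
          star (u x k a) * u y k b = if a = b then m else 0 := by
    intro x y hxy
    -- Applied to the transfer between `φ x` and `φ y`, the cohomomorphism condition says that the
    -- product of the two selected blocks is a scalar matrix, with scalar zero unless `x ≃ y`.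
    obtain ⟨m, hm0, hm⟩ := hES (i x) (i y) _ (DimGraph.transfer_mem hxy)
    refine ⟨m x y, hm0 x y, fun a ha b hb => ?_⟩
    have := hm ⟨x, ⟨a, ha⟩⟩ ⟨y, ⟨b, hb⟩⟩
    rw [conjTranspose_mul_transfer_mul _ _ (W'.dim_eq _ _ hxy)] at this
    simp only [u, dif_pos ha, dif_pos hb]
    exact this
  choose m hm0 hm using hm
  -- For `x = y` the scalar is the squared norm of any column; column `0` is nonzero by the choice
  -- of the block, so dividing by `sqrt (r x)` produces an isometry.
  let r : W.graph.V → ℝ := fun x => ∑ k ∈ Finset.range (W'.dim (φ x)), ‖u x k 0‖ ^ 2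
  have hr : ∀ x, 0 < r x := fun x => by
    refine Finset.sum_pos' (fun _ _ => by positivity) ⟨b x, Finset.mem_range.2 (b x).2, ?_⟩
    have : u x (b x) 0 ≠ 0 := by
      simp only [u, dif_pos (W.dim_pos x), zeroExtend_val]
      exact hb x
    positivity
  have hrm : ∀ x, m x x (AdjEq.refl _) = r x := fun x => by
    have := hm x x (AdjEq.refl _) 0 (W.dim_pos x) 0 (W.dim_pos x)
    rw [if_pos rfl] at this
    rw [← this]
    push_cast [r]
    refine Finset.sum_congr rfl fun k _ => ?_
    exact Complex.conj_mul' _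
  refine ⟨φ, fun x k a => u x k a / (Real.sqrt (r x) : ℂ), fun x y =>
    if h : W'.graph.AdjEq (φ x) (φ y) then
      m x y h / ((Real.sqrt (r x) : ℂ) * (Real.sqrt (r y) : ℂ)) else 0, fun x => ?_,
    fun x y hxy => ⟨fun h => ?_, fun a ha b hb => ?_⟩⟩
  · dsimp only
    rw [dif_pos (AdjEq.refl _), hrm, ← Complex.ofReal_mul, Real.mul_self_sqrt (hr x).le,
      div_self (Complex.ofReal_ne_zero.2 (hr x).ne')]
  · dsimp only
    rw [dif_pos hxy, hm0 x y hxy h, zero_div]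
  · dsimp only
    rw [dif_pos hxy]
    have h₁ : ∀ k, star (u x k a / (Real.sqrt (r x) : ℂ)) * (u y k b / (Real.sqrt (r y) : ℂ)) =
        star (u x k a) * u y k b / ((Real.sqrt (r x) : ℂ) * (Real.sqrt (r y) : ℂ)) := fun k => by
      rw [star_div₀, div_mul_div_comm]
      congr 2
      exact Complex.conj_ofReal _
    simp only [h₁]
    rw [← Finset.sum_div, hm x y hxy a ha b hb]
    split_ifs <;> simp

theorem cohomLE_of_fintype {S T : NCGraph} {K : Type} [Fintype K] (E : K → Matrix S.ι T.ι ℂ)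
    (h₁ : ∑ i, (E i)ᴴ * E i = 1) (h₂ : ∀ i j, ∀ A ∈ S.space, (E i)ᴴ * A * E j ∈ T.space) :
    T.CohomLE S :=
  ⟨Fintype.card K, fun i => E ((Fintype.equivFin K).symm i), by
    rw [Equiv.sum_comp (Fintype.equivFin K).symm fun i => (E i)ᴴ * E i, h₁], fun i j => h₂ _ _⟩

/-- Isometries between the spaces at the vertices define a cohomomorphism. -/
theorem cohomLE_of_isometries {G G' : FinGraph} {d d' : ℕ} (φ : G.V → G'.V)
    (v : G.V → Matrix (Fin d') (Fin d) ℂ) (m : G.V → G.V → ℂ) (hm : ∀ x, m x x = 1)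
    (hm0 : ∀ x y, G'.AdjEq (φ x) (φ y) → ¬ G.AdjEq x y → m x y = 0)
    (hv : ∀ x y, G'.AdjEq (φ x) (φ y) → (v x)ᴴ * v y = m x y • (1 : Matrix (Fin d) (Fin d) ℂ)) :
    ((ofGraph G).tensor (idealQuantum d)).CohomLE ((ofGraph G').tensor (idealQuantum d')) := by
  -- The operator `|φ x⟩⟨x| ⊗ v x`. The squares `(E x)* (E x)` are the projections onto the summands
  -- at the vertices `x`, hence sum to the identity.
  let E : G.V → Matrix (G'.V × Fin d') (G.V × Fin d) ℂ := fun x p q =>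
    if p.1 = φ x ∧ q.1 = x then v x p.2 q.2 else 0
  have key : ∀ (x y : G.V) (A : Matrix (G'.V × Fin d') (G'.V × Fin d') ℂ) (c : ℂ),
      (∀ a b, A (φ x, a) (φ y, b) = if a = b then c else 0) → ∀ p q,
      ((E x)ᴴ * A * E y) p q = if p.1 = x ∧ q.1 = y then c * ((v x)ᴴ * v y) p.2 q.2 else 0 := by
    rintro x y A c hA ⟨x', a⟩ ⟨y', b⟩
    rw [Matrix.mul_apply, Fintype.sum_prod_type, Finset.sum_eq_single (φ y)]
    · by_cases hp : x' = x
      · by_cases hq : y' = y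
        · rw [if_pos ⟨hp, hq⟩, Matrix.mul_apply, Finset.mul_sum]
          refine Finset.sum_congr rfl fun k _ => ?_
          rw [Matrix.mul_apply, Fintype.sum_prod_type, Finset.sum_eq_single (φ x)]
          · simp only [hA, Matrix.conjTranspose_apply]
            simp [E, hp, hq]
            ring
          · intro z _ hz
            refine Finset.sum_eq_zero fun l _ => ?_
            rw [Matrix.conjTranspose_apply]
            simp [E, hz]
          · simp
        · rw [if_neg fun h => hq h.2]
          refine Finset.sum_eq_zero fun k _ => ?_
          simp [E, hq]
      · rw [if_neg fun h => hp h.1]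
        refine Finset.sum_eq_zero fun k _ => ?_
        rw [Matrix.mul_apply, Finset.sum_eq_zero, zero_mul]
        intro r _
        rw [Matrix.conjTranspose_apply]
        simp [E, hp]
    · intro z _ hz
      refine Finset.sum_eq_zero fun k _ => ?_
      simp [E, hz]
    · simp
  refine cohomLE_of_fintype (S := (ofGraph G').tensor (idealQuantum d'))
    (T := (ofGraph G).tensor (idealQuantum d)) E ?_ ?_
  · ext p q
    have h₁ : ∀ x, ((E x)ᴴ * E x) p q =
        if p.1 = x ∧ q.1 = x then (1 : Matrix (Fin d) (Fin d) ℂ) p.2 q.2 else 0 := fun x => by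
      have := key x x 1 1 (fun a b => by simp [Matrix.one_apply]) p q
      rwa [Matrix.mul_one, hv x x (AdjEq.refl _), hm, one_smul, one_mul] at this
    rw [Matrix.sum_apply]
    refine (Finset.sum_congr rfl fun x _ => h₁ x).trans ?_
    rw [Finset.sum_eq_single p.1]
    · obtain ⟨x, a⟩ := p
      obtain ⟨y, b⟩ := q
      simp only [Matrix.one_apply, Prod.mk.injEq]
      by_cases hxy : x = y <;> simp [hxy, eq_comm]
    · intro z _ hz
      rw [if_neg fun h => hz h.1.symm]
    · simp
  · intro x y A hA
    obtain ⟨μ, hμ0, hμ⟩ := mem_tensor_ofGraph.1 hA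
    refine mem_tensor_ofGraph.2 ⟨fun x' y' => if x' = x ∧ y' = y then
      μ (φ x) (φ y) * m x y else 0, fun x' y' h => ?_, fun p q => ?_⟩
    · dsimp only
      split_ifs with h'
      · obtain ⟨rfl, rfl⟩ := h'
        by_cases hxy : G'.AdjEq (φ x') (φ y')
        · rw [hm0 _ _ hxy h, mul_zero]
        · rw [hμ0 _ _ hxy, zero_mul]
      · rfl
    · refine (key x y A (μ (φ x) (φ y)) (fun a b => hμ _ _) p q).trans ?_
      by_cases hxy : G'.AdjEq (φ x) (φ y)
      · rw [hv x y hxy, Matrix.smul_apply, Matrix.one_apply]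
        by_cases h₁ : p.1 = x ∧ q.1 = y <;> by_cases h₂ : p.2 = q.2 <;> simp only [h₁, h₂] <;> simp
      · rw [hμ0 _ _ hxy]
        simp

/-! ### Product bases of tensor powers -/

section Decode

variable {I : Type} [Fintype I] [DecidableEq I]

/-- An enumeration of the vectors with entries bounded by `δ`. -/
noncomputable def decodeEquiv (δ : I → ℕ) {D : ℕ} (h : ∏ i, δ i = D) :
    Fin D ≃ ∀ i, Fin (δ i) :=
  Fintype.equivOfCardEq (by simp [h])

/-- An enumeration of the vectors with entries bounded by `δ`, as vectors of natural numbers. -/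
noncomputable def decode (δ : I → ℕ) {D : ℕ} (h : ∏ i, δ i = D) (A : Fin D) (i : I) : ℕ :=
  decodeEquiv δ h A i

theorem decode_lt (δ : I → ℕ) {D : ℕ} (h : ∏ i, δ i = D) (A : Fin D) (i : I) :
    decode δ h A i < δ i := (decodeEquiv δ h A i).2

/-- The enumeration is an arbitrary choice, but it depends only on the vector of dimensions. Along
edges these vectors agree, so adjacent words use the same product basis. -/
theorem decode_congr {δ δ' : I → ℕ} (e : δ = δ') {D : ℕ} (h : ∏ i, δ i = D)
    (h' : ∏ i, δ' i = D) : decode δ h = decode δ' h' := by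
  subst e
  rfl

theorem decode_injective (δ : I → ℕ) {D : ℕ} (h : ∏ i, δ i = D) :
    Function.Injective (decode δ h) := by
  intro A B hAB
  refine (decodeEquiv δ h).injective (funext fun i => Fin.ext ?_)
  exact congrFun hAB i

theorem sum_prod_decode (δ : I → ℕ) {D : ℕ} (h : ∏ i, δ i = D) (g : I → ℕ → ℂ) :
    ∑ A : Fin D, ∏ i, g i (decode δ h A i) = ∏ i, ∑ k ∈ Finset.range (δ i), g i k := by
  have := Equiv.sum_comp (decodeEquiv δ h) fun p => ∏ i, g i (p i)
  refine Eq.trans this ?_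
  simp only [Finset.sum_range]
  rw [Finset.prod_univ_sum, Fintype.piFinset_univ]

end Decode

theorem prod_pow_wordCount {I V M : Type} [Fintype I] [Fintype V] [DecidableEq V] [CommMonoid M]
    (x : I → V) (w : V → M) : ∏ v, w v ^ wordCount x v = ∏ i, w (x i) := by
  simp only [wordCount_eq_sum, ← Finset.prod_pow_eq_pow_sum]
  rw [Finset.prod_comm]
  refine Finset.prod_congr rfl fun i _ => ?_
  rw [Finset.prod_eq_single (x i)] <;> simp +contextual [eq_comm]

/-- The tensor powers of a cohomomorphism map type graphs to type graphs. -/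
theorem exists_map_typeClass {W W' : DimGraph} (h : W.toNC.CohomLE W'.toNC) :
    ∃ φ : W.graph.V → W'.graph.V, ∀ c : W.graph.V → ℕ,
      NCClass.ofGraphClass (typeClass W.graph c) *
          (idealQuantum (∏ v, W.dim v ^ c v)).toClass ≤
        NCClass.ofGraphClass (typeClass W'.graph (pushCount φ c)) *
          (idealQuantum (∏ v, W'.dim v ^ pushCount φ c v)).toClass := by
  obtain ⟨φ, v, m, hm, hv⟩ := exists_isometries h
  refine ⟨φ, fun c => ?_⟩
  rw [← toClass_wordGraph (I := Fin (∑ v, c v)) (c := pushCount φ c) (by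
    rw [sum_pushCount]; simp)]
  set I := Fin (∑ v, c v)
  set G := wordGraph I W.graph c with hG
  set G' := wordGraph I W'.graph (pushCount φ c) with hG'
  set d := ∏ v, W.dim v ^ c v
  set d' := ∏ v, W'.dim v ^ pushCount φ c v
  let Φ : G.V → G'.V := fun x => ⟨φ ∘ x.1, by rw [wordCount_comp, x.2]⟩
  -- On a type graph the total dimension depends only on the type, so a single ideal channel serves
  -- all words.
  have hd : ∀ x : G.V, ∏ i, W.dim (x.1 i) = d := fun x => by
    rw [← prod_pow_wordCount, x.2]
  have hd' : ∀ x : G'.V, ∏ i, W'.dim (x.1 i) = d' := fun x => by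
    rw [← prod_pow_wordCount, x.2]
  -- The isometry at a word is the tensor product of the isometries at its letters, written in the
  -- chosen product bases.
  refine cohomLE_of_isometries (G := G) (G' := G') Φ
    (fun x => Matrix.of fun B A => ∏ i, v (x.1 i) (decode _ (hd' (Φ x)) B i) (decode _ (hd x) A i))
    (fun x y => ∏ i, m (x.1 i) (y.1 i)) (fun x => by simp [hm]) (fun x y hxy hn => ?_)
    fun x y hxy => ?_
  · rw [wordGraph_adjEq] at hxy hn
    rw [not_forall] at hn
    obtain ⟨i, hi⟩ := hn
    exact Finset.prod_eq_zero (Finset.mem_univ i) ((hv _ _ (hxy i)).1 hi)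
  · rw [wordGraph_adjEq] at hxy
    ext A B
    rw [Matrix.mul_apply, Matrix.smul_apply, Matrix.one_apply]
    have e : decode _ (hd' (Φ x)) = decode _ (hd' (Φ y)) :=
      decode_congr (funext fun i => W'.dim_eq _ _ (hxy i)) _ _
    simp only [Matrix.conjTranspose_apply, Matrix.of_apply, ← e, star_prod,
      ← Finset.prod_mul_distrib]
    rw [sum_prod_decode (fun i => W'.dim ((Φ x).1 i)) (hd' (Φ x)) fun i k =>
      star (v (x.1 i) k (decode _ (hd x) A i)) * v (y.1 i) k (decode _ (hd y) B i)]
    have h₁ : ∀ i, ∑ k ∈ Finset.range (W'.dim ((Φ x).1 i)),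
        star (v (x.1 i) k (decode _ (hd x) A i)) * v (y.1 i) k (decode _ (hd y) B i) =
        if decode _ (hd x) A i = decode _ (hd y) B i then m (x.1 i) (y.1 i) else 0 := fun i =>
      (hv _ _ (hxy i)).2 _ (decode_lt (fun i => W.dim (x.1 i)) _ _ _) _
        (decode_lt (fun i => W.dim (y.1 i)) _ _ _)
    simp only [h₁]
    -- If the source words are `≃`, they share a basis and the product of Kronecker deltas is the
    -- delta of the codes. Otherwise their bases may differ, but some factor `m` vanishes and both
    -- sides are zero.
    by_cases hadj : ∀ i, W.graph.AdjEq (x.1 i) (y.1 i)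
    · have e' : decode _ (hd x) = decode _ (hd y) :=
        decode_congr (funext fun i => W.dim_eq _ _ (hadj i)) _ _
      by_cases hAB : A = B
      · subst hAB
        simp [e']
      · rw [if_neg hAB, smul_zero]
        have : decode _ (hd x) A ≠ decode _ (hd y) B := by
          rw [e']
          exact fun h => hAB (decode_injective _ _ h)
        obtain ⟨i, hi⟩ := Function.ne_iff.1 this
        exact Finset.prod_eq_zero (Finset.mem_univ i) (if_neg hi)
    · rw [not_forall] at hadj
      obtain ⟨i, hi⟩ := hadj
      have h0 : m (x.1 i) (y.1 i) = 0 := (hv _ _ (hxy i)).1 hi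
      rw [Finset.prod_eq_zero (Finset.mem_univ i) (by rw [h0, ite_self]),
        Finset.prod_eq_zero (Finset.mem_univ i) h0, zero_smul]

/-! ## Geometric means of admissible pairs -/

theorem IsFAlpha.apply_graphA_mul_quantumA {f : GraphClass →+* ℝ≥0} {α : ℝ} {φ : algA →+* ℝ≥0}
    (h : IsFAlpha f α φ) (G : FinGraph) {D : ℕ} (hD : 0 < D) :
    φ (graphA G * quantumA D) = f G.toClass * (D : ℝ≥0) ^ α := by
  obtain ⟨k, rfl⟩ := Nat.exists_eq_succ_of_ne_zero hD.ne'
  -- Index `k` stands for dimension `k + 1 = D`; all other summands are empty graphs and contribute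
  -- nothing.
  have h₁ := h (k + 1) fun i => if i = Fin.last k then G else FinGraph.empty
  have h₀ : graphA FinGraph.empty = 0 := Subtype.ext <|
    NCGraph.toClass_eq_of_isEmpty (S := ofGraph FinGraph.empty) (T := NCGraph.zero)
  have h₂ : f FinGraph.empty.toClass = 0 := map_zero f
  rw [familyA, Finset.sum_eq_single (Fin.last k), Finset.sum_eq_single (Fin.last k)] at h₁
  · simpa using h₁
  · intro i _ hi
    rw [if_neg hi, h₂, zero_mul]
  · simp
  · intro i _ hi
    rw [if_neg hi, h₀, zero_mul]
  · simp

theorem IsAdmissible.mul_rpow_le {f : GraphClass →+* ℝ≥0} {α : ℝ} (h : IsAdmissible f α)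
    {G G' : FinGraph} {D D' : ℕ} (hD : 0 < D) (hD' : 0 < D')
    (hle : NCClass.ofGraphClass G.toClass * (idealQuantum D).toClass ≤
      NCClass.ofGraphClass G'.toClass * (idealQuantum D').toClass) :
    f G.toClass * (D : ℝ≥0) ^ α ≤ f G'.toClass * (D' : ℝ≥0) ^ α := by
  obtain ⟨-, φ, hφ, hfα⟩ := h
  rw [← hfα.apply_graphA_mul_quantumA G hD, ← hfα.apply_graphA_mul_quantumA G' hD']
  exact hφ hle

/-- The weights of the vertices of a dimension-labelled graph. -/
noncomputable def DimGraph.weight (W : DimGraph) (γ : ℝ) (v : W.graph.V) : ℝ≥0 :=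
  (W.dim v : ℝ≥0) ^ γ

theorem DimGraph.one_le_weight (W : DimGraph) {γ : ℝ} (hγ : 0 ≤ γ) (v : W.graph.V) :
    1 ≤ W.weight γ v :=
  NNReal.one_le_rpow (by exact_mod_cast W.dim_pos v) hγ

theorem DimGraph.prod_weight_pow (W : DimGraph) (γ : ℝ) (c : W.graph.V → ℕ) :
    ∏ v, W.weight γ v ^ c v = ((∏ v, W.dim v ^ c v : ℕ) : ℝ≥0) ^ γ := by
  push_cast
  rw [← NNReal.finsetProd_rpow]
  refine Finset.prod_congr rfl fun v _ => ?_
  rw [DimGraph.weight, ← NNReal.rpow_mul_natCast, ← NNReal.rpow_natCast_mul, mul_comm]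

section GeomMean

variable {f g : GraphClass →+* ℝ≥0} {α β a b : ℝ}

/-- The reason why the exponents combine as `a * α + b * β`: with these weights the value at a type
is exactly the geometric mean of the numbers `f_α` and `g_β` of the type graph tensor the ideal
channel of its total dimension. -/
theorem typeValue_geomMean_weight (ha : 0 ≤ a) (hb : 0 ≤ b) (hα : 0 ≤ α) (hβ : 0 ≤ β)
    (W : DimGraph) (c : W.graph.V → ℕ) :
    typeValue (geomMean (f : GraphClass →* ℝ≥0) g a b) W.graph (W.weight (a * α + b * β)) c =
      (f (typeClass W.graph c) * ((∏ v, W.dim v ^ c v : ℕ) : ℝ≥0) ^ α) ^ a *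
        (g (typeClass W.graph c) * ((∏ v, W.dim v ^ c v : ℕ) : ℝ≥0) ^ β) ^ b := by
  rw [typeValue, DimGraph.prod_weight_pow,
    NNReal.rpow_add_of_nonneg _ (mul_nonneg ha hα) (mul_nonneg hb hβ), NNReal.mul_rpow,
    NNReal.mul_rpow, ← NNReal.rpow_mul, ← NNReal.rpow_mul, mul_comm a α, mul_comm b β]
  change f _ ^ a * g _ ^ b * _ = _
  ring

/-- Type by type, `exists_map_typeClass` provides an inequality in `𝒜`. Monotonicity of `f_α` and of
`g_β` turns it into two numerical inequalities, which are then raised to the powers `a` and `b` and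
multiplied. -/
theorem value_le_of_cohomLE (hf : IsNormalized (f : GraphClass →* ℝ≥0))
    (hg : IsNormalized (g : GraphClass →* ℝ≥0)) (hfα : IsAdmissible f α) (hgβ : IsAdmissible g β)
    (ha : 0 ≤ a) (hb : 0 ≤ b) (hab : a + b = 1) {W W' : DimGraph}
    (h : W.toNC.CohomLE W'.toNC) :
    value (geomMean (f : GraphClass →* ℝ≥0) g a b) W.graph (W.weight (a * α + b * β)) ≤
      value (geomMean (f : GraphClass →* ℝ≥0) g a b) W'.graph (W'.weight (a * α + b * β)) := by
  obtain ⟨φ, hφ⟩ := exists_map_typeClass h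
  have hα : 0 ≤ α := zero_le_one.trans hfα.1
  have hβ : 0 ≤ β := zero_le_one.trans hgβ.1
  refine value_mono (hf.geomMean hg ha hb hab) φ fun c => ?_
  rw [typeValue_geomMean_weight ha hb hα hβ, typeValue_geomMean_weight ha hb hα hβ]
  have hpos : ∀ (W : DimGraph) (c : W.graph.V → ℕ), 0 < ∏ v, W.dim v ^ c v := fun W c =>
    Finset.prod_pos fun v _ => pow_pos (W.dim_pos v) _
  exact mul_le_mul'
    (NNReal.rpow_le_rpow (hfα.mul_rpow_le (hpos _ _) (hpos _ _) (hφ c)) ha)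
    (NNReal.rpow_le_rpow (hgβ.mul_rpow_le (hpos _ _) (hpos _ _) (hφ c)) hb)

end GeomMean

/-- The element of the asymptotic spectrum of graphs given by the growth rates of a functional. -/
noncomputable def valueHom {F : GraphClass →* ℝ≥0} (hF : IsNormalized F) : GraphClass →+* ℝ≥0 where
  toFun := Quotient.lift (fun G => value F G 1) fun G H ⟨e⟩ =>
    le_antisymm
      (value_mono_of_hom hF e (fun x y => (adjEq_iff_of_iso e x y).1) fun _ => le_rfl)
      (value_mono_of_hom hF e.symm (fun x y => (adjEq_iff_of_iso e.symm x y).1) fun _ => le_rfl)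
  map_zero' := value_eq_zero (G := FinGraph.empty) 1
  map_one' := value_point hF 1
  map_add' X Y := Quotient.inductionOn₂ X Y fun G H => by
    have := value_disjUnion hF (G := G) (H := H) (w := 1) (w' := 1) (fun _ => le_rfl)
      fun _ => le_rfl
    refine Eq.trans ?_ this
    change value F (G.disjUnion H) 1 = _
    congr 1
    ext (v | v) <;> rfl
  map_mul' X Y := Quotient.inductionOn₂ X Y fun G H => by
    have := value_strongProd hF (G := G) (H := H) (w := 1) (w' := 1) (fun _ => le_rfl)
      fun _ => le_rfl
    refine Eq.trans ?_ this
    change value F (G.strongProd H) 1 = _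
    congr 1
    ext v
    simp

theorem valueHom_toClass {F : GraphClass →* ℝ≥0} (hF : IsNormalized F) (G : FinGraph) :
    valueHom hF G.toClass = value F G 1 := rfl

theorem valueHom_mem {F : GraphClass →* ℝ≥0} (hF : IsNormalized F) :
    valueHom hF ∈ asymptoticSpectrum GraphClass := by
  intro X Y
  refine Quotient.inductionOn₂ X Y fun G H h => ?_
  obtain ⟨φ, hφ⟩ := toClass_le_iff.1 h
  exact value_mono_of_hom hF φ hφ fun _ => le_rfl

/-- Values that are monotone on the dimension-labelled graphs define an admissible pair. -/
theorem isAdmissible_valueHom {F : GraphClass →* ℝ≥0} (hF : IsNormalized F) {γ : ℝ} (hγ : 1 ≤ γ)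
    (hmono : ∀ W W' : DimGraph, W.toNC.CohomLE W'.toNC →
      value F W.graph (W.weight γ) ≤ value F W'.graph (W'.weight γ)) :
    IsAdmissible (valueHom hF) γ := by
  have hγ0 : 0 ≤ γ := zero_le_one.trans hγ
  choose rep hrep using exists_dimGraph
  let val : DimGraph → ℝ≥0 := fun W => value F W.graph (W.weight γ)
  have hle : ∀ W W' : DimGraph, W.toNC.toClass ≤ W'.toNC.toClass → val W ≤ val W' :=
    fun W W' h => hmono W W' h
  -- Monotonicity alone makes the value independent of the representative: equal classes are
  -- comparable in both directions.
  have heq : ∀ (x : algA) (W : DimGraph), W.toNC.toClass = x.1 → val (rep x) = val W :=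
    fun x W h => le_antisymm (hle _ _ (by rw [hrep, h])) (hle _ _ (by rw [hrep, h]))
  have hgraph : ∀ G : FinGraph, val (rep (graphA G)) = value F G 1 := fun G => by
    rw [heq _ _ (toClass_toNC_const_one G)]
    change value F G _ = _
    congr 1
    ext v
    simp [DimGraph.weight]
  have hquantum : ∀ d : ℕ, val (rep (quantumA (d + 1))) = ((d : ℝ≥0) + 1) ^ γ := fun d => by
    rw [heq _ _ (toClass_toNC_const_point (d + 1) d.succ_pos)]
    refine (value_point hF (((d + 1 : ℕ) : ℝ≥0) ^ γ)).trans ?_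
    push_cast
    rfl
  have hzero : val (rep 0) = 0 := by
    rw [heq 0 (DimGraph.const FinGraph.empty 1 one_pos) ?_]
    · exact value_eq_zero (G := FinGraph.empty) _
    · have : IsEmpty (DimGraph.const FinGraph.empty 1 one_pos).toNC.ι := ⟨fun p => p.1.elim⟩
      exact NCGraph.toClass_eq_of_isEmpty (T := NCGraph.zero)
  have hunit : val (rep 1) = 1 := by
    have h₁ := hquantum 0
    have h₂ : quantumA (0 + 1) = 1 := Subtype.ext toClass_idealQuantum_one
    rw [h₂] at h₁
    simpa using h₁
  have hadd : ∀ x y, val (rep (x + y)) = val (rep x) + val (rep y) := fun x y => by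
    rw [heq (x + y) ((rep x).disjUnion (rep y)) (by
      rw [DimGraph.toClass_toNC_disjUnion, hrep, hrep]; rfl)]
    rw [← value_disjUnion hF ((rep x).one_le_weight hγ0) ((rep y).one_le_weight hγ0)]
    change value F _ _ = _
    congr 1
    ext (v | v) <;> rfl
  have hmul : ∀ x y, val (rep (x * y)) = val (rep x) * val (rep y) := fun x y => by
    rw [heq (x * y) ((rep x).strongProd (rep y)) (by
      rw [DimGraph.toClass_toNC_strongProd, hrep, hrep]; rfl)]
    -- Dimensions multiply in the strong product, so the weights `dim ^ γ` do as well.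
    rw [← value_strongProd hF ((rep x).one_le_weight hγ0) ((rep y).one_le_weight hγ0)]
    change value F _ _ = _
    congr 1
    ext v
    simp [DimGraph.weight, NNReal.mul_rpow]
  let φ : algA →+* ℝ≥0 :=
    { toFun := fun x => val (rep x)
      map_zero' := hzero
      map_one' := hunit
      map_add' := hadd
      map_mul' := hmul }
  refine ⟨hγ, φ, fun x y hxy => hle _ _ (by rw [hrep, hrep]; exact hxy), fun r G => ?_⟩
  rw [familyA, map_sum]
  refine Finset.sum_congr rfl fun d _ => ?_
  rw [map_mul]
  exact congrArg₂ (· * ·) (hgraph (G d)) (hquantum d)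

/-- The weighted geometric means of admissible pairs on the level of the refinements. -/
theorem exists_geomMean {f g : GraphClass →+* ℝ≥0} (hf : f ∈ asymptoticSpectrum GraphClass)
    (hg : g ∈ asymptoticSpectrum GraphClass) {α β : ℝ} (hfα : IsAdmissible f α)
    (hgβ : IsAdmissible g β) {a b : ℝ} (ha : 0 ≤ a) (hb : 0 ≤ b) (hab : a + b = 1) :
    ∃ h ∈ asymptoticSpectrum GraphClass,
      (∀ G : FinGraph, ∀ Q ∈ stdSimplex ℝ G.V, Real.log (probRefinement h G Q) =
        a * Real.log (probRefinement f G Q) + b * Real.log (probRefinement g G Q)) ∧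
      IsAdmissible h (a * α + b * β) := by
  have hF := (isNormalized_of_mem hf).geomMean (isNormalized_of_mem hg) ha hb hab
  refine ⟨valueHom hF, valueHom_mem hF, fun G Q hQ => ?_, isAdmissible_valueHom hF ?_
    fun W W' h => value_le_of_cohomLE (isNormalized_of_mem hf) (isNormalized_of_mem hg) hfα hgβ
      ha hb hab h⟩
  · obtain ⟨L, hL⟩ := exists_hasLogRate (isNormalized_of_mem hf) G hQ
    obtain ⟨L', hL'⟩ := exists_hasLogRate (isNormalized_of_mem hg) G hQ
    have h := (HasLogRate.geomMean (a := a) (b := b) (isNormalized_of_mem hf)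
      (isNormalized_of_mem hg) hL hL').of_value hF
      (F' := (valueHom hF : GraphClass →* ℝ≥0)) (valueHom_toClass hF)
    rw [probRefinement_eq_exp hf hQ hL, probRefinement_eq_exp hg hQ hL',
      probRefinement_eq_exp (valueHom_mem hF) hQ h, Real.log_exp, Real.log_exp, Real.log_exp]
  · nlinarith [hfα.1, hgβ.1, mul_le_mul_of_nonneg_left hfα.1 ha,
      mul_le_mul_of_nonneg_left hgβ.1 hb]

theorem ProbFamily.cond_mem (X : ProbFamily) (d : Fin X.r) (hd : X.marginal d ≠ 0) :
    X.cond d ∈ stdSimplex ℝ (X.G d).V := by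
  have h0 : 0 ≤ X.marginal d := Finset.sum_nonneg fun v _ => X.Q_mem.1 _
  refine ⟨fun v => div_nonneg (X.Q_mem.1 _) h0, ?_⟩
  change ∑ v, X.Q ⟨d, v⟩ / X.marginal d = 1
  rw [← Finset.sum_div]
  exact div_self hd

/-- The entropy term is common to all functionals and `a + b = 1`. A component with zero marginal
has no normalized restriction in the simplex, but its factor `X.marginal d` makes the term vanish.
-/
theorem logRefinement_convexCombination {f g h : GraphClass →+* ℝ≥0} {α β a b : ℝ}
    (hab : a + b = 1)
    (hh : ∀ G : FinGraph, ∀ Q ∈ stdSimplex ℝ G.V, Real.log (probRefinement h G Q) =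
      a * Real.log (probRefinement f G Q) + b * Real.log (probRefinement g G Q)) :
    a • logRefinement f α + b • logRefinement g β = logRefinement h (a * α + b * β) := by
  ext X
  simp only [Pi.add_apply, Pi.smul_apply, smul_eq_mul, logRefinement]
  have h₁ : ∀ d : Fin X.r, X.marginal d * (Real.log (probRefinement h (X.G d) (X.cond d)) +
      (a * α + b * β) * Real.log ((d : ℝ) + 1)) =
      a * (X.marginal d * (Real.log (probRefinement f (X.G d) (X.cond d)) +
        α * Real.log ((d : ℝ) + 1))) + b * (X.marginal d *
        (Real.log (probRefinement g (X.G d) (X.cond d)) + β * Real.log ((d : ℝ) + 1))) := by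
    intro d
    by_cases hd : X.marginal d = 0
    · rw [hd]
      ring
    · rw [hh _ _ (X.cond_mem d hd)]
      ring
  simp only [h₁, Finset.sum_add_distrib, ← Finset.mul_sum]
  linear_combination (∑ d, Real.negMulLog (X.marginal d)) * hab

end ZeroError

theorem mainTheorem2 :
    (∀ f ∈ ZeroError.asymptoticSpectrum ZeroError.GraphClass, ∀ G : ZeroError.FinGraph,
      ∀ Q ∈ stdSimplex ℝ G.V,
        ZeroError.IsRefinementValue f G Q (ZeroError.probRefinement f G Q) ∧
          0 < ZeroError.probRefinement f G Q) ∧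
    Convex ℝ ZeroError.logFunctionals ∧
    (∀ f ∈ ZeroError.asymptoticSpectrum ZeroError.GraphClass,
      ∀ g ∈ ZeroError.asymptoticSpectrum ZeroError.GraphClass, ∀ α β : ℝ,
        ZeroError.IsAdmissible f α → ZeroError.IsAdmissible g β →
          ∀ a b : ℝ, 0 ≤ a → 0 ≤ b → a + b = 1 →
            ∃ h ∈ ZeroError.asymptoticSpectrum ZeroError.GraphClass,
              (∀ G : ZeroError.FinGraph, ∀ Q ∈ stdSimplex ℝ G.V,
                Real.log (ZeroError.probRefinement h G Q) =
                  a * Real.log (ZeroError.probRefinement f G Q) +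
                    b * Real.log (ZeroError.probRefinement g G Q)) ∧
              ZeroError.IsAdmissible h (a * α + b * β)) := by
  refine ⟨fun f hf G Q hQ => ?_, ?_, fun f hf g hg α β hfα hgβ a b ha hb hab =>
    ZeroError.exists_geomMean hf hg hfα hgβ ha hb hab⟩
  · obtain ⟨L, hL⟩ := ZeroError.exists_hasLogRate (ZeroError.isNormalized_of_mem hf) G hQ
    rw [ZeroError.probRefinement_eq_exp hf hQ hL]
    exact ⟨ZeroError.isRefinementValue_of_hasLogRate hf hL, Real.exp_pos L⟩
  · rintro _ ⟨f, hf, α, hfα, rfl⟩ _ ⟨g, hg, β, hgβ, rfl⟩ a b ha hb hab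
    obtain ⟨h, hh, hlog, hadm⟩ := ZeroError.exists_geomMean hf hg hfα hgβ ha hb hab
    exact ⟨h, hh, _, hadm, ZeroError.logRefinement_convexCombination hab hlog⟩
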